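/- Let $\mathcal H$ be a complex separable Hilbert space, let $A_-$ be a self-adjoint operator in $\mathcal H$, and let $B(t)$ and $B'(t)$, $t\in\mathbb R$, be two families of closed symmetric operators in $\mathcal H$ whose domains all contain $\operatorname{dom}(A_-)$. Here $|T|=(T^*T)^{1/2}$, and $\|\cdot\|_{\mathcal B_1}$ denotes the trace norm. Assume: (a) the family $B(t)(|A_-|+I)^{-1}$, $t\in\mathbb R$, is weakly locally absolutely continuous, and for all $g,h\in\mathcal H$ and a.e. $t\in\mathbb R$, $$\frac{d}{dt}\big(g,B(t)(|A_-|+I)^{-1}h\big)=\big(g,B'(t)(|A_-|+I)^{-1}h\big);$$ (b) $B'(t)(|A_-|+I)^{-1}$ is trace class for every $t\in\mathbb R$, and $\int_{\mathbb R}\|B'(t)(|A_-|+I)^{-1}\|_{\mathcal B_1}\,dt<\infty$; (c) the families $(|B(t)|^2+I)^{-1}$ and $(|B'(t)|^2+I)^{-1}$, $t\in\mathbb R$, are weakly measurable; (d) $B(t)(|A_-|+I)^{-1}\to 0$ weakly as $t\to-\infty$. Put $A(t)=A_-+B(t)$ with $\operatorname{dom}(A(t))=\operatorname{dom}(A_-)$.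 Let $\boldsymbol A$ be the operator in $L^2(\mathbb R;\mathcal H)$ given by $(\boldsymbol A f)(t)=A(t)f(t)$ for a.e. $t$, with domain all $f\in L^2(\mathbb R;\mathcal H)$ such that $f(t)\in\operatorname{dom}(A(t))$ for a.e. $t$ and $t\mapsto A(t)f(t)$ is measurable and square integrable, and let $\boldsymbol A_-$ be the operator obtained in the same way with $A_-$ in place of $A(t)$. Let $d/dt$ be the operator in $L^2(\mathbb R;\mathcal H)$ whose domain consists of all locally absolutely continuous $f\in L^2(\mathbb R;\mathcal H)$ with $f'\in L^2(\mathbb R;\mathcal H)$, and define $$\boldsymbol D_{\boldsymbol A}=\frac{d}{dt}+\boldsymbol A,\qquad \operatorname{dom}(\boldsymbol D_{\boldsymbol A})=\operatorname{dom}(d/dt)\cap\operatorname{dom}(\boldsymbol A_-).$$ Then there is a unique self-adjoint operator $A_+$ in $\mathcal H$ such that $A(t)\to A_+$ in the norm resolvent sense as $t\to+\infty$ (that is, $(A(t)-zI)^{-1}\to(A_+-zI)^{-1}$ in operator norm for all $z\in\mathbb C\setminus\mathbb R$), the operator $\boldsymbol D_{\boldsymbol A}$ is densely defined and closed, and $$\sigma_{\rm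 ess}(\boldsymbol D_{\boldsymbol A})=(\sigma(A_+)+i\mathbb R)\cup(\sigma(A_-)+i\mathbb R),$$ where $\sigma_{\rm ess}(T)$ is the set of all $\lambda\in\mathbb C$ for which $T-\lambda I$ is not Fredholm, and a densely defined closed operator $T$ is Fredholm if its range is closed and the kernels of $T$ and $T^*$ are finite dimensional. -/

import Mathlib

open MeasureTheory Filter Topology
open scoped ENNReal LinearPMap Pointwise

noncomputable section

namespace ModelOperator

section Unbounded

variable {H : Type*} [NormedAddCommGroup H] [InnerProductSpace ℂ H]

/-- The unbounded operator `T - z I`, with domain `dom T`. -/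
def shift (T : H →ₗ.[ℂ] H) (z : ℂ) : H →ₗ.[ℂ] H :=
  (-(z • (LinearMap.id : H →ₗ[ℂ] H))) +ᵥ T

/-- The bounded operator `R` is the everywhere defined two-sided inverse of `T - z I`. -/
def IsResolventAt (T : H →ₗ.[ℂ] H) (z : ℂ) (R : H →L[ℂ] H) : Prop :=
  (∀ y : H, ∃ h : R y ∈ (shift T z).domain, shift T z ⟨R y, h⟩ = y) ∧
    ∀ x : (shift T z).domain, R (shift T z x) = x

/-- The resolvent set `ρ(T)`. -/
def resolventSet (T : H →ₗ.[ℂ] H) : Set ℂ := {z | ∃ R : H →L[ℂ] H, IsResolventAt T z R}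

/-- The spectrum `σ(T)`, the complement of the resolvent set. -/
def spec (T : H →ₗ.[ℂ] H) : Set ℂ := (resolventSet T)ᶜ

open scoped Classical in
/-- The resolvent `(T - z I)⁻¹` for `z ∈ ρ(T)` (and `0` for `z` in the spectrum). -/
def resolv (T : H →ₗ.[ℂ] H) (z : ℂ) : H →L[ℂ] H :=
  if h : ∃ R : H →L[ℂ] H, IsResolventAt T z R then h.choose else 0

open scoped Classical in
/-- The value `T x` for `x ∈ dom T`, extended by `0` to vectors outside of the domain. -/
def val (T : H →ₗ.[ℂ] H) (x : H) : H := if h : x ∈ T.domain then T ⟨x, h⟩ else 0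

theorem val_add {T : H →ₗ.[ℂ] H} {x y : H} (hx : x ∈ T.domain) (hy : y ∈ T.domain) :
    val T (x + y) = val T x + val T y := by
  rw [val, val, val, dif_pos hx, dif_pos hy, dif_pos (T.domain.add_mem hx hy), ← T.map_add]
  rfl

theorem val_smul {T : H →ₗ.[ℂ] H} (c : ℂ) {x : H} (hx : x ∈ T.domain) :
    val T (c • x) = c • val T x := by
  rw [val, val, dif_pos hx, dif_pos (T.domain.smul_mem c hx), ← T.map_smul]
  rfl

theorem val_zero (T : H →ₗ.[ℂ] H) : val T 0 = 0 := by
  rw [val, dif_pos T.domain.zero_mem]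
  exact T.map_zero

/-- The composition `S T` on its natural domain `{x ∈ dom T | T x ∈ dom S}`. -/
def mul (S T : H →ₗ.[ℂ] H) : H →ₗ.[ℂ] H :=
  S.comp (T.domRestrict ((S.domain.comap T.toFun).map T.domain.subtype)) (by
    rintro ⟨x, hx, hx'⟩
    obtain ⟨y, hy, rfl⟩ := hx
    exact hy)

/-- The operators `A(t)` converge to `A'` along the filter `l` in the norm resolvent sense. -/
def NormResolventTendsto (A : ℝ → H →ₗ.[ℂ] H) (l : Filter ℝ) (A' : H →ₗ.[ℂ] H) : Prop :=
  ∀ z : ℂ, z.im ≠ 0 → (∀ t, z ∈ resolventSet (A t)) ∧ z ∈ resolventSet A' ∧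
    Tendsto (fun t => resolv (A t) z) l (𝓝 (resolv A' z))

variable [CompleteSpace H]

/-- `S` is a nonnegative self-adjoint operator with `S² = T* T`. -/
def IsAbs (T S : H →ₗ.[ℂ] H) : Prop :=
  IsSelfAdjoint S ∧ (∀ x : S.domain, 0 ≤ (inner ℂ (S x) (x : H)).re) ∧ mul S S = mul (T†) T

/-- `|T|`, the nonnegative self-adjoint square root of `T* T`, which exists and is unique whenever
`T` is closed and densely defined. -/
def absOp (T : H →ₗ.[ℂ] H) : H →ₗ.[ℂ] H := Classical.epsilon (IsAbs T)

/-- `(|T| + I)⁻¹`. -/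
def absInv (T : H →ₗ.[ℂ] H) : H →L[ℂ] H := resolv (absOp T) (-1)

/-- `(|T|² + I)⁻¹`. -/
def absSqInv (T : H →ₗ.[ℂ] H) : H →L[ℂ] H := resolv (mul (absOp T) (absOp T)) (-1)

/-- `T` is a Fredholm operator: it is densely defined and closed, its range is closed, and the
kernels of `T` and of `T*` are finite dimensional. -/
def IsFredholm (T : H →ₗ.[ℂ] H) : Prop :=
  Dense (T.domain : Set H) ∧ T.IsClosed ∧ IsClosed (LinearMap.range T.toFun : Set H) ∧
    FiniteDimensional ℂ (LinearMap.ker T.toFun) ∧ FiniteDimensional ℂ (LinearMap.ker (T†).toFun)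

/-- The essential spectrum: all `z ∈ ℂ` for which `T - z I` is not Fredholm. -/
def essSpec (T : H →ₗ.[ℂ] H) : Set ℂ := {z | ¬ IsFredholm (shift T z)}

/-- The trace norm `tr |K|` of a bounded operator, with values in `[0, ∞]`; the trace of the
nonnegative operator `|K|` does not depend on the orthonormal basis. -/
def traceNorm (K : H →L[ℂ] H) : ℝ≥0∞ :=
  ⨆ (w : Set H) (b : HilbertBasis w ℂ H),
    ∑' i, ENNReal.ofReal (inner ℂ (b i) (CFC.abs K (b i))).re

/-- The standing assumptions: a self-adjoint operator `A₋` and a family `B(t)` of closed symmetric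
operators which is relatively trace class with respect to `A₋`. -/
structure RelTraceClassFamily (Aminus : H →ₗ.[ℂ] H) (B B' : ℝ → H →ₗ.[ℂ] H) : Prop where
  selfAdjoint : IsSelfAdjoint Aminus
  closed : ∀ t, (B t).IsClosed
  symm : ∀ t, (B t).IsFormalAdjoint (B t)
  dom_le : ∀ t, Aminus.domain ≤ (B t).domain
  closed' : ∀ t, (B' t).IsClosed
  symm' : ∀ t, (B' t).IsFormalAdjoint (B' t)
  dom_le' : ∀ t, Aminus.domain ≤ (B' t).domain
  /-- `B(t) (|A₋| + I)⁻¹` is weakly locally absolutely continuous. -/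
  absCont : ∀ (g h : H) (a b : ℝ),
    AbsolutelyContinuousOnInterval (fun t => inner ℂ g (val (B t) (absInv Aminus h))) a b
  hasDeriv : ∀ g h : H, ∀ᵐ t : ℝ,
    HasDerivAt (fun s => inner ℂ g (val (B s) (absInv Aminus h)))
      (inner ℂ g (val (B' t) (absInv Aminus h))) t
  /-- `B'(t) (|A₋| + I)⁻¹` is trace class, with integrable trace norm. -/
  traceClass : ∃ K : ℝ → H →L[ℂ] H, (∀ t h, K t h = val (B' t) (absInv Aminus h)) ∧
    (∀ t, traceNorm (K t) < ∞) ∧ ∫⁻ t, traceNorm (K t) < ∞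
  measurable : ∀ g h : H, AEMeasurable (fun t : ℝ => inner ℂ g (absSqInv (B t) h))
  measurable' : ∀ g h : H, AEMeasurable (fun t : ℝ => inner ℂ g (absSqInv (B' t) h))
  /-- `A₋` is the asymptote of `A₋ + B(t)` at `-∞`: the perturbation vanishes there. -/
  tendsto_atBot : ∀ g h : H,
    Tendsto (fun t => inner ℂ g (val (B t) (absInv Aminus h))) atBot (𝓝 0)

end Unbounded

section Model

variable (H : Type*) [NormedAddCommGroup H] [InnerProductSpace ℂ H]

/-- The Hilbert space `L²(ℝ; H)`. -/
abbrev L2 : Type _ := Lp H 2 (volume : Measure ℝ)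

variable {H}

/-- `f` has a locally absolutely continuous representative `u`, with derivative `h ∈ L²(ℝ; H)`. -/
def HasL2Deriv (f h : L2 H) : Prop :=
  ∃ u : ℝ → H, u =ᵐ[volume] f ∧ ∀ t₀ t : ℝ, u t = u t₀ + ∫ s in t₀..t, h s

theorem L2.intervalIntegrable (h : L2 H) (a b : ℝ) : IntervalIntegrable h volume a b :=
  (LocallyIntegrable.integrableOn_isCompact (MemLp.locallyIntegrable (Lp.memLp h) (by norm_num))
    isCompact_uIcc).intervalIntegrable

/-- The graph of `d/dt` in `L²(ℝ; H)`. -/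
def ddtGraph : Submodule ℂ (L2 H × L2 H) where
  carrier := {p | HasL2Deriv p.1 p.2}
  zero_mem' := by
    refine ⟨fun _ => 0, (Lp.coeFn_zero H 2 volume).symm, fun t₀ t => ?_⟩
    have : ∫ s in t₀..t, ((0 : L2 H) : ℝ → H) s = ∫ s in t₀..t, (0 : H) :=
      intervalIntegral.integral_congr_ae ((Lp.coeFn_zero H 2 volume).mono fun s hs _ => hs)
    change (0 : H) = 0 + ∫ s in t₀..t, ((0 : L2 H) : ℝ → H) s
    rw [this, intervalIntegral.integral_zero, add_zero]
  add_mem' := by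
    rintro ⟨f, h⟩ ⟨f', h'⟩ ⟨u, hu, hu'⟩ ⟨v, hv, hv'⟩
    refine ⟨u + v, ?_, fun t₀ t => ?_⟩
    · exact (hu.add hv).trans (Lp.coeFn_add f f').symm
    · have : ∫ s in t₀..t, ((h + h' : L2 H) : ℝ → H) s = ∫ s in t₀..t, (h s + h' s) :=
        intervalIntegral.integral_congr_ae ((Lp.coeFn_add h h').mono fun s hs _ => hs)
      simp only [Pi.add_apply, Prod.mk_add_mk]
      rw [this, intervalIntegral.integral_add (L2.intervalIntegrable h _ _)
        (L2.intervalIntegrable h' _ _), hu' t₀ t, hv' t₀ t]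
      abel
  smul_mem' := by
    rintro c ⟨f, h⟩ ⟨u, hu, hu'⟩
    refine ⟨c • u, ?_, fun t₀ t => ?_⟩
    · exact (hu.const_smul c).trans (Lp.coeFn_smul c f).symm
    · have : ∫ s in t₀..t, ((c • h : L2 H) : ℝ → H) s = ∫ s in t₀..t, c • h s :=
        intervalIntegral.integral_congr_ae ((Lp.coeFn_smul c h).mono fun s hs _ => hs)
      simp only [Pi.smul_apply, Prod.smul_mk]
      rw [this, intervalIntegral.integral_smul, hu' t₀ t, smul_add]

/-- The operator `d/dt` in `L²(ℝ; H)`, with domain all `f ∈ L²(ℝ; H)` that are locally absolutely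
continuous with derivative in `L²(ℝ; H)`. -/
def ddt : L2 H →ₗ.[ℂ] L2 H := (ddtGraph (H := H)).toLinearPMap

/-- The derivative is determined by the function, so that `ddtGraph` is the graph of `ddt`. -/
theorem ddt_graph [CompleteSpace H] : (ddt (H := H)).graph = ddtGraph := by
  refine Submodule.toLinearPMap_graph_eq _ ?_
  rintro ⟨f, h⟩ ⟨u, hu, hu'⟩ hf
  simp only at hf hu hu'
  subst hf
  have hu0 : u =ᵐ[volume] fun _ => (0 : H) := hu.trans (Lp.coeFn_zero H 2 volume)
  have hli : LocallyIntegrable h volume := (Lp.memLp h).locallyIntegrable (by norm_num)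
  have hcont : Continuous u := by
    have : u = fun t => u 0 + ∫ s in (0 : ℝ)..t, h s := funext fun t => hu' 0 t
    rw [this]
    exact continuous_const.add
      (intervalIntegral.continuous_primitive (fun a b => L2.intervalIntegrable h a b) 0)
  have hz : u = fun _ => (0 : H) := (hcont.ae_eq_iff_eq volume continuous_const).1 hu0
  have hint : (fun t => ∫ s in (0 : ℝ)..t, h s) = fun _ => (0 : H) := by
    funext t
    have := hu' 0 t
    simpa [hz] using this.symm
  have hh : (h : ℝ → H) =ᵐ[volume] 0 := by
    filter_upwards [LocallyIntegrable.ae_hasDerivAt_integral hli] with t ht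
    have := ht 0
    rw [hint] at this
    exact (this.unique (hasDerivAt_const t (0 : H)))
  exact (Lp.eq_zero_iff_ae_eq_zero).2 hh

theorem fiber_add {A : ℝ → H →ₗ.[ℂ] H} {f g : L2 H} (hf : ∀ᵐ t : ℝ, f t ∈ (A t).domain)
    (hg : ∀ᵐ t : ℝ, g t ∈ (A t).domain) :
    (fun t => val (A t) ((f + g : L2 H) t)) =ᵐ[volume]
      (fun t => val (A t) (f t)) + fun t => val (A t) (g t) := by
  filter_upwards [hf, hg, Lp.coeFn_add f g] with t h1 h2 h3
  rw [h3]
  exact val_add h1 h2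

theorem fiber_smul {A : ℝ → H →ₗ.[ℂ] H} (c : ℂ) {f : L2 H}
    (hf : ∀ᵐ t : ℝ, f t ∈ (A t).domain) :
    (fun t => val (A t) ((c • f : L2 H) t)) =ᵐ[volume] c • fun t => val (A t) (f t) := by
  filter_upwards [hf, Lp.coeFn_smul c f] with t h1 h3
  rw [h3]
  exact val_smul c h1

/-- The operator in `L²(ℝ; H)` with fibers `A(t)`: `(A f)(t) = A(t) f(t)` for a.e. `t`, with domain
all `f` such that `f(t) ∈ dom A(t)` for a.e. `t` and `t ↦ A(t) f(t)` is measurable and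
square integrable. -/
def fiberOp (A : ℝ → H →ₗ.[ℂ] H) : L2 H →ₗ.[ℂ] L2 H where
  domain :=
    { carrier := {f | (∀ᵐ t : ℝ, f t ∈ (A t).domain) ∧ MemLp (fun t => val (A t) (f t)) 2 volume}
      zero_mem' := by
        have h0 := Lp.coeFn_zero H 2 (volume : Measure ℝ)
        refine ⟨h0.mono fun t ht => by rw [ht]; exact (A t).domain.zero_mem, ?_⟩
        refine (MemLp.zero (ε := H) (p := 2) (μ := volume)).ae_eq (h0.mono fun t ht => ?_)
        change (0 : H) = val (A t) (((0 : L2 H) : ℝ → H) t)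
        rw [ht]
        exact (val_zero _).symm
      add_mem' := by
        rintro f g ⟨hf, hf'⟩ ⟨hg, hg'⟩
        refine ⟨?_, (hf'.add hg').ae_eq (fiber_add hf hg).symm⟩
        filter_upwards [hf, hg, Lp.coeFn_add f g] with t h1 h2 h3
        rw [h3]
        exact (A t).domain.add_mem h1 h2
      smul_mem' := by
        rintro c f ⟨hf, hf'⟩
        refine ⟨?_, (hf'.const_smul c).ae_eq (fiber_smul c hf).symm⟩
        filter_upwards [hf, Lp.coeFn_smul c f] with t h1 h3
        rw [h3]
        exact (A t).domain.smul_mem c h1 }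
  toFun :=
    { toFun := fun f => MemLp.toLp _ f.2.2
      map_add' := fun f g => by
        rw [← MemLp.toLp_add]
        exact (MemLp.toLp_eq_toLp_iff _ _).2 (fiber_add f.2.1 g.2.1)
      map_smul' := fun c f => by
        rw [RingHom.id_apply, ← MemLp.toLp_const_smul]
        exact (MemLp.toLp_eq_toLp_iff _ _).2 (fiber_smul c f.2.1) }

/-- The model operator `d/dt + A` in `L²(ℝ; H)`, where `A` has the fibers `A(t) = A₋ + B(t)`, with
domain the intersection of the domains of `d/dt` and of the operator with constant fiber `A₋`. -/
def modelOp (Aminus : H →ₗ.[ℂ] H) (B : ℝ → H →ₗ.[ℂ] H) : L2 H →ₗ.[ℂ] L2 H :=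
  (ddt + fiberOp fun t => Aminus + B t).domRestrict
    (ddt.domain ⊓ (fiberOp fun _ => Aminus).domain)

/-- The imaginary axis `i ℝ`. -/
def imAxis : Set ℂ := Set.range fun μ : ℝ => Complex.I * (μ : ℂ)

end Model

end ModelOperator

end

/-! Write R = (A_- - i)⁻¹ and K(t) = B(t) R. On dom A_- one has A(t) = A_- + K(t)(A_- - i), so the
family is encoded in bounded operators (`perturb`, `add_eq_perturb`). Since R = (|A_-| + 1)⁻¹ V with
V bounded (`exists_absInv_comp`), the hypotheses pass to K: it is weakly locally absolutely
continuous, and its weak derivative K' has compact values and integrable operator norm, because the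
trace norm dominates the operator norm (`isWeakPrimitive_of_relTraceClassFamily`). Hence K is norm
continuous with norm limits at both ends: 0 at -∞, where the weak limit identifies it, and some K_+
at +∞. The bound ‖K(t) T‖ ≤ ∫ ‖K'(s) T‖ ds and dominated convergence make K(t) Tₙ small uniformly in
t whenever Tₙ is bounded and Tₙ* → 0 strongly (`IsWeakPrimitive.eventually_norm_comp_le`). With tail
projections for Tₙ this shows that K(t) is compact; with Tₙ = (A_- - i)(A_- - zₙ)⁻¹ it shows that
the perturbation is relatively small, uniformly in t.

A symmetric relatively compact perturbation is self-adjoint (`isSelfAdjoint_perturb`). So A_+ = A_-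
+ K_+(A_- - i) is self-adjoint, and the second resolvent identity turns K(t) → K_+ into norm
resolvent convergence (`normResolventTendsto_perturb`).

For the model operator put f = R g; it becomes g ↦ (R g)' + (1 + iR + K(t)) g, with bounded fibers
only (`mem_graph_modelOp`). For the constant fiber A_- one has ‖f' + A_- f‖² = ‖f'‖² + ‖A_- f‖²,
since d/dt is skew and commutes with A_-. The uniform relative smallness of K lets the perturbation
be absorbed, and the operator is closed.

For the essential spectrum let z = a + ib. If a lies in neither spectrum, then d/dt + A_- - z and
d/dt + A_+ - z are invertible (`exists_inverse_of_skew`). Gluing the two inverses with a cutoff of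
small slope gives a right inverse up to an error of norm less than one and a compact error; the
latter is compact by a Rellich argument (`isCompactOperator_fib_comp`). So the range is closed with
finite codimension. The same construction for -d/dt, applied to the formal adjoint, bounds the
kernel (`isFredholm_shift_modelOp`). If a belongs to one of the spectra, the functions exp(ibt) φ(t
∓ n) x, with φ a flat bump and x an approximate eigenvector of A_+ or A_-, are a singular Weyl
sequence (`not_isFredholm_shift_modelOp`). -/

noncomputable section

namespace ModelOperator

/-! ### Graphs, resolvents and self-adjointness criteria for unbounded operators. -/

section Unbounded

variable {H : Type*} [NormedAddCommGroup H] [InnerProductSpace ℂ H]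

theorem mem_shift_graph {T : H →ₗ.[ℂ] H} {z : ℂ} {x y : H} :
    (x, y) ∈ (shift T z).graph ↔ (x, y + z • x) ∈ T.graph := by
  simp only [LinearPMap.mem_graph_iff]
  constructor
  · rintro ⟨a, ha, hb⟩
    refine ⟨⟨a, a.2⟩, ha, ?_⟩
    rw [← hb, ← ha]
    have : shift T z a = -(z • (a : H)) + T ⟨a, a.2⟩ := rfl
    rw [this]
    abel
  · rintro ⟨a, ha, hb⟩
    refine ⟨⟨a, a.2⟩, ha, ?_⟩
    have : shift T z ⟨a, a.2⟩ = -(z • (a : H)) + T a := rfl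
    rw [this, hb, ← ha]
    abel

/-- Operators are handled through their graphs from here on, which removes the domain subtypes from
every later computation. -/
theorem isResolventAt_iff {T : H →ₗ.[ℂ] H} {z : ℂ} {R : H →L[ℂ] H} :
    IsResolventAt T z R ↔ (∀ y, (R y, y + z • R y) ∈ T.graph) ∧
      ∀ x y, (x, y) ∈ T.graph → R (y - z • x) = x := by
  refine and_congr (forall_congr' fun y => ?_) ⟨fun h x y hxy => ?_, fun h x => ?_⟩
  · rw [← mem_shift_graph, LinearPMap.mem_graph_iff]
    constructor
    · rintro ⟨h, h'⟩
      exact ⟨⟨_, h⟩, rfl, h'⟩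
    · rintro ⟨⟨a, ha⟩, rfl, h'⟩
      exact ⟨ha, h'⟩
  · have : (x, y - z • x) ∈ (shift T z).graph := by
      rw [mem_shift_graph]; simpa using hxy
    obtain ⟨a, rfl, hb⟩ := (LinearPMap.mem_graph_iff _).1 this
    simp only at hb
    rw [← hb]
    exact h a
  · have := (shift T z).mem_graph x
    rw [mem_shift_graph] at this
    simpa using h _ _ this

theorem isResolventAt_resolv {T : H →ₗ.[ℂ] H} {z : ℂ} (h : z ∈ resolventSet T) :
    IsResolventAt T z (resolv T z) := by
  rw [resolv, dif_pos (show ∃ R : H →L[ℂ] H, IsResolventAt T z R from h)]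
  exact Exists.choose_spec h

theorem resolv_mem_graph {T : H →ₗ.[ℂ] H} {z : ℂ} (h : z ∈ resolventSet T) (y : H) :
    (resolv T z y, y + z • resolv T z y) ∈ T.graph :=
  (isResolventAt_iff.1 (isResolventAt_resolv h)).1 y

theorem resolv_sub {T : H →ₗ.[ℂ] H} {z : ℂ} (h : z ∈ resolventSet T) {x y : H}
    (hxy : (x, y) ∈ T.graph) : resolv T z (y - z • x) = x :=
  (isResolventAt_iff.1 (isResolventAt_resolv h)).2 x y hxy

theorem val_eq_of_mem_graph {T : H →ₗ.[ℂ] H} {x y : H} (h : (x, y) ∈ T.graph) : val T x = y := by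
  obtain ⟨a, rfl, hb⟩ := (LinearPMap.mem_graph_iff _).1 h
  simp only at hb
  rw [val, dif_pos a.2, ← hb]

theorem mem_graph_val {T : H →ₗ.[ℂ] H} {x : H} (h : x ∈ T.domain) : (x, val T x) ∈ T.graph := by
  rw [val, dif_pos h]
  exact T.mem_graph ⟨x, h⟩

theorem mem_graph_val_iff {T : H →ₗ.[ℂ] H} {x y : H} :
    (x, y) ∈ T.graph ↔ x ∈ T.domain ∧ val T x = y :=
  ⟨fun h => ⟨LinearPMap.mem_domain_of_mem_graph h, val_eq_of_mem_graph h⟩,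
    fun h => h.2 ▸ mem_graph_val h.1⟩

theorem mem_graph_add {S T : H →ₗ.[ℂ] H} {x y : H} :
    (x, y) ∈ (S + T).graph ↔ ∃ u v, (x, u) ∈ S.graph ∧ (x, v) ∈ T.graph ∧ u + v = y := by
  constructor
  · intro h
    obtain ⟨⟨a, ha⟩, rfl, hb⟩ := (LinearPMap.mem_graph_iff _).1 h
    exact ⟨S ⟨a, ha.1⟩, T ⟨a, ha.2⟩, S.mem_graph ⟨a, ha.1⟩, T.mem_graph ⟨a, ha.2⟩, hb⟩
  · rintro ⟨u, v, hu, hv, rfl⟩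
    obtain ⟨⟨a, ha⟩, rfl, rfl⟩ := (LinearPMap.mem_graph_iff _).1 hu
    obtain ⟨⟨b, hb⟩, hab, rfl⟩ := (LinearPMap.mem_graph_iff _).1 hv
    simp only at hab
    subst hab
    exact (LinearPMap.mem_graph_iff _).2 ⟨⟨b, ha, hb⟩, rfl, rfl⟩

/-- The symmetry of an operator, in terms of its graph. -/
def IsSymm (T : H →ₗ.[ℂ] H) : Prop :=
  ∀ x y x' y', (x, y) ∈ T.graph → (x', y') ∈ T.graph → inner ℂ y x' = inner ℂ x y'

theorem isSymm_iff {T : H →ₗ.[ℂ] H} : IsSymm T ↔ T.IsFormalAdjoint T := by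
  constructor
  · intro h x y
    exact h _ _ _ _ (T.mem_graph x) (T.mem_graph y)
  · intro h x y x' y' hx hy
    obtain ⟨a, rfl, rfl⟩ := (LinearPMap.mem_graph_iff _).1 hx
    obtain ⟨b, rfl, rfl⟩ := (LinearPMap.mem_graph_iff _).1 hy
    exact h a b

theorem IsSymm.add {S T : H →ₗ.[ℂ] H} (hS : IsSymm S) (hT : IsSymm T) : IsSymm (S + T) := by
  intro x y x' y' h h'
  obtain ⟨u, v, hu, hv, rfl⟩ := mem_graph_add.1 h
  obtain ⟨u', v', hu', hv', rfl⟩ := mem_graph_add.1 h'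
  rw [inner_add_left, inner_add_right, hS _ _ _ _ hu hu', hT _ _ _ _ hv hv']

theorem IsSymm.inner_im {T : H →ₗ.[ℂ] H} (hT : IsSymm T) {x y : H} (h : (x, y) ∈ T.graph) :
    (inner ℂ x y).im = 0 := by
  have := hT _ _ _ _ h h
  rw [← inner_conj_symm] at this
  exact Complex.conj_eq_iff_im.1 this

/-- The cross term is the real part of an imaginary multiple of ⟨y - (Re z) x, x⟩, which is real by
symmetry. -/
theorem IsSymm.norm_sub_smul_sq {T : H →ₗ.[ℂ] H} (hT : IsSymm T) {x y : H} (h : (x, y) ∈ T.graph)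
    (z : ℂ) : ‖y - z • x‖ ^ 2 = ‖y - (z.re : ℂ) • x‖ ^ 2 + z.im ^ 2 * ‖x‖ ^ 2 := by
  have him := hT.inner_im h
  have hz : y - z • x = (y - (z.re : ℂ) • x) - (z.im * Complex.I : ℂ) • x := by
    conv_lhs => rw [← Complex.re_add_im z]
    rw [add_smul]; abel
  rw [hz, norm_sub_sq (𝕜 := ℂ), norm_smul, mul_pow]
  have h1 : inner ℂ (y - (z.re : ℂ) • x) ((z.im * Complex.I : ℂ) • x) =
      z.im * Complex.I * (inner ℂ y x - z.re * (‖x‖ : ℂ) ^ 2) := by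
    rw [inner_smul_right, inner_sub_left, inner_smul_left, inner_self_eq_norm_sq_to_K]
    simp
  have h2 : (inner ℂ y x).im = 0 := by
    rw [← inner_conj_symm, Complex.conj_im, him, neg_zero]
  rw [h1]
  simp [h2, ← Complex.ofReal_pow]

theorem IsSymm.abs_im_mul_norm_le {T : H →ₗ.[ℂ] H} (hT : IsSymm T) {x y : H}
    (h : (x, y) ∈ T.graph) (z : ℂ) : |z.im| * ‖x‖ ≤ ‖y - z • x‖ := by
  refine abs_le_of_sq_le_sq' ?_ (norm_nonneg _) |>.2
  rw [hT.norm_sub_smul_sq h, mul_pow, sq_abs]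
  nlinarith [sq_nonneg ‖y - (z.re : ℂ) • x‖]

/-- Applied to the graph points of a resolvent, this says that A (A - ib)⁻¹ is a contraction. -/
theorem IsSymm.norm_le_of_re_eq_zero {T : H →ₗ.[ℂ] H} (hT : IsSymm T) {x y : H}
    (h : (x, y) ∈ T.graph) {z : ℂ} (hz : z.re = 0) : ‖y‖ ≤ ‖y - z • x‖ := by
  refine abs_le_of_sq_le_sq' ?_ (norm_nonneg _) |>.2
  rw [hT.norm_sub_smul_sq h, hz]
  simp only [Complex.ofReal_zero, zero_smul, sub_zero]
  nlinarith [mul_nonneg (sq_nonneg z.im) (sq_nonneg ‖x‖)]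

variable [CompleteSpace H]

theorem mem_graph_of_isSelfAdjoint {A : H →ₗ.[ℂ] H} (hA : IsSelfAdjoint A) {x y : H}
    (h : ∀ a b, (a, b) ∈ A.graph → inner ℂ b x = inner ℂ a y) : (x, y) ∈ A.graph := by
  have := LinearPMap.adjoint_graph_eq_graph_adjoint hA.dense_domain
  rw [LinearPMap.isSelfAdjoint_def.1 hA] at this
  rw [this, Submodule.mem_adjoint_iff]
  intro a b hab
  rw [h a b hab, sub_self]

theorem IsSelfAdjoint.isSymm {A : H →ₗ.[ℂ] H} (hA : IsSelfAdjoint A) : IsSymm A := by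
  intro x y x' y' h h'
  have := LinearPMap.adjoint_graph_eq_graph_adjoint hA.dense_domain
  rw [LinearPMap.isSelfAdjoint_def.1 hA] at this
  rw [this, Submodule.mem_adjoint_iff] at h'
  exact sub_eq_zero.1 (h' x y h)

/-- A symmetric operator `A` is self-adjoint if `A - z` and `A - conj z` are surjective. -/
theorem IsSymm.isSelfAdjoint {A : H →ₗ.[ℂ] H} (hA : IsSymm A) (hd : Dense (A.domain : Set H))
    (z : ℂ) (h1 : ∀ w, ∃ x y, (x, y) ∈ A.graph ∧ y - z • x = w)
    (h2 : ∀ w, ∃ x y, (x, y) ∈ A.graph ∧ y - (starRingEnd ℂ z) • x = w) : IsSelfAdjoint A := by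
  rw [LinearPMap.isSelfAdjoint_def]
  apply LinearPMap.eq_of_eq_graph
  rw [LinearPMap.adjoint_graph_eq_graph_adjoint hd]
  ext ⟨x, y⟩
  rw [Submodule.mem_adjoint_iff]
  constructor
  · intro h
    -- With u in dom A and (A - z) u = (A* - z) x, the difference x - u is in the kernel of A* - z.
    -- It is thus orthogonal to the range of A - conj z, which is everything.
    obtain ⟨u, v, huv, hw⟩ := h1 (y - z • x)
    have hxu : x - u = 0 := by
      obtain ⟨a, b, hab, hb⟩ := h2 (x - u)
      have e1 : inner ℂ b x = inner ℂ a y := sub_eq_zero.1 (h a b hab)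
      have e2 : inner ℂ b u = inner ℂ a v := hA _ _ _ _ hab huv
      have e3 : y = v - z • u + z • x := by rw [hw]; abel
      rw [← @inner_self_eq_zero ℂ]
      nth_rw 1 [← hb]
      rw [inner_sub_left, inner_sub_right, e1, e2, e3, inner_smul_left]
      simp only [inner_add_right, inner_sub_right, inner_smul_right, Complex.conj_conj]
      ring
    rw [sub_eq_zero] at hxu
    subst hxu
    have : v = y := by simpa using hw
    exact this ▸ huv
  · intro h a b hab
    exact sub_eq_zero.2 (hA _ _ _ _ hab h)

/-- A point is in the resolvent set of a self-adjoint operator `A` if `A - z` and `A - conj z` are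
bounded below. -/
theorem mem_resolventSet_of_bound {A : H →ₗ.[ℂ] H} (hA : IsSelfAdjoint A) {z : ℂ} {c : ℝ}
    (hc : 0 < c) (h1 : ∀ x y, (x, y) ∈ A.graph → c * ‖x‖ ≤ ‖y - z • x‖)
    (h2 : ∀ x y, (x, y) ∈ A.graph → c * ‖x‖ ≤ ‖y - (starRingEnd ℂ z) • x‖) :
    z ∈ resolventSet A := by
  -- A - z is viewed as a bounded map on the complete space graph A. There `h1` gives injectivity
  -- and closed range, and `h2` gives dense range.
  let L₀ : H × H →L[ℂ] H := ContinuousLinearMap.snd ℂ H H - z • ContinuousLinearMap.fst ℂ H H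
  let L : A.graph →L[ℂ] H := L₀ ∘L A.graph.subtypeL
  have hL : ∀ p : A.graph, L p = (p : H × H).2 - z • (p : H × H).1 := fun p => rfl
  have hLb : ∀ p : A.graph, c * ‖(p : H × H).1‖ ≤ ‖L p‖ := fun p => h1 _ _ p.2
  have hcl : IsClosed (A.graph : Set (H × H)) := hA.isClosed
  have : CompleteSpace A.graph := hcl.completeSpace_coe
  have hanti : ∃ K, AntilipschitzWith K L := by
    refine ⟨_, ContinuousLinearMap.antilipschitz_of_bound L (K := (1 + (1 + ‖z‖) / c).toNNReal)
      fun p => ?_⟩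
    have hk : 0 ≤ (1 + ‖z‖) / c := by positivity
    rw [Real.coe_toNNReal _ (by positivity)]
    have hp1 : ‖(p : H × H).1‖ ≤ ‖L p‖ / c := by
      rw [le_div_iff₀ hc]; linarith [hLb p]
    have hp2 : ‖(p : H × H).2‖ ≤ ‖L p‖ + ‖z‖ * ‖(p : H × H).1‖ := by
      have : (p : H × H).2 = L p + z • (p : H × H).1 := by rw [hL]; abel
      rw [this]
      exact (norm_add_le _ _).trans (by rw [norm_smul])
    have hp3 : ‖z‖ * ‖(p : H × H).1‖ ≤ ‖z‖ * (‖L p‖ / c) := by gcongr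
    have hd : (1 + (1 + ‖z‖) / c) * ‖L p‖ = ‖L p‖ + ‖L p‖ / c + ‖z‖ * (‖L p‖ / c) := by ring
    have h0 : 0 ≤ ‖L p‖ / c := by positivity
    have h00 : 0 ≤ ‖z‖ * (‖L p‖ / c) := by positivity
    rw [hd]
    refine max_le ?_ ?_
    · exact hp1.trans (by linarith [norm_nonneg (L p)])
    · exact hp2.trans (by linarith)
  obtain ⟨K, hK⟩ := hanti
  have hinj : LinearMap.ker (L : A.graph →ₗ[ℂ] H) = ⊥ :=
    LinearMap.ker_eq_bot.2 hK.injective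
  have hrcl : IsClosed (LinearMap.range (L : A.graph →ₗ[ℂ] H) : Set H) := by
    have := hK.isClosed_range L.uniformContinuous
    rw [LinearMap.coe_range]
    exact this
  have hrange : LinearMap.range (L : A.graph →ₗ[ℂ] H) = ⊤ := by
    have : CompleteSpace (LinearMap.range (L : A.graph →ₗ[ℂ] H)) := hrcl.completeSpace_coe
    rw [← Submodule.orthogonal_eq_bot_iff, Submodule.eq_bot_iff]
    intro w hw
    -- A vector orthogonal to the range is an eigenvector of A* = A for conj z, which `h2` excludes.
    have hw' : ∀ a b, (a, b) ∈ A.graph → inner ℂ b w = inner ℂ a ((starRingEnd ℂ z) • w) := by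
      intro a b hab
      have := (Submodule.mem_orthogonal _ _).1 hw (L ⟨(a, b), hab⟩) ⟨⟨(a, b), hab⟩, rfl⟩
      rw [hL] at this
      simp only [inner_sub_left, inner_smul_left] at this
      rw [inner_smul_right]
      exact sub_eq_zero.1 this
    have := h2 _ _ (mem_graph_of_isSelfAdjoint hA hw')
    rw [sub_self, norm_zero] at this
    have : ‖w‖ ≤ 0 := by nlinarith [norm_nonneg w]
    exact norm_le_zero_iff.1 this
  let e := ContinuousLinearEquiv.ofBijective L hinj hrange
  have he : ∀ p, e p = L p := fun p => rfl
  let R : H →L[ℂ] H := ContinuousLinearMap.fst ℂ H H ∘L A.graph.subtypeL ∘L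
    (e.symm : H →L[ℂ] A.graph)
  refine ⟨R, isResolventAt_iff.2 ⟨fun y => ?_, fun x y hxy => ?_⟩⟩
  · have h := (e.symm y).2
    have h' : ((e.symm y : A.graph) : H × H).2 - z • R y = y := by
      have := e.apply_symm_apply y
      rw [he, hL] at this
      exact this
    have h'' : y + z • R y = ((e.symm y : A.graph) : H × H).2 := by
      nth_rw 1 [← h']; abel
    rw [h'']
    exact h
  · have : e.symm (y - z • x) = ⟨(x, y), hxy⟩ := by
      rw [ContinuousLinearEquiv.symm_apply_eq]; rfl
    change ((e.symm (y - z • x) : A.graph) : H × H).1 = x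
    rw [this]

theorem mem_resolventSet_of_im_ne_zero {A : H →ₗ.[ℂ] H} (hA : IsSelfAdjoint A) {z : ℂ}
    (hz : z.im ≠ 0) : z ∈ resolventSet A := by
  refine mem_resolventSet_of_bound hA (abs_pos.2 hz)
    (fun x y h => (IsSelfAdjoint.isSymm hA).abs_im_mul_norm_le h z) fun x y h => ?_
  simpa using (IsSelfAdjoint.isSymm hA).abs_im_mul_norm_le h (starRingEnd ℂ z)

theorem norm_resolv_le {A : H →ₗ.[ℂ] H} (hA : IsSelfAdjoint A) {z : ℂ} (hz : z.im ≠ 0) (y : H) :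
    |z.im| * ‖resolv A z y‖ ≤ ‖y‖ := by
  have h := mem_resolventSet_of_im_ne_zero hA hz
  simpa using (IsSelfAdjoint.isSymm hA).abs_im_mul_norm_le (resolv_mem_graph h y) z

theorem adjoint_resolv {A : H →ₗ.[ℂ] H} (hA : IsSelfAdjoint A) {z : ℂ} (hz : z.im ≠ 0) :
    ContinuousLinearMap.adjoint (resolv A z) = resolv A (starRingEnd ℂ z) := by
  symm
  rw [ContinuousLinearMap.eq_adjoint_iff]
  intro x y
  have h := mem_resolventSet_of_im_ne_zero hA hz
  have h' := mem_resolventSet_of_im_ne_zero hA (z := starRingEnd ℂ z) (by simpa using hz)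
  have := (IsSelfAdjoint.isSymm hA) _ _ _ _ (resolv_mem_graph h' x) (resolv_mem_graph h y)
  rw [inner_add_left, inner_add_right, inner_smul_left, inner_smul_right, Complex.conj_conj] at this
  exact (add_right_cancel this).symm

theorem tendsto_of_dense_of_bounded {E F : Type*} [NormedAddCommGroup E] [NormedSpace ℂ E]
    [NormedAddCommGroup F] [NormedSpace ℂ F] {T : ℕ → E →L[ℂ] F} {T' : E →L[ℂ] F} {C : ℝ}
    (hT : ∀ n, ‖T n‖ ≤ C) {s : Set E} (hs : Dense s)
    (h : ∀ x ∈ s, Tendsto (fun n => T n x) atTop (𝓝 (T' x))) (x : E) :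
    Tendsto (fun n => T n x) atTop (𝓝 (T' x)) := by
  have hC : 0 ≤ C := (norm_nonneg _).trans (hT 0)
  rw [Metric.tendsto_atTop]
  intro ε hε
  have hδ : 0 < ε / (2 * (C + ‖T'‖ + 1)) := by positivity
  obtain ⟨u, hu, hxu⟩ := Metric.dense_iff.1 hs x _ hδ
  obtain ⟨N, hN⟩ := Metric.tendsto_atTop.1 (h u hxu) (ε / 2) (by positivity)
  refine ⟨N, fun n hn => ?_⟩
  have h1 := hN n hn
  rw [dist_eq_norm] at h1 ⊢
  have h2 : T n x - T' x = (T n (x - u) - T' (x - u)) + (T n u - T' u) := by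
    simp only [map_sub]; abel
  have h3 : ‖x - u‖ < ε / (2 * (C + ‖T'‖ + 1)) := by
    rw [← dist_eq_norm, dist_comm]; exact hu
  have h4 : ‖T n (x - u) - T' (x - u)‖ ≤ (C + ‖T'‖) * ‖x - u‖ := by
    refine (norm_sub_le _ _).trans ?_
    rw [add_mul]
    exact add_le_add (((T n).le_opNorm _).trans (by gcongr; exact hT n)) (T'.le_opNorm _)
  have h5 : (C + ‖T'‖) * ‖x - u‖ ≤ ε / 2 := by
    rw [lt_div_iff₀ (by positivity)] at h3
    nlinarith [norm_nonneg (x - u), norm_nonneg T']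
  rw [h2]
  linarith [norm_add_le (T n (x - u) - T' (x - u)) (T n u - T' u)]

/-- A self-adjoint operator `A` is approximated by the bounded operators `A Eₙ`, where
`Eₙ = i n (A + i n)⁻¹` tends to the identity. -/
theorem exists_regularizer {A : H →ₗ.[ℂ] H} (hA : IsSelfAdjoint A) :
    ∃ E G : ℕ → H →L[ℂ] H, (∀ n, ‖E n‖ ≤ 1) ∧ (∀ x, Tendsto (fun n => E n x) atTop (𝓝 x)) ∧
      (∀ x, Tendsto (fun n => ContinuousLinearMap.adjoint (E n) x) atTop (𝓝 x)) ∧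
      (∀ n x, (E n x, G n x) ∈ A.graph) ∧
      ∀ n x y, (x, y) ∈ A.graph → E n y = G n x ∧
        ContinuousLinearMap.adjoint (E n) y = ContinuousLinearMap.adjoint (G n) x := by
  -- Using n + 1 instead of n keeps `s 0` off the real axis.
  let s : ℕ → ℂ := fun n => ((n + 1 : ℝ) : ℂ) * Complex.I
  have hs : ∀ n, (s n).im = n + 1 := fun n => by simp [s]
  have hsconj : ∀ n, starRingEnd ℂ (s n) = -s n := fun n => by
    simp only [s, map_mul, Complex.conj_ofReal, Complex.conj_I]; ring
  have hspos : ∀ n : ℕ, (0 : ℝ) < n + 1 := fun n => by positivity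
  have hsnorm : ∀ n, ‖s n‖ = n + 1 := fun n => by
    simp only [s, norm_mul, Complex.norm_I, mul_one, Complex.norm_real, Real.norm_eq_abs]
    exact abs_of_pos (hspos n)
  have hz : ∀ n, (-s n).im ≠ 0 := fun n => by
    rw [Complex.neg_im, hs, neg_ne_zero]; exact (hspos n).ne'
  have hz' : ∀ n, (s n).im ≠ 0 := fun n => by rw [hs]; exact (hspos n).ne'
  -- Needed for both signs: w = -s gives the regularizers, w = s their adjoints.
  have key : ∀ w : ℕ → ℂ, (∀ n, (w n).im ≠ 0) → (∀ n, ‖w n‖ = n + 1) → (∀ n, |(w n).im| = n + 1) →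
      (∀ n, ‖(w n) • resolv A (w n)‖ ≤ 1) ∧
        ∀ x, Tendsto (fun n => (-(w n) • resolv A (w n)) x) atTop (𝓝 x) := by
    intro w hw hwn hwi
    have hb : ∀ n, ‖(w n) • resolv A (w n)‖ ≤ 1 := fun n => by
      refine ContinuousLinearMap.opNorm_le_bound _ zero_le_one fun y => ?_
      rw [smul_apply, norm_smul, hwn, ← hwi, one_mul]
      exact norm_resolv_le hA (hw n) y
    refine ⟨hb, fun x => ?_⟩
    refine tendsto_of_dense_of_bounded (T' := ContinuousLinearMap.id ℂ H) (C := 1)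
      (fun n => by simpa only [neg_smul, norm_neg] using hb n) hA.dense_domain (fun x hx => ?_) x
    have hxy := mem_graph_val hx
    have hlim : Tendsto (fun n : ℕ => ‖val A x‖ / ((n : ℝ) + 1)) atTop (𝓝 0) := by
      have := (tendsto_one_div_add_atTop_nhds_zero_nat (𝕜 := ℝ)).const_mul ‖val A x‖
      simpa only [mul_one_div, mul_zero] using this
    rw [tendsto_iff_norm_sub_tendsto_zero]
    refine squeeze_zero (fun _ => norm_nonneg _) (fun n => ?_) hlim
    -- For x in dom A the error is -(A - wₙ)⁻¹ A x, of norm at most ‖A x‖ / (n + 1).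
    have h1 := resolv_sub (mem_resolventSet_of_im_ne_zero hA (hw n)) hxy
    rw [map_sub, map_smul] at h1
    have h2 : (-(w n) • resolv A (w n)) x - ContinuousLinearMap.id ℂ H x =
        -(resolv A (w n) (val A x)) := by
      rw [sub_eq_iff_eq_add.1 h1]
      change -(w n) • resolv A (w n) x - x = _
      rw [neg_smul]
      abel
    rw [h2, norm_neg, le_div_iff₀ (hspos n), mul_comm, ← hwi]
    exact norm_resolv_le hA (hw n) _
  have k1 := key (fun n => -s n) hz (fun n => by rw [norm_neg, hsnorm])
    (fun n => by rw [Complex.neg_im, abs_neg, hs, abs_of_pos (hspos n)])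
  have k2 := key s hz' hsnorm (fun n => by rw [hs, abs_of_pos (hspos n)])
  have hadj : ∀ n, ContinuousLinearMap.adjoint (s n • resolv A (-s n)) =
      -(s n) • resolv A (s n) := fun n => by
    rw [map_smulₛₗ, adjoint_resolv hA (hz n), map_neg, hsconj, neg_neg]
  refine ⟨fun n => s n • resolv A (-s n),
    fun n => s n • (ContinuousLinearMap.id ℂ H - s n • resolv A (-s n)), fun n => ?_, fun x => ?_,
    fun x => ?_, fun n x => ?_, fun n x y hxy => ⟨?_, ?_⟩⟩
  · simpa only [neg_smul, norm_neg] using k1.1 n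
  · simpa only [neg_neg] using k1.2 x
  · simp only [hadj]
    exact k2.2 x
  · have := A.graph.smul_mem (s n)
      (resolv_mem_graph (mem_resolventSet_of_im_ne_zero hA (hz n)) x)
    rw [Prod.smul_mk, neg_smul, ← sub_eq_add_neg] at this
    exact this
  · have h1 := resolv_sub (mem_resolventSet_of_im_ne_zero hA (hz n)) hxy
    rw [map_sub, map_smul, neg_smul, sub_neg_eq_add] at h1
    simp only [smul_apply, sub_apply,
      ContinuousLinearMap.id_apply]
    congr 1
    exact eq_sub_of_add_eq h1
  · have h1 := resolv_sub (mem_resolventSet_of_im_ne_zero hA (hz' n)) hxy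
    rw [map_sub, map_smul] at h1
    rw [hadj, map_smulₛₗ, map_sub, hadj, hsconj]
    have : ContinuousLinearMap.adjoint (ContinuousLinearMap.id ℂ H) = ContinuousLinearMap.id ℂ H :=
      ContinuousLinearMap.adjoint_id
    rw [this]
    simp only [smul_apply, sub_apply,
      ContinuousLinearMap.id_apply]
    congr 1
    rw [neg_smul, sub_neg_eq_add]
    exact sub_eq_iff_eq_add.1 h1

end Unbounded

end ModelOperator

end

noncomputable section

namespace ModelOperator

/-! ### The absolute value of a self-adjoint operator. -/

section AbsoluteValue

variable {H : Type*} [NormedAddCommGroup H] [InnerProductSpace ℂ H]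

theorem mem_graph_mul {S T : H →ₗ.[ℂ] H} {x y : H} :
    (x, y) ∈ (mul S T).graph ↔ ∃ u, (x, u) ∈ T.graph ∧ (u, y) ∈ S.graph := by
  constructor
  · intro h
    obtain ⟨⟨a, ha⟩, rfl, hb⟩ := (LinearPMap.mem_graph_iff _).1 h
    have ha2 : a ∈ T.domain := ha.2
    have ha1 : T ⟨a, ha2⟩ ∈ S.domain := by
      obtain ⟨y, hy, hya⟩ := ha.1
      have : y = ⟨a, ha2⟩ := Subtype.ext hya
      rw [← this]
      exact hy
    refine ⟨T ⟨a, ha2⟩, T.mem_graph ⟨a, ha2⟩, ?_⟩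
    simp only at hb
    rw [← hb]
    exact S.mem_graph ⟨T ⟨a, ha2⟩, ha1⟩
  · rintro ⟨u, hu, hy⟩
    obtain ⟨⟨a, ha⟩, rfl, rfl⟩ := (LinearPMap.mem_graph_iff _).1 hu
    obtain ⟨⟨b, hb⟩, hab, rfl⟩ := (LinearPMap.mem_graph_iff _).1 hy
    simp only at hab
    subst hab
    exact (LinearPMap.mem_graph_iff _).2 ⟨⟨a, ⟨⟨a, ha⟩, hb, rfl⟩, ha⟩, rfl, rfl⟩

variable [CompleteSpace H]

/-- Since A² + 1 = (A - i)(A + i), the product of the two resolvents is (A² + 1)⁻¹. -/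
theorem mem_graph_mul_self_iff {A : H →ₗ.[ℂ] H} (hA : IsSelfAdjoint A) {x y : H} :
    (x, y) ∈ (mul A A).graph ↔ resolv A (-Complex.I) (resolv A Complex.I (x + y)) = x := by
  have hp : Complex.I ∈ resolventSet A := mem_resolventSet_of_im_ne_zero hA (by simp)
  have hm : -Complex.I ∈ resolventSet A := mem_resolventSet_of_im_ne_zero hA (by simp)
  rw [mem_graph_mul]
  constructor
  · rintro ⟨u, hx, hu⟩
    have h1 := A.graph.add_mem hu (A.graph.smul_mem Complex.I hx)
    have h2 := resolv_sub hp h1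
    have h3 : y + Complex.I • u - Complex.I • (u + Complex.I • x) = x + y := by
      rw [smul_add, smul_smul, Complex.I_mul_I]
      module
    simp only [Prod.smul_mk] at h2
    rw [h3] at h2
    have h4 := resolv_sub hm hx
    rw [neg_smul, sub_neg_eq_add] at h4
    rw [h2, h4]
  · intro h
    have h1 := resolv_mem_graph hp (x + y)
    have h2 := resolv_mem_graph hm (resolv A Complex.I (x + y))
    rw [h] at h2
    refine ⟨_, h2, ?_⟩
    have h3 := A.graph.sub_mem h1 (A.graph.smul_mem Complex.I h2)
    rw [Prod.smul_mk, Prod.mk_sub_mk] at h3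
    convert h3 using 2
    · module
    · rw [smul_add, smul_smul, mul_neg, Complex.I_mul_I]
      module

/-- With ρ = (A² + 1)⁻¹ one has formally |A|² = ρ⁻¹ - 1, hence |A| = C T⁻¹ for the commuting bounded
operators T = √ρ and C = √(1 - ρ). So the graph {(T x, C x)} is the candidate, and the bounded
functional calculus is enough. -/
theorem exists_isAbs {A : H →ₗ.[ℂ] H} (hA : IsSelfAdjoint A) : ∃ S, IsAbs A S := by
  have hp : Complex.I ∈ resolventSet A := mem_resolventSet_of_im_ne_zero hA (by simp)
  set Rp := resolv A Complex.I with hRp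
  have hadj : star Rp = resolv A (-Complex.I) := by
    rw [ContinuousLinearMap.star_eq_adjoint, hRp, adjoint_resolv hA (by simp), Complex.conj_I]
  set ρ : H →L[ℂ] H := star Rp * Rp with hρ
  have hρ0 : 0 ≤ ρ := star_mul_self_nonneg Rp
  have hRn : ‖Rp‖ ≤ 1 := ContinuousLinearMap.opNorm_le_bound _ zero_le_one fun y => by
    simpa using norm_resolv_le hA (z := Complex.I) (by simp) y
  have hρ1 : ρ ≤ 1 := by
    rw [← CStarAlgebra.norm_le_one_iff_of_nonneg ρ hρ0, hρ, CStarRing.norm_star_mul_self]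
    nlinarith [norm_nonneg Rp]
  set T := CFC.sqrt ρ with hT
  set C := CFC.sqrt (1 - ρ) with hC
  have hT0 : 0 ≤ T := CFC.sqrt_nonneg _
  have hC0 : 0 ≤ C := CFC.sqrt_nonneg _
  have hTT : T * T = ρ := CFC.sqrt_mul_sqrt_self ρ hρ0
  have hCC : C * C = 1 - ρ := CFC.sqrt_mul_sqrt_self (1 - ρ) (sub_nonneg.2 hρ1)
  have hcomm : Commute T C := by
    have h1 : Commute ρ (1 - ρ) := (Commute.one_right ρ).sub_right (Commute.refl ρ)
    have h2 : Commute T (1 - ρ) := h1.cfcₙ_nnreal _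
    exact (h2.symm.cfcₙ_nnreal _).symm
  have hTs : ∀ x y, inner ℂ (T x) y = inner ℂ x (T y) := fun x y =>
    ((ContinuousLinearMap.nonneg_iff_isPositive T).1 hT0).isSymmetric x y
  have hCs : ∀ x y, inner ℂ (C x) y = inner ℂ x (C y) := fun x y =>
    ((ContinuousLinearMap.nonneg_iff_isPositive C).1 hC0).isSymmetric x y
  have hTC : ∀ x, T (C x) = C (T x) := fun x => DFunLike.congr_fun hcomm.eq x
  have hTT' : ∀ x, T (T x) = ρ x := fun x => DFunLike.congr_fun hTT x
  have hCC' : ∀ x, C (C x) = x - ρ x := fun x => DFunLike.congr_fun hCC x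
  have hinj : ∀ x, T x = 0 → x = 0 := by
    intro x hx
    have h1 : ρ x = 0 := by rw [← hTT', hx, map_zero]
    have h2 : inner ℂ (Rp x) (Rp x) = inner ℂ x (ρ x) := by
      rw [hρ, ContinuousLinearMap.star_eq_adjoint]
      exact (ContinuousLinearMap.adjoint_inner_right Rp x (Rp x)).symm
    rw [h1, inner_zero_right, inner_self_eq_zero] at h2
    have h3 := resolv_mem_graph hp x
    rw [← hRp, h2, smul_zero, add_zero] at h3
    exact A.graph_fst_eq_zero_snd h3 rfl
  let g : Submodule ℂ (H × H) := LinearMap.range ((T.prod C : H →L[ℂ] H × H) : H →ₗ[ℂ] H × H)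
  have hg : ∀ u v, (u, v) ∈ g ↔ ∃ x, T x = u ∧ C x = v := fun u v => by
    simp only [g, LinearMap.mem_range]
    exact exists_congr fun x => Prod.mk_inj
  let S := g.toLinearPMap
  have hSg : S.graph = g := by
    refine Submodule.toLinearPMap_graph_eq _ ?_
    rintro ⟨u, v⟩ huv hu
    obtain ⟨x, rfl, rfl⟩ := (hg u v).1 huv
    rw [hinj x hu]
    exact map_zero C
  have hS : ∀ u v, (u, v) ∈ S.graph ↔ ∃ x, T x = u ∧ C x = v := fun u v => by rw [hSg, hg]
  have hsymm : IsSymm S := by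
    intro x y x' y' h h'
    obtain ⟨a, rfl, rfl⟩ := (hS _ _).1 h
    obtain ⟨b, rfl, rfl⟩ := (hS _ _).1 h'
    rw [hCs, hTs, hTC]
  have hdense : Dense (S.domain : Set H) := by
    rw [Submodule.dense_iff_topologicalClosure_eq_top,
      Submodule.topologicalClosure_eq_top_iff, Submodule.eq_bot_iff]
    intro w hw
    refine hinj w ?_
    rw [← inner_self_eq_zero (𝕜 := ℂ), ← hTs]
    exact (Submodule.mem_orthogonal _ _).1 hw _
      (LinearPMap.mem_domain_of_mem_graph ((hS _ _).2 ⟨T w, rfl, rfl⟩))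
  have hsa : IsSelfAdjoint S := by
    refine hsymm.isSelfAdjoint hdense Complex.I (fun w => ?_) fun w => ?_
    · refine ⟨_, _, (hS _ _).2 ⟨C w + Complex.I • T w, rfl, rfl⟩, ?_⟩
      simp only [map_add, map_smul, smul_add, smul_smul, Complex.I_mul_I, hTT', hCC', hTC]
      module
    · refine ⟨_, _, (hS _ _).2 ⟨C w - Complex.I • T w, rfl, rfl⟩, ?_⟩
      simp only [map_sub, map_smul, smul_sub, smul_smul, hTT', hCC', hTC, Complex.conj_I,
        neg_mul, Complex.I_mul_I]
      module
  refine ⟨S, hsa, fun x => ?_, ?_⟩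
  · obtain ⟨a, ha, hb⟩ := (hS _ _).1 (S.mem_graph x)
    rw [← ha, ← hb, hCs, ← hTC]
    exact ((ContinuousLinearMap.nonneg_iff_isPositive _).1
      (hcomm.mul_nonneg hT0 hC0)).re_inner_nonneg_right a
  · rw [LinearPMap.isSelfAdjoint_def.1 hA]
    apply LinearPMap.eq_of_eq_graph
    ext ⟨x, y⟩
    rw [mem_graph_mul_self_iff hA, ← hadj, mem_graph_mul]
    change _ ↔ ρ (x + y) = x
    constructor
    · rintro ⟨u, hx, hu⟩
      obtain ⟨a, rfl, rfl⟩ := (hS _ _).1 hx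
      obtain ⟨b, hb, rfl⟩ := (hS _ _).1 hu
      have : T (T a + C b) = a := by
        rw [map_add, hTC, hb, hTT', hCC']
        abel
      rw [← hTT', this]
    · intro h
      refine ⟨C (T (x + y)), (hS _ _).2 ⟨T (x + y), by rw [hTT', h], rfl⟩,
        (hS _ _).2 ⟨C (x + y), hTC _, ?_⟩⟩
      rw [hCC', h]
      abel

/-- A self-adjoint operator `A` and its absolute value `S` have the same norms on `dom A`. -/
theorem IsAbs.exists_mem_graph {A S : H →ₗ.[ℂ] H} (hA : IsSelfAdjoint A) (hS : IsAbs A S)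
    {x y : H} (hxy : (x, y) ∈ A.graph) : ∃ v, (x, v) ∈ S.graph ∧ ‖v‖ = ‖y‖ := by
  have hmul : mul S S = mul A A := by rw [hS.2.2, LinearPMap.isSelfAdjoint_def.1 hA]
  -- On dom A² the two norms agree, by pairing S² x = A² x with x. The regularizers move x into dom
  -- A², and S Eₙ x is Cauchy because A Eₙ x = Eₙ y is; closedness of S finishes.
  obtain ⟨E, G, -, hE, -, hEG, hcomm⟩ := exists_regularizer hA
  have hex : ∀ n, ∃ v, (E n x, v) ∈ S.graph := by
    intro n
    have h2 : (E n x, E n y) ∈ A.graph := (hcomm n x y hxy).1 ▸ hEG n x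
    have h3 : (E n x, G n y) ∈ (mul A A).graph := mem_graph_mul.2 ⟨_, h2, hEG n y⟩
    rw [← hmul] at h3
    obtain ⟨v, hv, -⟩ := mem_graph_mul.1 h3
    exact ⟨v, hv⟩
  choose v hv using hex
  have hnorm : ∀ n m, ‖v n - v m‖ = ‖E n y - E m y‖ ∧ ‖v n‖ = ‖E n y‖ := by
    have gen : ∀ a b c, (a, b) ∈ A.graph → (b, c) ∈ A.graph → ∀ w, (a, w) ∈ S.graph →
        ‖w‖ = ‖b‖ := by
      intro a b c hab hbc w hw
      have h3 : (a, c) ∈ (mul A A).graph := mem_graph_mul.2 ⟨_, hab, hbc⟩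
      rw [← hmul] at h3
      obtain ⟨w', hw', hc⟩ := mem_graph_mul.1 h3
      have hww : w' = w := S.mem_graph_snd_inj hw' hw rfl
      subst hww
      have e1 := (IsSelfAdjoint.isSymm hS.1) _ _ _ _ hw' hc
      have e2 := (IsSelfAdjoint.isSymm hA) _ _ _ _ hab hbc
      have e3 : (‖w'‖ : ℂ) ^ 2 = (‖b‖ : ℂ) ^ 2 := by
        exact (inner_self_eq_norm_sq_to_K (𝕜 := ℂ) w').symm.trans
          ((e1.trans e2.symm).trans (inner_self_eq_norm_sq_to_K (𝕜 := ℂ) b))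
      have e4 : ‖w'‖ ^ 2 = ‖b‖ ^ 2 := by exact_mod_cast e3
      exact (sq_eq_sq₀ (norm_nonneg _) (norm_nonneg _)).1 e4
    have h2 : ∀ n, (E n x, E n y) ∈ A.graph := fun n => (hcomm n x y hxy).1 ▸ hEG n x
    intro n m
    refine ⟨gen (E n x - E m x) _ (G n y - G m y) ?_ ?_ (v n - v m) ?_, gen _ _ _ (h2 n) (hEG n y) _ (hv n)⟩
    · exact A.graph.sub_mem (h2 n) (h2 m)
    · exact A.graph.sub_mem (hEG n y) (hEG m y)
    · exact S.graph.sub_mem (hv n) (hv m)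
  have hcau : CauchySeq v := by
    have hc := (hE y).cauchySeq
    rw [Metric.cauchySeq_iff] at hc ⊢
    intro ε hε
    obtain ⟨N, hN⟩ := hc ε hε
    refine ⟨N, fun m hm n hn => ?_⟩
    rw [dist_eq_norm, (hnorm m n).1, ← dist_eq_norm]
    exact hN m hm n hn
  obtain ⟨w, hw⟩ := cauchySeq_tendsto_of_complete hcau
  refine ⟨w, ?_, ?_⟩
  · exact hS.1.isClosed.mem_of_tendsto ((hE x).prodMk_nhds hw) (Eventually.of_forall hv)
  · refine tendsto_nhds_unique hw.norm ?_
    simp only [(hnorm _ 0).2]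
    exact (hE y).norm

/-- V = (|A| + 1)(A - i)⁻¹ is bounded because |A| and A have the same norms on dom A. This transfers
hypotheses on B(t) (|A| + 1)⁻¹ to B(t) (A - i)⁻¹ by composing with V on the right. -/
theorem exists_absInv_comp {A : H →ₗ.[ℂ] H} (hA : IsSelfAdjoint A) :
    ∃ V : H →L[ℂ] H, ∀ x, absInv A (V x) = resolv A Complex.I x := by
  have hS : IsAbs A (absOp A) := Classical.epsilon_spec (exists_isAbs hA)
  set S := absOp A with hSdef
  have hp : Complex.I ∈ resolventSet A := mem_resolventSet_of_im_ne_zero hA (by simp)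
  -- Nonnegativity of S gives ‖(S + 1) x‖ ≥ ‖x‖.
  have hm : (-1 : ℂ) ∈ resolventSet S := by
    have hb : ∀ x y, (x, y) ∈ S.graph → 1 * ‖x‖ ≤ ‖y - (-1 : ℂ) • x‖ := by
      intro x y h
      obtain ⟨a, rfl, rfl⟩ := (LinearPMap.mem_graph_iff _).1 h
      have h1 := hS.2.1 a
      simp only [neg_smul, one_smul, sub_neg_eq_add, one_mul]
      refine abs_le_of_sq_le_sq' ?_ (norm_nonneg _) |>.2
      rw [@norm_add_sq ℂ]
      have : 0 ≤ RCLike.re (inner ℂ (S a) (a : H)) := h1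
      nlinarith [sq_nonneg ‖S a‖]
    refine mem_resolventSet_of_bound hS.1 one_pos hb ?_
    simpa using hb
  have hdom : ∀ x, resolv A Complex.I x ∈ S.domain := fun x => by
    obtain ⟨v, hv, -⟩ := hS.exists_mem_graph hA (resolv_mem_graph hp x)
    exact LinearPMap.mem_domain_of_mem_graph hv
  let V₀ : H →ₗ[ℂ] H := S.toFun ∘ₗ
    ((resolv A Complex.I : H →ₗ[ℂ] H).codRestrict S.domain hdom)
  have hV₀ : ∀ x, (resolv A Complex.I x, V₀ x) ∈ S.graph := fun x =>
    S.mem_graph ⟨resolv A Complex.I x, hdom x⟩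
  have hV₀n : ∀ x, ‖V₀ x‖ ≤ 1 * ‖x‖ := fun x => by
    obtain ⟨v, hv, hvn⟩ := hS.exists_mem_graph hA (resolv_mem_graph hp x)
    have : V₀ x = v := S.mem_graph_snd_inj (hV₀ x) hv rfl
    rw [this, hvn, one_mul]
    have := (IsSelfAdjoint.isSymm hA).norm_le_of_re_eq_zero (resolv_mem_graph hp x)
      (z := Complex.I) (by simp)
    simpa using this
  refine ⟨V₀.mkContinuous 1 hV₀n + resolv A Complex.I, fun x => ?_⟩
  have := resolv_sub hm (hV₀ x)
  rw [neg_smul, one_smul, sub_neg_eq_add] at this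
  exact this

end AbsoluteValue

end ModelOperator

end

noncomputable section

namespace ModelOperator

/-! ### Compact operators and strong convergence. -/

section Compact

variable {E F G : Type*} [NormedAddCommGroup E] [InnerProductSpace ℂ E]
  [NormedAddCommGroup F] [InnerProductSpace ℂ F] [NormedAddCommGroup G] [InnerProductSpace ℂ G]

theorem IsCompactOperator.exists_finite_net {K : E →L[ℂ] F} (hK : IsCompactOperator K) {ε : ℝ}
    (hε : 0 < ε) : ∃ t : Set F, t.Finite ∧ ∀ x, ‖x‖ ≤ 1 → ∃ y ∈ t, ‖K x - y‖ < ε := by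
  have h : TotallyBounded (K '' Metric.closedBall 0 1) :=
    (IsCompactOperator.isCompact_closure_image_closedBall (f := (K : E →ₗ[ℂ] F)) hK
      1).totallyBounded.subset subset_closure
  obtain ⟨t, ht, hcov⟩ := Metric.totallyBounded_iff.1 h ε hε
  refine ⟨t, ht, fun x hx => ?_⟩
  have := hcov ⟨x, by simpa using hx, rfl⟩
  simp only [Set.mem_iUnion, Metric.mem_ball, exists_prop, dist_eq_norm] at this
  exact this

/-- Compact operators are limits of operators of finite rank. -/
theorem IsCompactOperator.exists_finiteDimensional_approx {K : E →L[ℂ] F}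
    (hK : IsCompactOperator K) {ε : ℝ} (hε : 0 < ε) :
    ∃ (V : Submodule ℂ F) (_ : FiniteDimensional ℂ V),
      ‖K - V.starProjection ∘L K‖ ≤ ε := by
  obtain ⟨t, ht, hnet⟩ := IsCompactOperator.exists_finite_net hK hε
  have hfd : FiniteDimensional ℂ (Submodule.span ℂ t) := FiniteDimensional.span_of_finite ℂ ht
  refine ⟨Submodule.span ℂ t, hfd, ?_⟩
  refine ContinuousLinearMap.opNorm_le_of_unit_norm hε.le fun x hx => ?_
  obtain ⟨y, hy, hxy⟩ := hnet x hx.le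
  refine le_trans ?_ hxy.le
  change ‖K x - (Submodule.span ℂ t).starProjection (K x)‖ ≤ _
  rw [Submodule.starProjection_minimal]
  exact ciInf_le ⟨0, by rintro _ ⟨z, rfl⟩; exact norm_nonneg _⟩
    (⟨y, Submodule.subset_span hy⟩ : Submodule.span ℂ t)

theorem isCompactOperator_of_finiteDimensional_range {V : Submodule ℂ F} [FiniteDimensional ℂ V]
    (K : E →L[ℂ] V) : IsCompactOperator (V.subtypeL ∘L K) :=
  (isCompactOperator_of_locallyCompactSpace_dom K).clm_comp V.subtypeL

theorem isCompactOperator_starProjection_comp (V : Submodule ℂ F) [FiniteDimensional ℂ V]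
    (K : E →L[ℂ] F) : IsCompactOperator (V.starProjection ∘L K) :=
  isCompactOperator_of_finiteDimensional_range (V.orthogonalProjectionOnto ∘L K)

theorem isCompactOperator_of_forall_norm_sub_le [CompleteSpace F] {K : E →L[ℂ] F}
    (h : ∀ ε > 0, ∃ L : E →L[ℂ] F, IsCompactOperator L ∧ ‖K - L‖ ≤ ε) : IsCompactOperator K := by
  have hc : IsClosed {f : E →L[ℂ] F | IsCompactOperator f} := isClosed_setOfPred_isCompactOperator
  have hmem : K ∈ closure {f : E →L[ℂ] F | IsCompactOperator f} := ?_
  · rwa [hc.closure_eq] at hmem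
  rw [Metric.mem_closure_iff]
  intro ε hε
  obtain ⟨L, hL, hn⟩ := h (ε / 2) (by positivity)
  exact ⟨L, hL, by rw [dist_eq_norm]; linarith⟩

/-- Approximating K by P K with P a finite rank projection, the adjoints K* P have finite rank, and
taking adjoints is isometric. -/
theorem IsCompactOperator.adjoint [CompleteSpace E] [CompleteSpace F] {K : E →L[ℂ] F}
    (hK : IsCompactOperator K) : IsCompactOperator (ContinuousLinearMap.adjoint K) := by
  refine isCompactOperator_of_forall_norm_sub_le fun ε hε => ?_
  obtain ⟨V, hV, hn⟩ := IsCompactOperator.exists_finiteDimensional_approx hK hε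
  refine ⟨ContinuousLinearMap.adjoint (V.starProjection ∘L K), ?_, ?_⟩
  · rw [ContinuousLinearMap.adjoint_comp]
    have : ContinuousLinearMap.adjoint V.starProjection = V.starProjection := by
      symm
      rw [ContinuousLinearMap.eq_adjoint_iff]
      exact Submodule.inner_starProjection_left_eq_right V
    rw [this]
    have h2 := isCompactOperator_starProjection_comp V (ContinuousLinearMap.id ℂ F)
    exact h2.clm_comp (ContinuousLinearMap.adjoint K)
  · rw [← map_sub, LinearIsometryEquiv.norm_map]
    exact hn

/-- Bounded strong convergence is uniform on totally bounded sets, such as the image of the unit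
ball under K. -/
theorem tendsto_comp_of_isCompactOperator {ι : Type*} {l : Filter ι} {T : ι → F →L[ℂ] G} {C : ℝ}
    (hT : ∀ i, ‖T i‖ ≤ C) (hlim : ∀ x, Tendsto (fun i => T i x) l (𝓝 0)) {K : E →L[ℂ] F}
    (hK : IsCompactOperator K) : Tendsto (fun i => ‖T i ∘L K‖) l (𝓝 0) := by
  rw [Metric.tendsto_nhds]
  intro ε hε
  obtain ⟨t, ht, hnet⟩ := IsCompactOperator.exists_finite_net hK
    (ε := ε / (4 * (|C| + 1))) (by positivity)
  have hev : ∀ᶠ i in l, ∀ y ∈ t, ‖T i y‖ < ε / 4 := (ht.eventually_all).2 fun y _ => by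
    have := (Metric.tendsto_nhds.1 (hlim y)) (ε / 4) (by positivity)
    simpa using this
  filter_upwards [hev] with i hi
  rw [dist_zero_right, norm_norm]
  refine lt_of_le_of_lt (b := ε / 2) ?_ (by linarith)
  refine ContinuousLinearMap.opNorm_le_of_unit_norm (by positivity) fun x hx => ?_
  obtain ⟨y, hy, hxy⟩ := hnet x hx.le
  have h1 : (T i ∘L K) x = T i (K x - y) + T i y := by simp
  rw [h1]
  have h2 : ‖T i (K x - y)‖ ≤ |C| * ‖K x - y‖ :=
    ((T i).le_opNorm _).trans (by gcongr; exact (hT i).trans (le_abs_self C))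
  rw [lt_div_iff₀ (by positivity)] at hxy
  have := hi y hy
  have h3 := norm_add_le (T i (K x - y)) (T i y)
  nlinarith [norm_nonneg (K x - y)]

/-- The adjoint of the previous statement. With the compact factor on the left, it is the adjoints
of the Tᵢ that must tend to zero strongly. -/
theorem tendsto_isCompactOperator_comp [CompleteSpace E] [CompleteSpace F] [CompleteSpace G]
    {ι : Type*} {l : Filter ι} {T : ι → G →L[ℂ] E} {C : ℝ}
    (hT : ∀ i, ‖T i‖ ≤ C) (hlim : ∀ x, Tendsto (fun i => ContinuousLinearMap.adjoint (T i) x) l (𝓝 0))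
    {K : E →L[ℂ] F} (hK : IsCompactOperator K) : Tendsto (fun i => ‖K ∘L T i‖) l (𝓝 0) := by
  have := tendsto_comp_of_isCompactOperator (T := fun i => ContinuousLinearMap.adjoint (T i))
    (fun i => (LinearIsometryEquiv.norm_map _ _).trans_le (hT i)) hlim
    (IsCompactOperator.adjoint hK)
  refine this.congr fun i => ?_
  rw [← ContinuousLinearMap.adjoint_comp, LinearIsometryEquiv.norm_map]

end Compact

/-! ### Trace class operators: norm bound and compactness. -/

section TraceNorm

variable {H : Type*} [NormedAddCommGroup H] [InnerProductSpace ℂ H] [CompleteSpace H]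

/-- This turns the trace of |K| into a Hilbert–Schmidt sum for √|K|. -/
theorem norm_sqrt_abs_sq (K : H →L[ℂ] H) (x : H) :
    ‖CFC.sqrt (CFC.abs K) x‖ ^ 2 = (inner ℂ x (CFC.abs K x)).re := by
  have h0 : 0 ≤ CFC.sqrt (CFC.abs K) := CFC.sqrt_nonneg _
  have h1 := ((ContinuousLinearMap.nonneg_iff_isPositive _).1 h0).isSymmetric x
    (CFC.sqrt (CFC.abs K) x)
  have h2 : CFC.sqrt (CFC.abs K) (CFC.sqrt (CFC.abs K) x) = CFC.abs K x :=
    DFunLike.congr_fun (CFC.sqrt_mul_sqrt_self _ (CFC.abs_nonneg K)) x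
  rw [← h2]
  have h3 := inner_self_eq_norm_sq (𝕜 := ℂ) (CFC.sqrt (CFC.abs K) x)
  rw [← h3]
  exact congrArg Complex.re h1

/-- Any unit vector extends to a Hilbert basis, so ‖√|K| x‖² is a single term of a trace and ‖√|K|‖²
is at most the trace norm. -/
theorem enorm_le_traceNorm (K : H →L[ℂ] H) : ‖K‖ₑ ≤ traceNorm K := by
  by_cases htop : traceNorm K = ∞
  · rw [htop]; exact le_top
  set τ := (traceNorm K).toReal with hτ
  have hτ0 : 0 ≤ τ := ENNReal.toReal_nonneg
  have key : ∀ x : H, ‖x‖ = 1 → ‖CFC.sqrt (CFC.abs K) x‖ ≤ √τ := by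
    intro x hx
    have ho : Orthonormal ℂ ((↑) : ({x} : Set H) → H) := by
      refine ⟨fun i => ?_, fun i j hij => (hij (Subsingleton.elim i j)).elim⟩
      rw [show (i : H) = x from i.2, hx]
    obtain ⟨w, b, hw, hb⟩ := ho.exists_hilbertBasis_extension
    have hx' : x ∈ w := hw rfl
    refine Real.le_sqrt_of_sq_le ?_
    rw [norm_sqrt_abs_sq, hτ, ← ENNReal.ofReal_le_iff_le_toReal htop]
    refine le_trans ?_ (le_iSup₂_of_le (f := fun (w : Set H) (b : HilbertBasis w ℂ H) =>
      ∑' i, ENNReal.ofReal (inner ℂ (b i) (CFC.abs K (b i))).re) w b le_rfl)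
    refine le_trans ?_ (ENNReal.le_tsum ⟨x, hx'⟩)
    rw [hb]
  have h1 : ‖CFC.sqrt (CFC.abs K)‖ ≤ √τ :=
    ContinuousLinearMap.opNorm_le_of_unit_norm (Real.sqrt_nonneg _) key
  have h2 : ‖K‖ ≤ τ := by
    rw [← CFC.norm_abs, ← CFC.sqrt_mul_sqrt_self (CFC.abs K) (CFC.abs_nonneg K)]
    refine (norm_mul_le _ _).trans ?_
    nlinarith [Real.sq_sqrt hτ0, norm_nonneg (CFC.sqrt (CFC.abs K)), Real.sqrt_nonneg τ]
  rw [← ofReal_norm]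
  exact (ENNReal.ofReal_le_iff_le_toReal htop).2 h2

/-- √|K| is Hilbert–Schmidt, hence a limit of finite rank operators, and |K| is its square. Passing
from |K| to K needs no polar decomposition, only ‖K T‖ = ‖|K| T‖. -/
theorem isCompactOperator_of_traceNorm {K : H →L[ℂ] H} (hK : traceNorm K < ∞) :
    IsCompactOperator K := by
  set s := CFC.sqrt (CFC.abs K) with hs
  have hs0 : 0 ≤ s := CFC.sqrt_nonneg _
  have hsymm := ((ContinuousLinearMap.nonneg_iff_isPositive _).1 hs0).isSymmetric
  obtain ⟨w, b, -⟩ := exists_hilbertBasis ℂ H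
  have hsum : ∑' i, ENNReal.ofReal (inner ℂ (b i) (CFC.abs K (b i))).re < ∞ :=
    lt_of_le_of_lt (le_iSup₂_of_le (f := fun (w : Set H) (b : HilbertBasis w ℂ H) =>
      ∑' i, ENNReal.ofReal (inner ℂ (b i) (CFC.abs K (b i))).re) w b le_rfl) hK
  simp only [← norm_sqrt_abs_sq, ← hs] at hsum
  have hsummable : Summable fun i => ‖s (b i)‖ ^ 2 := by
    have := ENNReal.summable_toReal hsum.ne
    simpa only [ENNReal.toReal_ofReal (sq_nonneg _)] using this
  classical
  have hscomp : IsCompactOperator s := by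
    refine isCompactOperator_of_forall_norm_sub_le fun ε hε => ?_
    -- The finite set t leaves a tail of the Hilbert–Schmidt sum below ε²; projecting onto the span
    -- of its basis vectors costs at most that tail.
    obtain ⟨t, ht⟩ := ((Metric.tendsto_nhds.1 hsummable.hasSum) (ε ^ 2) (by positivity)).exists
    rw [dist_comm, Real.dist_eq] at ht
    let V : Submodule ℂ H := Submodule.span ℂ (b '' (t : Set w))
    have hV : FiniteDimensional ℂ V := FiniteDimensional.span_of_finite ℂ (t.finite_toSet.image _)
    refine ⟨V.starProjection ∘L s, isCompactOperator_starProjection_comp V s, ?_⟩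
    refine ContinuousLinearMap.opNorm_le_of_unit_norm hε.le fun y hy => ?_
    have hv : (s - V.starProjection ∘L s) y = s y - V.starProjection (s y) := rfl
    rw [hv]
    set v := s y - V.starProjection (s y) with hvdef
    have hvV : v ∈ Vᗮ := V.sub_starProjection_mem_orthogonal _
    have hin : ∀ i ∈ t, inner ℂ (b i) v = 0 := fun i hi =>
      (Submodule.mem_orthogonal _ _).1 hvV _ (Submodule.subset_span ⟨i, hi, rfl⟩)
    have hout : ∀ i ∉ t, inner ℂ (b i) v = inner ℂ (b i) (s y) := by
      intro i hi
      rw [hvdef, inner_sub_right, sub_eq_self]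
      have hmem : V ≤ (Submodule.span ℂ {b i})ᗮ := by
        rw [Submodule.span_le]
        rintro _ ⟨j, hj, rfl⟩
        rw [SetLike.mem_coe, Submodule.mem_orthogonal_singleton_iff_inner_right]
        exact b.orthonormal.2 fun h => hi (h ▸ hj)
      exact Submodule.mem_orthogonal_singleton_iff_inner_right.1
        (hmem (V.starProjection_apply_mem _))
    have hle : ∀ i, ‖inner ℂ (b i) v‖ ^ 2 ≤
        ‖s (b i)‖ ^ 2 - (if i ∈ t then ‖s (b i)‖ ^ 2 else 0) := by
      intro i
      by_cases hi : i ∈ t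
      · simp [hin i hi, hi]
      · rw [if_neg hi, sub_zero, hout i hi]
        have : inner ℂ (b i) (s y) = inner ℂ (s (b i)) y := (hsymm (b i) y).symm
        rw [this]
        gcongr
        simpa [hy] using norm_inner_le_norm (𝕜 := ℂ) (s (b i)) y
    have hs1 : HasSum (fun i => ‖inner ℂ (b i) v‖ ^ 2) (‖v‖ ^ 2) := by
      have := Complex.hasSum_re (b.hasSum_inner_mul_inner v v)
      have h3 := inner_self_eq_norm_sq (𝕜 := ℂ) v
      rw [← h3]
      change HasSum _ (inner ℂ v v).re
      convert this using 2 with i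
      rw [← inner_conj_symm v (b i), ← Complex.normSq_eq_conj_mul_self, Complex.ofReal_re,
        Complex.normSq_eq_norm_sq]
    have hs2 : HasSum (fun i => ‖s (b i)‖ ^ 2 - (if i ∈ t then ‖s (b i)‖ ^ 2 else 0))
        (∑' i, ‖s (b i)‖ ^ 2 - ∑ i ∈ t, ‖s (b i)‖ ^ 2) := by
      refine hsummable.hasSum.sub ?_
      have h4 : ∑ i ∈ t, ‖s (b i)‖ ^ 2 = ∑ i ∈ t, if i ∈ t then ‖s (b i)‖ ^ 2 else 0 :=
        Finset.sum_congr rfl fun i hi => (if_pos hi).symm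
      rw [h4]
      exact hasSum_sum_of_ne_finset_zero fun i hi => if_neg hi
    have := hasSum_le hle hs1 hs2
    exact abs_le_of_sq_le_sq' (this.trans ((le_abs_self _).trans ht.le)) hε.le |>.2
  have hcabs : IsCompactOperator (CFC.abs K : H →L[ℂ] H) := by
    have h1 := hscomp.clm_comp s
    have h2 : s * s = CFC.abs K := CFC.sqrt_mul_sqrt_self (CFC.abs K) (CFC.abs_nonneg K)
    rw [← h2]
    exact h1
  -- Both squared norms equal ‖T* |K|² T‖.
  have hn : ∀ T : H →L[ℂ] H, ‖K * T‖ = ‖CFC.abs K * T‖ := by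
    intro T
    have : ∀ S : H →L[ℂ] H, ‖S * T‖ ^ 2 = ‖star T * (star S * S) * T‖ := fun S => by
      rw [sq, ← CStarRing.norm_star_mul_self, star_mul]
      simp only [mul_assoc]
    refine (sq_eq_sq₀ (norm_nonneg _) (norm_nonneg _)).1 ?_
    rw [this, this, (CFC.abs_nonneg K).isSelfAdjoint.star_eq, CFC.abs_mul_abs]
  refine isCompactOperator_of_forall_norm_sub_le fun ε hε => ?_
  -- Approximating the adjoint puts the projection on the right of |K|, where it can be carried over
  -- to K.
  obtain ⟨V, hV, hVn⟩ := IsCompactOperator.exists_finiteDimensional_approx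
    (IsCompactOperator.adjoint hcabs) hε
  refine ⟨K ∘L V.starProjection,
    (isCompactOperator_starProjection_comp V (ContinuousLinearMap.id ℂ H)).clm_comp K, ?_⟩
  have h1 : K - K ∘L V.starProjection = K * (1 - V.starProjection) := by
    rw [mul_sub, mul_one]; rfl
  rw [h1, hn, ← norm_star]
  refine le_trans (le_of_eq ?_) hVn
  congr 1
  have hst : star V.starProjection = V.starProjection := by
    rw [ContinuousLinearMap.star_eq_adjoint]
    symm
    rw [ContinuousLinearMap.eq_adjoint_iff]
    exact Submodule.inner_starProjection_left_eq_right V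
  rw [star_mul, star_sub, star_one, hst, sub_mul, one_mul]
  rfl

end TraceNorm

end ModelOperator

end

noncomputable section

namespace ModelOperator

/-! ### Vector-valued absolutely continuous functions. -/

section AbsolutelyContinuous

theorem absolutelyContinuousOnInterval_of_dist_le {X : Type*} [PseudoMetricSpace X] {f : ℝ → X}
    {V : ℝ → ℝ} {a b C : ℝ} (hV : AbsolutelyContinuousOnInterval V a b)
    (h : ∀ s ∈ Set.uIcc a b, ∀ t ∈ Set.uIcc a b, dist (f s) (f t) ≤ C * dist (V s) (V t)) :
    AbsolutelyContinuousOnInterval f a b := by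
  refine squeeze_zero' (Eventually.of_forall fun E => Finset.sum_nonneg fun _ _ => dist_nonneg) ?_
    (by simpa using Tendsto.const_mul C hV)
  refine eventually_inf_principal.2 (Eventually.of_forall fun E hE => ?_)
  rw [Finset.mul_sum]
  exact Finset.sum_le_sum fun i hi => h _ (hE.1 i hi).1 _ (hE.1 i hi).2

variable {F : Type*} [NormedAddCommGroup F] [NormedSpace ℝ F]

theorem norm_intervalIntegral_le_dist {h : ℝ → F} {c s t : ℝ}
    (hh : ∀ a b, IntervalIntegrable h volume a b) :
    ‖∫ x in s..t, h x‖ ≤ dist (∫ x in c..s, ‖h x‖) (∫ x in c..t, ‖h x‖) := by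
  rw [dist_comm, Real.dist_eq, intervalIntegral.integral_interval_sub_left (hh c t).norm
    (hh c s).norm]
  exact intervalIntegral.norm_integral_le_abs_integral_norm

theorem absolutelyContinuousOnInterval_integral [CompleteSpace F] {h : ℝ → F}
    (hh : ∀ a b, IntervalIntegrable h volume a b) (a b c : ℝ) :
    AbsolutelyContinuousOnInterval (fun x => ∫ v in c..x, h v) a b := by
  -- The window [-M, M] contains the base point c as well, which need not lie between a and b.
  set M := |a| + |b| + |c| with hM
  have hmem : ∀ x, |x| ≤ M → x ∈ Set.uIcc (-M) M := fun x hx => Set.Icc_subset_uIcc (abs_le.1 hx)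
  have ha : |a| ≤ M := by linarith [abs_nonneg a, abs_nonneg b, abs_nonneg c]
  have hb : |b| ≤ M := by linarith [abs_nonneg a, abs_nonneg b, abs_nonneg c]
  have hc : |c| ≤ M := by linarith [abs_nonneg a, abs_nonneg b, abs_nonneg c]
  have hV : AbsolutelyContinuousOnInterval (fun x => ∫ v in c..x, ‖h v‖) a b :=
    (IntervalIntegrable.absolutelyContinuousOnInterval_intervalIntegral (hh (-M) M).norm
      (hmem c hc)).mono (Set.uIcc_subset_uIcc (hmem a ha) (hmem b hb))
  refine absolutelyContinuousOnInterval_of_dist_le (C := 1) hV fun s _ t _ => ?_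
  rw [one_mul, dist_eq_norm, intervalIntegral.integral_interval_sub_left (hh c s) (hh c t), dist_comm]
  exact norm_intervalIntegral_le_dist hh

/-- The fundamental theorem of calculus for absolutely continuous functions. -/
theorem integral_eq_sub_of_absolutelyContinuous [CompleteSpace F] {f f' : ℝ → F} {a b : ℝ}
    (hf : AbsolutelyContinuousOnInterval f a b) (hd : ∀ᵐ t, HasDerivAt f (f' t) t)
    (hi : LocallyIntegrable f') : ∫ t in a..b, f' t = f b - f a := by
  have hii : ∀ a b, IntervalIntegrable f' volume a b := fun a b =>
    (hi.integrableOn_isCompact isCompact_uIcc).intervalIntegrable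
  have hac := hf.sub (absolutelyContinuousOnInterval_integral hii a b a)
  -- f minus the primitive of its derivative is absolutely continuous with zero derivative almost
  -- everywhere, hence constant.
  obtain ⟨C, hC⟩ := hac.const_of_ae_hasDerivAt_zero (by
    filter_upwards [hd, LocallyIntegrable.ae_hasDerivAt_integral hi] with x h1 h2 _
    simpa using h1.sub (h2 a))
  have h1 := hC a Set.left_mem_uIcc
  have h2 := hC b Set.right_mem_uIcc
  simp only [Pi.sub_apply, intervalIntegral.integral_same, sub_zero] at h1 h2
  rw [h1, ← h2]
  abel

end AbsolutelyContinuous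

/-! ### Operator families with an integrable weak derivative. -/

section WeakPrimitive

variable {H : Type*} [NormedAddCommGroup H] [InnerProductSpace ℂ H]

theorem enorm_le_of_forall_inner_le {s : Set H} (hs : Dense s) (T : H →L[ℂ] H) {c : ℝ≥0∞}
    (h : ∀ x ∈ s, ∀ y ∈ s, ‖inner ℂ x (T y)‖ₑ ≤ c * (‖x‖ₑ * ‖y‖ₑ)) : ‖T‖ₑ ≤ c := by
  by_cases hc : c = ∞
  · rw [hc]; exact le_top
  lift c to NNReal using hc
  have h1 : ∀ x ∈ s, ∀ y ∈ s, ‖inner ℂ x (T y)‖ ≤ c * (‖x‖ * ‖y‖) := by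
    intro x hx y hy
    have := h x hx y hy
    simp only [enorm_eq_nnnorm] at this
    exact_mod_cast this
  have h2 : ∀ x, ∀ y ∈ s, ‖inner ℂ x (T y)‖ ≤ c * (‖x‖ * ‖y‖) := fun x y hy =>
    hs.induction (P := fun x => ‖inner ℂ x (T y)‖ ≤ c * (‖x‖ * ‖y‖)) (fun x hx => h1 x hx y hy)
      (isClosed_le (by fun_prop) (by fun_prop)) x
  have h3 : ∀ x y, ‖inner ℂ x (T y)‖ ≤ c * (‖x‖ * ‖y‖) := fun x y =>
    hs.induction (P := fun y => ‖inner ℂ x (T y)‖ ≤ c * (‖x‖ * ‖y‖)) (fun y hy => h2 x y hy)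
      (isClosed_le (by fun_prop) (by fun_prop)) y
  have h4 : ‖T‖ ≤ c := T.opNorm_le_bound c.2 fun y => by
    have := h3 (T y) y
    rw [norm_inner_symm, inner_self_eq_norm_sq_to_K, norm_pow] at this
    simp only [Complex.coe_algebraMap, Complex.norm_real, norm_norm] at this
    by_cases h0 : ‖T y‖ = 0
    · rw [h0]; positivity
    · have hpos : 0 < ‖T y‖ := lt_of_le_of_ne (norm_nonneg _) (Ne.symm h0)
      refine le_of_mul_le_mul_left ?_ hpos
      calc _ = ‖T y‖ ^ 2 := by ring
        _ ≤ _ := this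
        _ = _ := by ring
  rw [enorm_eq_nnnorm]
  exact_mod_cast h4

theorem enorm_inner_apply_le (T : H →L[ℂ] H) (x y : H) :
    ‖inner ℂ x (T y)‖ₑ ≤ ‖T‖ₑ * (‖x‖ₑ * ‖y‖ₑ) := by
  have : ‖inner ℂ x (T y)‖ ≤ ‖T‖ * (‖x‖ * ‖y‖) := by
    refine (norm_inner_le_norm _ _).trans ?_
    calc _ ≤ ‖x‖ * (‖T‖ * ‖y‖) := by gcongr; exact T.le_opNorm y
      _ = _ := by ring
  simp only [enorm_eq_nnnorm]
  exact_mod_cast this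

/-- The norm of a weakly measurable operator family is measurable. -/
theorem aemeasurable_enorm_of_weak [TopologicalSpace.SeparableSpace H] {K : ℝ → H →L[ℂ] H}
    (hK : ∀ g h, AEMeasurable fun t => inner ℂ g (K t h)) : AEMeasurable fun t => ‖K t‖ₑ := by
  have hd := TopologicalSpace.denseRange_denseSeq H
  set d := TopologicalSpace.denseSeq H
  -- The norm is a countable supremum of normalized matrix elements. If `d m` or `d n` vanishes the
  -- quotient is 0 / 0 = 0, which is harmless.
  have heq : (fun t => ‖K t‖ₑ) = fun t => ⨆ p : ℕ × ℕ,
      ‖inner ℂ (d p.1) (K t (d p.2))‖ₑ / (‖d p.1‖ₑ * ‖d p.2‖ₑ) := by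
    funext t
    refine le_antisymm (enorm_le_of_forall_inner_le hd _ ?_) (iSup_le fun p => ?_)
    · rintro _ ⟨m, rfl⟩ _ ⟨n, rfl⟩
      refine le_trans ?_ (mul_le_mul_left
        (le_iSup (fun p : ℕ × ℕ => ‖inner ℂ (d p.1) (K t (d p.2))‖ₑ / (‖d p.1‖ₑ * ‖d p.2‖ₑ))
          (m, n)) _)
      by_cases h0 : ‖d m‖ₑ * ‖d n‖ₑ = 0
      · rcases mul_eq_zero.1 h0 with h | h <;> rw [enorm_eq_zero] at h <;> simp [h]
      · rw [ENNReal.div_mul_cancel h0 (ENNReal.mul_ne_top enorm_ne_top enorm_ne_top)]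
    · exact ENNReal.div_le_of_le_mul (enorm_inner_apply_le _ _ _)
  rw [heq]
  exact AEMeasurable.iSup fun p => (hK _ _).enorm.div_const _

/-- The family `K` is weakly locally absolutely continuous and vanishes weakly at `-∞`, and its
weak derivative `K'` is integrable, with compact values. -/
structure IsWeakPrimitive (K K' : ℝ → H →L[ℂ] H) : Prop where
  absCont : ∀ (g h : H) (a b : ℝ), AbsolutelyContinuousOnInterval (fun t => inner ℂ g (K t h)) a b
  hasDeriv : ∀ g h : H, ∀ᵐ t : ℝ,
    HasDerivAt (fun s => inner ℂ g (K s h)) (inner ℂ g (K' t h)) t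
  compact : ∀ t, IsCompactOperator (K' t)
  lintegral_lt_top : ∫⁻ t, ‖K' t‖ₑ < ∞
  tendsto_atBot : ∀ g h : H, Tendsto (fun t => inner ℂ g (K t h)) atBot (𝓝 0)

namespace IsWeakPrimitive

variable {K K' : ℝ → H →L[ℂ] H}

/-- Matrix elements of K' agree almost everywhere with a pointwise derivative, and `deriv` is always
measurable. -/
theorem aemeasurable_inner (hK : IsWeakPrimitive K K') (g h : H) :
    AEMeasurable fun t => inner ℂ g (K' t h) :=
  ⟨_, measurable_deriv fun s => inner ℂ g (K s h),
    (hK.hasDeriv g h).mono fun _ ht => ht.deriv.symm⟩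

theorem integrable_inner (hK : IsWeakPrimitive K K') (g h : H) :
    Integrable fun t => inner ℂ g (K' t h) := by
  refine ⟨(hK.aemeasurable_inner g h).aestronglyMeasurable, ?_⟩
  refine lt_of_le_of_lt (lintegral_mono fun t => enorm_inner_apply_le (K' t) g h) ?_
  rw [lintegral_mul_const' _ _ (ENNReal.mul_ne_top enorm_ne_top enorm_ne_top)]
  exact ENNReal.mul_lt_top hK.lintegral_lt_top
    (ENNReal.mul_lt_top enorm_lt_top enorm_lt_top)

theorem integral_inner (hK : IsWeakPrimitive K K') (g h : H) (a b : ℝ) :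
    ∫ t in a..b, inner ℂ g (K' t h) = inner ℂ g (K b h) - inner ℂ g (K a h) :=
  integral_eq_sub_of_absolutelyContinuous (hK.absCont g h a b) (hK.hasDeriv g h)
    (hK.integrable_inner g h).locallyIntegrable

/-- The fundamental theorem of calculus on matrix elements. T stays inside the integral because
later smallness comes from K'(t) T, not from K'(t). -/
theorem enorm_sub_comp_le (hK : IsWeakPrimitive K K') (T : H →L[ℂ] H) {a b : ℝ} (hab : a ≤ b) :
    ‖(K b - K a) ∘L T‖ₑ ≤ ∫⁻ t in Set.Ioc a b, ‖K' t ∘L T‖ₑ := by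
  refine enorm_le_of_forall_inner_le dense_univ _ fun g _ h _ => ?_
  have h1 : inner ℂ g (((K b - K a) ∘L T) h) = ∫ t in Set.Ioc a b, inner ℂ g (K' t (T h)) := by
    rw [← intervalIntegral.integral_of_le hab, hK.integral_inner]
    simp
  rw [h1, ← lintegral_mul_const' _ _ (ENNReal.mul_ne_top enorm_ne_top enorm_ne_top)]
  refine (enorm_integral_le_lintegral_enorm _).trans (lintegral_mono fun t => ?_)
  exact enorm_inner_apply_le (K' t ∘L T) g h

variable [TopologicalSpace.SeparableSpace H]

theorem aemeasurable_enorm_comp (hK : IsWeakPrimitive K K') (T : H →L[ℂ] H) :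
    AEMeasurable fun t => ‖K' t ∘L T‖ₑ :=
  aemeasurable_enorm_of_weak fun g h => hK.aemeasurable_inner g (T h)

theorem integrable_norm (hK : IsWeakPrimitive K K') : Integrable fun t => ‖K' t‖ := by
  have hm : AEMeasurable fun t => ‖K' t‖ₑ := aemeasurable_enorm_of_weak hK.aemeasurable_inner
  have : (fun t => ‖K' t‖) = fun t => (‖K' t‖ₑ).toReal := by
    funext t; rw [toReal_enorm]
  rw [this]
  exact integrable_toReal_of_lintegral_ne_top hm hK.lintegral_lt_top.ne

/-- Increments of K are dominated by those of one bounded real function, which yields both norm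
continuity and the limits at ±∞. -/
theorem dist_le (hK : IsWeakPrimitive K K') (a b : ℝ) :
    dist (K a) (K b) ≤ dist (∫ t in Set.Iic a, ‖K' t‖) (∫ t in Set.Iic b, ‖K' t‖) := by
  wlog hab : a ≤ b generalizing a b
  · rw [dist_comm, dist_comm (∫ t in Set.Iic a, ‖K' t‖)]
    exact this b a (le_of_not_ge hab)
  have hi := hK.integrable_norm
  rw [dist_comm, dist_comm (∫ t in Set.Iic a, ‖K' t‖), Real.dist_eq,
    intervalIntegral.integral_Iic_sub_Iic hi.integrableOn hi.integrableOn, dist_eq_norm,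
    intervalIntegral.integral_of_le hab]
  refine le_trans ?_ (le_abs_self _)
  have h1 := hK.enorm_sub_comp_le (ContinuousLinearMap.id ℂ H) hab
  simp only [ContinuousLinearMap.comp_id] at h1
  have h2 : ∫⁻ t in Set.Ioc a b, ‖K' t‖ₑ = ENNReal.ofReal (∫ t in Set.Ioc a b, ‖K' t‖) := by
    rw [ofReal_integral_eq_lintegral_ofReal hi.integrableOn
      (Eventually.of_forall fun _ => norm_nonneg _)]
    simp only [ofReal_norm]
  rw [h2, ← ofReal_norm, ENNReal.ofReal_le_ofReal_iff (integral_nonneg fun _ => norm_nonneg _)] at h1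
  exact h1

end IsWeakPrimitive

end WeakPrimitive

end ModelOperator

end

noncomputable section

namespace ModelOperator

/-! ### Norm limits, uniform smallness and compactness of K. -/

namespace IsWeakPrimitive

variable {H : Type*} [NormedAddCommGroup H] [InnerProductSpace ℂ H]
  [TopologicalSpace.SeparableSpace H] {K K' : ℝ → H →L[ℂ] H}

theorem tendsto_integral_Iic_atTop (hK : IsWeakPrimitive K K') :
    Tendsto (fun a => ∫ t in Set.Iic a, ‖K' t‖) atTop (𝓝 (∫ t, ‖K' t‖)) :=
  (aecover_Iic (μ := volume) tendsto_id).integral_tendsto_of_countably_generated hK.integrable_norm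

theorem tendsto_integral_Iic_atBot (hK : IsWeakPrimitive K K') :
    Tendsto (fun a => ∫ t in Set.Iic a, ‖K' t‖) atBot (𝓝 0) := by
  have h1 : Tendsto (fun a => ∫ t in Set.Ioi a, ‖K' t‖) atBot (𝓝 (∫ t, ‖K' t‖)) :=
    (aecover_Ioi (μ := volume) tendsto_id).integral_tendsto_of_countably_generated
      hK.integrable_norm
  have h2 := h1.const_sub (∫ t, ‖K' t‖)
  rw [sub_self] at h2
  refine h2.congr fun a => ?_
  have := integral_add_compl (μ := volume) (s := Set.Iic a) measurableSet_Iic hK.integrable_norm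
  rw [Set.compl_Iic] at this
  linarith

theorem continuous (hK : IsWeakPrimitive K K') : Continuous K := by
  have hc : Continuous fun a => ∫ t in (0 : ℝ)..a, ‖K' t‖ :=
    intervalIntegral.continuous_primitive (fun a b => hK.integrable_norm.intervalIntegrable) 0
  rw [continuous_iff_continuousAt]
  intro t
  rw [ContinuousAt, tendsto_iff_dist_tendsto_zero]
  have h1 := tendsto_iff_dist_tendsto_zero.1 (hc.tendsto t)
  refine squeeze_zero (fun _ => dist_nonneg) (fun s => (hK.dist_le s t).trans (le_of_eq ?_)) h1
  have hi := hK.integrable_norm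
  rw [Real.dist_eq, Real.dist_eq, intervalIntegral.integral_Iic_sub_Iic hi.integrableOn
    hi.integrableOn, intervalIntegral.integral_interval_sub_left hi.intervalIntegrable
    hi.intervalIntegrable]

theorem exists_tendsto [CompleteSpace H] (hK : IsWeakPrimitive K K') {l : Filter ℝ} [l.NeBot]
    {c : ℝ} (hl : Tendsto (fun a => ∫ t in Set.Iic a, ‖K' t‖) l (𝓝 c)) :
    ∃ L, Tendsto K l (𝓝 L) := by
  refine cauchy_map_iff_exists_tendsto.1 (cauchy_map_iff.2 ⟨inferInstance, ?_⟩)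
  have h1 := (cauchy_map_iff.1 hl.cauchy_map).2
  rw [tendsto_uniformity_iff_dist_tendsto_zero] at h1 ⊢
  exact squeeze_zero (fun _ => dist_nonneg) (fun p => hK.dist_le p.1 p.2) h1

/-- A norm limit exists by the Cauchy property; its matrix elements are then known from the weak
limit. -/
theorem tendsto_zero_atBot [CompleteSpace H] (hK : IsWeakPrimitive K K') :
    Tendsto K atBot (𝓝 0) := by
  obtain ⟨L, hL⟩ := hK.exists_tendsto hK.tendsto_integral_Iic_atBot
  have : L = 0 := by
    ext h
    refine ext_inner_left ℂ fun g => ?_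
    have h1 : Tendsto (fun t => inner ℂ g (K t h)) atBot (𝓝 (inner ℂ g (L h))) :=
      ((continuous_const (y := g)).inner (continuous_eval_const h)).continuousAt.tendsto.comp hL
    rw [tendsto_nhds_unique h1 (hK.tendsto_atBot g h)]
    simp
  rwa [this] at hL

theorem enorm_comp_le [CompleteSpace H] (hK : IsWeakPrimitive K K') (T : H →L[ℂ] H) (t : ℝ) :
    ‖K t ∘L T‖ₑ ≤ ∫⁻ s, ‖K' s ∘L T‖ₑ := by
  have h1 : Tendsto (fun a => ‖(K t - K a) ∘L T‖ₑ) atBot (𝓝 ‖K t ∘L T‖ₑ) := by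
    have h2 : Tendsto (fun a => (K t - K a) ∘L T) atBot (𝓝 ((K t - 0) ∘L T)) := by
      have : Continuous fun S : H →L[ℂ] H => S ∘L T := by fun_prop
      exact (this.tendsto _).comp (hK.tendsto_zero_atBot.const_sub _)
    rw [sub_zero] at h2
    exact h2.enorm
  refine le_of_tendsto h1 ?_
  filter_upwards [eventually_le_atBot t] with a ha
  exact (hK.enorm_sub_comp_le T ha).trans (setLIntegral_le_lintegral _ _)

/-- ‖K(t) Tₙ‖ ≤ ∫ ‖K'(s) Tₙ‖ ds with a bound independent of t. The integrand tends to zero because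
K'(s) is compact, and is dominated by C ‖K'(s)‖. -/
theorem eventually_norm_comp_le [CompleteSpace H] (hK : IsWeakPrimitive K K')
    {T : ℕ → H →L[ℂ] H} {C : ℝ} (hT : ∀ n, ‖T n‖ ≤ C)
    (hlim : ∀ x, Tendsto (fun n => ContinuousLinearMap.adjoint (T n) x) atTop (𝓝 0)) {ε : ℝ}
    (hε : 0 < ε) : ∀ᶠ n in atTop, ∀ t, ‖K t ∘L T n‖ ≤ ε := by
  have h1 : Tendsto (fun n => ∫⁻ s, ‖K' s ∘L T n‖ₑ) atTop (𝓝 (∫⁻ _ : ℝ, 0)) := by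
    refine tendsto_lintegral_of_dominated_convergence' (fun s => ‖K' s‖ₑ * ENNReal.ofReal C)
      (fun n => hK.aemeasurable_enorm_comp (T n)) (fun n => Eventually.of_forall fun s => ?_) ?_
      (Eventually.of_forall fun s => ?_)
    · beta_reduce
      rw [← ofReal_norm, ← ofReal_norm, ← ENNReal.ofReal_mul (norm_nonneg _)]
      refine ENNReal.ofReal_le_ofReal ((ContinuousLinearMap.opNorm_comp_le _ _).trans ?_)
      gcongr
      exact hT n
    · rw [lintegral_mul_const' _ _ ENNReal.ofReal_ne_top]
      exact (ENNReal.mul_lt_top hK.lintegral_lt_top ENNReal.ofReal_lt_top).ne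
    · have := tendsto_isCompactOperator_comp hT hlim (hK.compact s)
      have h2 := ENNReal.tendsto_ofReal this
      simpa only [ofReal_norm, ENNReal.ofReal_zero] using h2
  rw [lintegral_zero] at h1
  have h2 : (0 : ℝ≥0∞) < ENNReal.ofReal ε := by simpa using hε
  filter_upwards [h1.eventually_lt_const h2] with n hn t
  have h3 := (hK.enorm_comp_le (T n) t).trans hn.le
  rw [← ofReal_norm, ENNReal.ofReal_le_ofReal_iff hε.le] at h3
  exact h3

/-- Take Tₙ = 1 - Pₙ with finite rank projections Pₙ increasing to the identity: K(t) is then a norm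
limit of the finite rank operators K(t) Pₙ. -/
theorem isCompactOperator [CompleteSpace H] (hK : IsWeakPrimitive K K') (t : ℝ) :
    IsCompactOperator (K t) := by
  let V : ℕ → Submodule ℂ H := fun n =>
    Submodule.span ℂ (TopologicalSpace.denseSeq H '' (Finset.range n : Set ℕ))
  have hV : ∀ n, FiniteDimensional ℂ (V n) := fun n =>
    FiniteDimensional.span_of_finite ℂ ((Finset.range n).finite_toSet.image _)
  have hmono : Monotone V := fun m n hmn =>
    Submodule.span_mono (Set.image_mono (by simpa using Set.Iio_subset_Iio hmn))
  have htop : ⊤ ≤ (⨆ n, V n).topologicalClosure := by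
    intro x _
    refine closure_mono ?_ (TopologicalSpace.denseRange_denseSeq H x)
    rintro _ ⟨n, rfl⟩
    exact Submodule.mem_iSup_of_mem (n + 1) (Submodule.subset_span ⟨n, by simp, rfl⟩)
  have hadj : ∀ n, ContinuousLinearMap.adjoint
      (ContinuousLinearMap.id ℂ H - (V n).starProjection) =
      ContinuousLinearMap.id ℂ H - (V n).starProjection := by
    intro n
    symm
    rw [ContinuousLinearMap.eq_adjoint_iff]
    intro x y
    simp only [sub_apply, ContinuousLinearMap.id_apply, inner_sub_left, inner_sub_right,
      Submodule.inner_starProjection_left_eq_right]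
  refine isCompactOperator_of_forall_norm_sub_le fun ε hε => ?_
  have hev := hK.eventually_norm_comp_le
    (T := fun n => ContinuousLinearMap.id ℂ H - (V n).starProjection) (C := 2) (fun n => ?_)
    (fun x => ?_) hε
  · obtain ⟨n, hn⟩ := hev.exists
    refine ⟨K t ∘L (V n).starProjection, (isCompactOperator_starProjection_comp (V n)
      (ContinuousLinearMap.id ℂ H)).clm_comp (K t), ?_⟩
    have := hn t
    rw [ContinuousLinearMap.comp_sub, ContinuousLinearMap.comp_id] at this
    exact this
  · refine (norm_sub_le _ _).trans ?_
    have h1 := (V n).starProjection_norm_le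
    have h2 := ContinuousLinearMap.norm_id_le (𝕜 := ℂ) (E := H)
    linarith
  · simp only [hadj]
    have := (Submodule.starProjection_tendsto_self V hmono x htop).const_sub x
    rw [sub_self] at this
    exact this

end IsWeakPrimitive

theorem isWeakPrimitive_of_relTraceClassFamily {H : Type*} [NormedAddCommGroup H]
    [InnerProductSpace ℂ H] [CompleteSpace H] {A : H →ₗ.[ℂ] H} {B B' : ℝ → H →ₗ.[ℂ] H}
    (hyp : RelTraceClassFamily A B B') :
    ∃ K K' : ℝ → H →L[ℂ] H, (∀ t x, (resolv A Complex.I x, K t x) ∈ (B t).graph) ∧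
      IsWeakPrimitive K K' := by
  have hA := hyp.selfAdjoint
  have hI : Complex.I ∈ resolventSet A := mem_resolventSet_of_im_ne_zero hA (by simp)
  obtain ⟨V, hV⟩ := exists_absInv_comp hA
  obtain ⟨K₀, hK₀, hfin, hint⟩ := hyp.traceClass
  have hdom : ∀ t x, resolv A Complex.I x ∈ (B t).domain := fun t x =>
    hyp.dom_le t (LinearPMap.mem_domain_of_mem_graph (resolv_mem_graph hI x))
  let L : ℝ → H →ₗ[ℂ] H := fun t => (B t).toFun ∘ₗ
    ((resolv A Complex.I : H →ₗ[ℂ] H).codRestrict (B t).domain (hdom t))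
  have hL : ∀ t x, (resolv A Complex.I x, L t x) ∈ (B t).graph := fun t x =>
    (B t).mem_graph ⟨resolv A Complex.I x, hdom t x⟩
  have hLc : ∀ t, Continuous (L t) := fun t => by
    -- B(t) (A - i)⁻¹ is everywhere defined with closed graph, because B(t) is closed and the
    -- resolvent is bounded.
    refine LinearMap.continuous_of_isClosed_graph (g := L t) ?_
    have h1 : IsClosed ((fun p : H × H => (resolv A Complex.I p.1, p.2)) ⁻¹'
        ((B t).graph : Set (H × H))) := (hyp.closed t).preimage (by fun_prop)
    convert h1 using 1
    ext ⟨x, y⟩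
    simp only [SetLike.mem_coe, LinearMap.mem_graph_iff, Set.mem_preimage]
    exact ⟨fun h => h ▸ hL t x, fun h => (B t).mem_graph_snd_inj h (hL t x) rfl⟩
  have hval : ∀ t x, L t x = val (B t) (absInv A (V x)) := fun t x => by
    rw [hV, val_eq_of_mem_graph (hL t x)]
  refine ⟨fun t => ⟨L t, hLc t⟩, fun t => K₀ t ∘L V, hL, ?_⟩
  constructor
  · intro g h a b
    have := hyp.absCont g (V h) a b
    simp only [← hval] at this
    exact this
  · intro g h
    have := hyp.hasDeriv g (V h)
    simp only [← hval, ← hK₀] at this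
    exact this
  · exact fun t => (isCompactOperator_of_traceNorm (hfin t)).comp_clm V
  · refine lt_of_le_of_lt (lintegral_mono (g := fun t => traceNorm (K₀ t) * ‖V‖ₑ) fun t => ?_) ?_
    · refine le_trans ?_ (mul_le_mul_left (enorm_le_traceNorm _) _)
      simp only [enorm_eq_nnnorm]
      exact_mod_cast ContinuousLinearMap.opNorm_comp_le (K₀ t) V
    · rw [lintegral_mul_const' _ _ enorm_ne_top]
      exact ENNReal.mul_lt_top hint enorm_lt_top
  · intro g h
    have := hyp.tendsto_atBot g (V h)
    simp only [← hval] at this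
    exact this

end ModelOperator

end

noncomputable section

namespace ModelOperator

/-! ### Relatively compact perturbations and norm resolvent convergence. -/

section Perturbation

variable {H : Type*} [NormedAddCommGroup H] [InnerProductSpace ℂ H]

theorem eq_of_resolv_eq {S T : H →ₗ.[ℂ] H} {z : ℂ} (hS : z ∈ resolventSet S)
    (hT : z ∈ resolventSet T) (h : resolv S z = resolv T z) : S = T := by
  have key : ∀ {S : H →ₗ.[ℂ] H}, z ∈ resolventSet S → ∀ x y,
      (x, y) ∈ S.graph ↔ resolv S z (y - z • x) = x := by
    intro S hS x y
    refine ⟨resolv_sub hS, fun h => ?_⟩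
    have := resolv_mem_graph hS (y - z • x)
    rwa [h, sub_add_cancel] at this
  apply LinearPMap.eq_of_eq_graph
  ext ⟨x, y⟩
  rw [key hS, key hT, h]

/-- If the range of `L` is contained in the range of an injective bounded operator `R`, then
`L = R S` for a bounded operator `S`. -/
theorem exists_eq_comp_of_range_le {E : Type*} [NormedAddCommGroup E] [NormedSpace ℂ E]
    [CompleteSpace E] [CompleteSpace H] (L : E →L[ℂ] H) (R : H →L[ℂ] H)
    (hR : Function.Injective R) (h : ∀ x, ∃ y, R y = L x) : ∃ S : E →L[ℂ] H, ∀ x, R (S x) = L x := by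
  choose S hS using h
  let S' : E →ₗ[ℂ] H :=
    { toFun := S
      map_add' := fun x y => hR (by rw [map_add, hS, hS, hS, map_add])
      map_smul' := fun c x => hR (by rw [map_smul, hS, hS, map_smul]; rfl) }
  have hc : Continuous S' := by
    refine LinearMap.continuous_of_isClosed_graph (g := S') ?_
    have h1 : IsClosed {p : E × H | R p.2 = L p.1} := isClosed_eq (by fun_prop) (by fun_prop)
    convert h1 using 1
    ext ⟨x, y⟩
    simp only [SetLike.mem_coe, LinearMap.mem_graph_iff, Set.mem_ofPred_eq]
    exact ⟨fun h => h ▸ hS x, fun h => hR (h.trans (hS x).symm)⟩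
  exact ⟨⟨S', hc⟩, hS⟩

/-- The operator `A + F (A - i)` with the domain of `A`. -/
def perturb (A : H →ₗ.[ℂ] H) (F : H →L[ℂ] H) : H →ₗ.[ℂ] H where
  domain := A.domain
  toFun := A.toFun + (F : H →ₗ[ℂ] H) ∘ₗ (A.toFun - Complex.I • A.domain.subtype)

theorem mem_perturb_graph {A : H →ₗ.[ℂ] H} {F : H →L[ℂ] H} {x y : H} :
    (x, y) ∈ (perturb A F).graph ↔ ∃ u, (x, u) ∈ A.graph ∧ u + F (u - Complex.I • x) = y := by
  constructor
  · intro h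
    obtain ⟨a, rfl, hb⟩ := (LinearPMap.mem_graph_iff _).1 h
    exact ⟨A a, A.mem_graph a, hb⟩
  · rintro ⟨u, hu, rfl⟩
    obtain ⟨a, rfl, rfl⟩ := (LinearPMap.mem_graph_iff _).1 hu
    exact (perturb A F).mem_graph a

theorem add_eq_perturb {A B : H →ₗ.[ℂ] H} {F : H →L[ℂ] H} (hI : Complex.I ∈ resolventSet A)
    (hF : ∀ x, (resolv A Complex.I x, F x) ∈ B.graph) : A + B = perturb A F := by
  apply LinearPMap.eq_of_eq_graph
  ext ⟨x, y⟩
  rw [mem_graph_add, mem_perturb_graph]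
  have key : ∀ u, (x, u) ∈ A.graph → (x, F (u - Complex.I • x)) ∈ B.graph := fun u hu => by
    have := hF (u - Complex.I • x)
    rwa [resolv_sub hI hu] at this
  constructor
  · rintro ⟨u, v, hu, hv, rfl⟩
    exact ⟨u, hu, by rw [B.mem_graph_snd_inj (key u hu) hv rfl]⟩
  · rintro ⟨u, hu, rfl⟩
    exact ⟨u, _, hu, key u hu, rfl⟩

/-- The variable v = (A - i) x parametrizes the graph by bounded operators. -/
theorem mem_perturb_iff {A : H →ₗ.[ℂ] H} {F : H →L[ℂ] H} (hI : Complex.I ∈ resolventSet A)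
    {x y : H} : (x, y) ∈ (perturb A F).graph ↔
      ∃ v, resolv A Complex.I v = x ∧ v + Complex.I • resolv A Complex.I v + F v = y := by
  rw [mem_perturb_graph]
  constructor
  · rintro ⟨u, hu, rfl⟩
    refine ⟨u - Complex.I • x, resolv_sub hI hu, ?_⟩
    rw [resolv_sub hI hu, sub_add_cancel]
  · rintro ⟨v, rfl, rfl⟩
    exact ⟨_, resolv_mem_graph hI v, by rw [add_sub_cancel_right]⟩

theorem resolv_injective {A : H →ₗ.[ℂ] H} {z : ℂ} (hz : z ∈ resolventSet A) :
    Function.Injective (resolv A z) := by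
  refine (injective_iff_map_eq_zero _).2 fun x hx => ?_
  have := resolv_mem_graph hz x
  rw [hx, smul_zero, add_zero] at this
  exact A.graph_fst_eq_zero_snd this rfl

theorem isSymm_perturb_of_tendsto {A : H →ₗ.[ℂ] H} {l : Filter ℝ} [l.NeBot]
    {F : ℝ → H →L[ℂ] H} {F' : H →L[ℂ] H} (hF : Tendsto F l (𝓝 F'))
    (hs : ∀ t, IsSymm (perturb A (F t))) : IsSymm (perturb A F') := by
  intro x y x' y' h h'
  obtain ⟨u, hu, rfl⟩ := mem_perturb_graph.1 h
  obtain ⟨u', hu', rfl⟩ := mem_perturb_graph.1 h'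
  have h1 : ∀ v, Tendsto (fun t => F t v) l (𝓝 (F' v)) := fun v =>
    (continuous_eval_const v).continuousAt.tendsto.comp hF
  refine tendsto_nhds_unique (f := fun t => inner ℂ (u + F t (u - Complex.I • x)) x')
    (((h1 _).const_add _).inner tendsto_const_nhds) ?_
  have h2 : (fun t => inner ℂ (u + F t (u - Complex.I • x)) x') =
      fun t => inner ℂ x (u' + F t (u' - Complex.I • x')) := by
    funext t
    exact hs t _ _ _ _ (mem_perturb_graph.2 ⟨u, hu, rfl⟩) (mem_perturb_graph.2 ⟨u', hu', rfl⟩)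
  rw [h2]
  exact tendsto_const_nhds.inner ((h1 _).const_add _)

variable [CompleteSpace H]

/-- The bounded operators `Tₙ = (A - i) (A - zₙ)⁻¹` with `zₙ = ± i (n + 1)`. -/
theorem exists_relative_regularizer {A : H →ₗ.[ℂ] H} (hA : IsSelfAdjoint A) (z : ℕ → ℂ)
    (hz : ∀ n, |(z n).im| = n + 1) (hre : ∀ n, (z n).re = 0) :
    ∃ T : ℕ → H →L[ℂ] H, (∀ n, ‖T n‖ ≤ 3) ∧
      (∀ x, Tendsto (fun n => ContinuousLinearMap.adjoint (T n) x) atTop (𝓝 0)) ∧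
      ∀ n x y, (x, y) ∈ A.graph → T n (y - z n • x) = y - Complex.I • x := by
  have hpos : ∀ n : ℕ, (0 : ℝ) < n + 1 := fun n => by positivity
  have him : ∀ n, (z n).im ≠ 0 := fun n => abs_pos.1 (by rw [hz]; exact hpos n)
  have hres : ∀ n, z n ∈ resolventSet A := fun n => mem_resolventSet_of_im_ne_zero hA (him n)
  have him' : ∀ n, (starRingEnd ℂ (z n)).im ≠ 0 := fun n => by simpa using him n
  have hres' : ∀ n, starRingEnd ℂ (z n) ∈ resolventSet A := fun n =>
    mem_resolventSet_of_im_ne_zero hA (him' n)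
  have hnorm : ∀ n, ‖z n‖ = n + 1 := fun n => by
    rw [← hz, ← Complex.re_add_im (z n), hre]
    simp
  -- This is (A - i)(A - zₙ)⁻¹ written out; its norm is at most 1 + (n + 2) / (n + 1) ≤ 3.
  refine ⟨fun n => ContinuousLinearMap.id ℂ H + (z n - Complex.I) • resolv A (z n), ?_, ?_, ?_⟩
  · intro n
    refine ContinuousLinearMap.opNorm_le_bound _ (by norm_num) fun x => ?_
    have h1 := norm_resolv_le hA (him n) x
    rw [hz] at h1
    have h2 : ‖z n - Complex.I‖ ≤ n + 2 := by
      refine (norm_sub_le _ _).trans ?_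
      rw [hnorm, Complex.norm_I]; linarith
    change ‖x + (z n - Complex.I) • resolv A (z n) x‖ ≤ _
    refine (norm_add_le _ _).trans ?_
    rw [norm_smul]
    have h3 : ‖z n - Complex.I‖ * ‖resolv A (z n) x‖ ≤ (n + 2) * ‖resolv A (z n) x‖ := by gcongr
    have h4 : (0 : ℝ) ≤ n := Nat.cast_nonneg n
    nlinarith [norm_nonneg (resolv A (z n) x)]
  · have hadj : ∀ n, ContinuousLinearMap.adjoint
        (ContinuousLinearMap.id ℂ H + (z n - Complex.I) • resolv A (z n)) =
        ContinuousLinearMap.id ℂ H + (starRingEnd ℂ (z n) + Complex.I) •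
          resolv A (starRingEnd ℂ (z n)) := fun n => by
      rw [map_add, map_smulₛₗ, adjoint_resolv hA (him n), ContinuousLinearMap.adjoint_id, map_sub,
        Complex.conj_I, sub_neg_eq_add]
    simp only [hadj]
    intro x
    refine tendsto_of_dense_of_bounded (T' := 0) (C := 3) (fun n => ?_) hA.dense_domain
      (fun x hx => ?_) x
    · refine ContinuousLinearMap.opNorm_le_bound _ (by norm_num) fun x => ?_
      have h1 := norm_resolv_le hA (him' n) x
      rw [Complex.conj_im, abs_neg, hz] at h1
      have h2 : ‖starRingEnd ℂ (z n) + Complex.I‖ ≤ n + 2 := by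
        refine (norm_add_le _ _).trans ?_
        rw [RCLike.norm_conj, hnorm, Complex.norm_I]; linarith
      change ‖x + (starRingEnd ℂ (z n) + Complex.I) • resolv A (starRingEnd ℂ (z n)) x‖ ≤ _
      refine (norm_add_le _ _).trans ?_
      rw [norm_smul]
      have h3 : ‖starRingEnd ℂ (z n) + Complex.I‖ * ‖resolv A (starRingEnd ℂ (z n)) x‖ ≤
          (n + 2) * ‖resolv A (starRingEnd ℂ (z n)) x‖ := by gcongr
      have h4 : (0 : ℝ) ≤ n := Nat.cast_nonneg n
      nlinarith [norm_nonneg (resolv A (starRingEnd ℂ (z n)) x)]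
    · have hxy := mem_graph_val hx
      have hlim : Tendsto (fun n : ℕ => ‖val A x + Complex.I • x‖ / ((n : ℝ) + 1)) atTop
          (𝓝 0) := by
        have := (tendsto_one_div_add_atTop_nhds_zero_nat (𝕜 := ℝ)).const_mul
          ‖val A x + Complex.I • x‖
        simpa only [mul_one_div, mul_zero] using this
      rw [zero_apply, tendsto_zero_iff_norm_tendsto_zero]
      refine squeeze_zero (fun _ => norm_nonneg _) (fun n => ?_) hlim
      have h1 := resolv_sub (hres' n) hxy
      rw [map_sub, map_smul] at h1
      have hzz : starRingEnd ℂ (z n) = -z n := by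
        apply Complex.ext <;> simp [hre]
      -- On dom A the adjoint acts as (A - conj zₙ)⁻¹ (A + i), which is O(1 / (n + 1)).
      have h2 : (ContinuousLinearMap.id ℂ H + (starRingEnd ℂ (z n) + Complex.I) •
          resolv A (starRingEnd ℂ (z n))) x =
          resolv A (starRingEnd ℂ (z n)) (val A x + Complex.I • x) := by
        change x + (starRingEnd ℂ (z n) + Complex.I) • resolv A (starRingEnd ℂ (z n)) x = _
        rw [map_add, map_smul, sub_eq_iff_eq_add.1 h1, add_smul]
        abel
      rw [h2, le_div_iff₀ (hpos n), mul_comm]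
      have := norm_resolv_le hA (him' n) (val A x + Complex.I • x)
      rwa [Complex.conj_im, abs_neg, hz] at this
  · intro n x y hxy
    have h1 := resolv_sub (hres n) hxy
    change y - z n • x + (z n - Complex.I) • resolv A (z n) (y - z n • x) = _
    rw [h1, sub_smul]
    abel

/-- A symmetric, relatively compact perturbation of a self-adjoint operator is self-adjoint. -/
theorem isSelfAdjoint_perturb {A : H →ₗ.[ℂ] H} (hA : IsSelfAdjoint A) {F : H →L[ℂ] H}
    (hF : IsCompactOperator F) (hs : IsSymm (perturb A F)) : IsSelfAdjoint (perturb A F) := by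
  have key : ∀ z : ℕ → ℂ, (∀ n, |(z n).im| = n + 1) → (∀ n, (z n).re = 0) →
      ∀ᶠ n in atTop, ∀ w, ∃ x y, (x, y) ∈ (perturb A F).graph ∧ y - z n • x = w := by
    intro z hz hre
    obtain ⟨T, hT, hlim, hTA⟩ := exists_relative_regularizer hA z hz hre
    have h1 := tendsto_isCompactOperator_comp hT hlim hF
    filter_upwards [h1.eventually_lt_const one_pos] with n hn w
    have hz' : z n ∈ resolventSet A := mem_resolventSet_of_im_ne_zero hA
      (abs_pos.1 (by rw [hz]; positivity))
    -- Composed with (A - zₙ)⁻¹, the perturbed operator minus zₙ is 1 + F Tₙ, and ‖F Tₙ‖ → 0 because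
    -- F is compact.
    obtain ⟨U, hU⟩ := isUnit_one_sub_of_norm_lt_one (x := -(F ∘L T n)) (by rwa [norm_neg])
    rw [sub_neg_eq_add] at hU
    set u := (↑U⁻¹ : H →L[ℂ] H) w with hu
    have huw : u + F (T n u) = w := by
      have : (U : H →L[ℂ] H) ((↑U⁻¹ : H →L[ℂ] H) w) = w :=
        DFunLike.congr_fun U.mul_inv w
      rw [hU] at this
      exact this
    have h2 := resolv_mem_graph hz' u
    have h3 := hTA n _ _ h2
    rw [add_sub_cancel_right] at h3
    refine ⟨resolv A (z n) u, _, mem_perturb_graph.2 ⟨_, h2, rfl⟩, ?_⟩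
    rw [← h3, ← huw]
    abel
  -- Surjectivity is needed at a point and at its conjugate, hence for both signs at a common n.
  obtain ⟨n, h1, h2⟩ := ((key (fun n => ((n + 1 : ℝ) : ℂ) * Complex.I) (fun n => by
      simp [abs_of_pos (show (0 : ℝ) < n + 1 by positivity)]) (fun n => by simp)).and
    (key (fun n => -(((n + 1 : ℝ) : ℂ) * Complex.I)) (fun n => by
      simp only [Complex.neg_im, abs_neg]
      simp [abs_of_pos (show (0 : ℝ) < n + 1 by positivity)]) (fun n => by simp))).exists
  refine hs.isSelfAdjoint hA.dense_domain _ h1 ?_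
  have : starRingEnd ℂ (((n + 1 : ℝ) : ℂ) * Complex.I) = -(((n + 1 : ℝ) : ℂ) * Complex.I) := by
    rw [map_mul, Complex.conj_ofReal, Complex.conj_I, mul_neg]
  rw [this]
  exact h2

/-- S = (A - i)(A_F - z)⁻¹, where A_F is the perturbed operator. It is bounded by the closed graph
theorem, since the resolvent of A_F has its range in dom A. -/
theorem exists_resolv_perturb_eq {A : H →ₗ.[ℂ] H} (hI : Complex.I ∈ resolventSet A)
    {F : H →L[ℂ] H} {z : ℂ} (hz : z ∈ resolventSet (perturb A F)) :
    ∃ S : H →L[ℂ] H, (∀ x, resolv A Complex.I (S x) = resolv (perturb A F) z x) ∧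
      ∀ x, S x + Complex.I • resolv A Complex.I (S x) + F (S x) -
        z • resolv A Complex.I (S x) = x := by
  have h0 : ∀ x, ∃ v, resolv A Complex.I v = resolv (perturb A F) z x ∧
      v + Complex.I • resolv A Complex.I v + F v = x + z • resolv (perturb A F) z x := fun x =>
    (mem_perturb_iff hI).1 (resolv_mem_graph hz x)
  obtain ⟨S, hS⟩ := exists_eq_comp_of_range_le (resolv (perturb A F) z) (resolv A Complex.I)
    (resolv_injective hI) fun x => (h0 x).imp fun v hv => hv.1
  refine ⟨S, hS, fun x => ?_⟩
  obtain ⟨v, hv1, hv2⟩ := h0 x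
  have : v = S x := resolv_injective hI (hv1.trans (hS x).symm)
  rw [← this, hv2, hv1, add_sub_cancel_right]

/-- Second resolvent identity: the difference of resolvents is -(A_F(t) - z)⁻¹ (F(t) - F') S, with S
= (A - i)(A_F' - z)⁻¹ bounded and the left factor bounded by 1 / |Im z|. -/
theorem normResolventTendsto_perturb {A : H →ₗ.[ℂ] H} (hI : Complex.I ∈ resolventSet A)
    {l : Filter ℝ} {F : ℝ → H →L[ℂ] H} {F' : H →L[ℂ] H} (hF : Tendsto F l (𝓝 F'))
    (hs : ∀ t, IsSelfAdjoint (perturb A (F t))) (hs' : IsSelfAdjoint (perturb A F')) :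
    NormResolventTendsto (fun t => perturb A (F t)) l (perturb A F') := by
  intro z hz
  have h1 : ∀ t, z ∈ resolventSet (perturb A (F t)) := fun t =>
    mem_resolventSet_of_im_ne_zero (hs t) hz
  have h2 : z ∈ resolventSet (perturb A F') := mem_resolventSet_of_im_ne_zero hs' hz
  refine ⟨h1, h2, ?_⟩
  obtain ⟨S, hS, hS'⟩ := exists_resolv_perturb_eq hI h2
  rw [tendsto_iff_norm_sub_tendsto_zero]
  have h3 : Tendsto (fun t => |z.im|⁻¹ * ‖F t - F'‖ * ‖S‖) l (𝓝 0) := by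
    simpa using ((tendsto_iff_norm_sub_tendsto_zero.1 hF).const_mul |z.im|⁻¹).mul_const ‖S‖
  refine squeeze_zero (fun _ => norm_nonneg _) (fun t => ?_) h3
  refine ContinuousLinearMap.opNorm_le_bound _ (by positivity) fun y => ?_
  have h4 : resolv (perturb A (F t)) z y - resolv (perturb A F') z y =
      -resolv (perturb A (F t)) z ((F t - F') (S y)) := by
    have h5 : (resolv A Complex.I (S y), S y + Complex.I • resolv A Complex.I (S y) + F t (S y)) ∈
        (perturb A (F t)).graph := (mem_perturb_iff hI).2 ⟨S y, rfl, rfl⟩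
    have h6 := resolv_sub (h1 t) h5
    have h6' : y + (F t - F') (S y) = S y + Complex.I • resolv A Complex.I (S y) + F t (S y) -
        z • resolv A Complex.I (S y) := by
      nth_rw 1 [← hS' y]
      rw [sub_apply]
      abel
    rw [← h6', map_add] at h6
    rw [← hS y, ← h6]
    abel
  rw [sub_apply, h4, norm_neg]
  have h7 := norm_resolv_le (hs t) hz ((F t - F') (S y))
  have h8 : ‖(F t - F') (S y)‖ ≤ ‖F t - F'‖ * (‖S‖ * ‖y‖) :=
    ((F t - F').le_opNorm _).trans (by gcongr; exact S.le_opNorm y)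
  have h9 : 0 < |z.im| := abs_pos.2 hz
  rw [mul_assoc, mul_assoc, ← div_eq_inv_mul, le_div_iff₀ h9, mul_comm]
  exact h7.trans h8

end Perturbation

end ModelOperator

end

noncomputable section
namespace ModelOperator

/-! ### The operator d/dt in L²(ℝ; H). -/

section Sobolev

variable {H : Type*} [NormedAddCommGroup H] [InnerProductSpace ℂ H]

theorem absolutelyContinuousOnInterval_inner {u v : ℝ → H} {a b : ℝ}
    (hu : AbsolutelyContinuousOnInterval u a b) (hv : AbsolutelyContinuousOnInterval v a b) :
    AbsolutelyContinuousOnInterval (fun t => inner ℂ (u t) (v t)) a b := by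
  obtain ⟨C, hC⟩ := hu.exists_bound
  obtain ⟨D, hD⟩ := hv.exists_bound
  refine squeeze_zero' (Eventually.of_forall fun E => Finset.sum_nonneg fun _ _ => dist_nonneg) ?_
    (by simpa using (Tendsto.const_mul C hv).add (Tendsto.const_mul D hu))
  refine eventually_inf_principal.2 (Eventually.of_forall fun E hE => ?_)
  rw [Finset.mul_sum, Finset.mul_sum, ← Finset.sum_add_distrib]
  refine Finset.sum_le_sum fun i hi => ?_
  obtain ⟨h1, h2⟩ := hE.1 i hi
  rw [dist_eq_norm, dist_eq_norm, dist_eq_norm]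
  have : inner ℂ (u (E.2 i).1) (v (E.2 i).1) - inner ℂ (u (E.2 i).2) (v (E.2 i).2) =
      inner ℂ (u (E.2 i).1) (v (E.2 i).1 - v (E.2 i).2) +
        inner ℂ (u (E.2 i).1 - u (E.2 i).2) (v (E.2 i).2) := by
    rw [inner_sub_right, inner_sub_left]; ring
  rw [this]
  refine (norm_add_le _ _).trans (add_le_add ?_ ?_)
  · exact (norm_inner_le_norm _ _).trans (by gcongr; exact hC _ h1)
  · rw [mul_comm D]
    exact (norm_inner_le_norm _ _).trans (by gcongr; exact hD _ h2)

theorem L2.locallyIntegrable {E : Type*} [NormedAddCommGroup E] (h : L2 E) : LocallyIntegrable h volume :=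
  (Lp.memLp h).locallyIntegrable (by norm_num)

theorem HasL2Deriv.add {f h g k : L2 H} (hf : HasL2Deriv f h) (hg : HasL2Deriv g k) :
    HasL2Deriv (f + g) (h + k) := ddtGraph.add_mem (x := (f, h)) (y := (g, k)) hf hg

theorem HasL2Deriv.smul (c : ℂ) {f h : L2 H} (hf : HasL2Deriv f h) :
    HasL2Deriv (c • f) (c • h) := ddtGraph.smul_mem (x := (f, h)) c hf

variable [CompleteSpace H]

theorem hasL2Deriv_iff {f h : L2 H} : HasL2Deriv f h ↔ ∃ u : ℝ → H, u =ᵐ[volume] f ∧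
    (∀ a b, AbsolutelyContinuousOnInterval u a b) ∧ ∀ᵐ t, HasDerivAt u (h t) t := by
  constructor
  · rintro ⟨u, hu, hu'⟩
    have h0 : u = fun t => u 0 + ∫ s in (0 : ℝ)..t, h s := funext fun t => hu' 0 t
    refine ⟨u, hu, fun a b => ?_, ?_⟩
    · rw [h0]
      have := absolutelyContinuousOnInterval_integral (L2.intervalIntegrable h) a b 0
      refine Tendsto.congr (fun E => Finset.sum_congr rfl fun i _ => ?_) this
      rw [dist_add_left]
    · filter_upwards [LocallyIntegrable.ae_hasDerivAt_integral (L2.locallyIntegrable h)] with t ht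
      rw [h0]
      exact (ht 0).const_add _
  · rintro ⟨u, hu, hac, hd⟩
    refine ⟨u, hu, fun a b => ?_⟩
    rw [integral_eq_sub_of_absolutelyContinuous (hac a b) hd (L2.locallyIntegrable h)]
    abel

/-- The derivative is skew-symmetric. -/
theorem HasL2Deriv.inner_add_inner {f h g k : L2 H} (hf : HasL2Deriv f h) (hg : HasL2Deriv g k) :
    inner ℂ h g + inner ℂ f k = 0 := by
  obtain ⟨u, hu, huac, hud⟩ := hasL2Deriv_iff.1 hf
  obtain ⟨v, hv, hvac, hvd⟩ := hasL2Deriv_iff.1 hg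
  set F' : ℝ → ℂ := fun t => inner ℂ (h t) (g t) + inner ℂ (f t) (k t) with hF'
  have hF'i : Integrable F' := (L2.integrable_inner h g).add (L2.integrable_inner f k)
  have hFi : Integrable fun t => inner ℂ (u t) (v t) := by
    refine (L2.integrable_inner (𝕜 := ℂ) f g).congr ?_
    filter_upwards [hu, hv] with t h1 h2
    rw [h1, h2]
  have hd : ∀ᵐ t, HasDerivAt (fun t => inner ℂ (u t) (v t)) (F' t) t := by
    filter_upwards [hu, hv, hud, hvd] with t h1 h2 h3 h4
    have := h3.inner ℂ h4
    rw [h1, h2, add_comm] at this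
    exact this
  have hftc : ∀ a b, ∫ t in a..b, F' t = inner ℂ (u b) (v b) - inner ℂ (u a) (v a) := fun a b =>
    integral_eq_sub_of_absolutelyContinuous
      (absolutelyContinuousOnInterval_inner (huac a b) (hvac a b)) hd hF'i.locallyIntegrable
  -- ⟨u, v⟩ has a limit at each end because its derivative is integrable, and the limit is zero
  -- because ⟨u, v⟩ itself is integrable.
  have htop : Tendsto (fun t => inner ℂ (u t) (v t)) atTop (𝓝 (0 : ℂ)) := by
    have h1 : Tendsto (fun t => inner ℂ (u t) (v t)) atTop
        (𝓝 (inner ℂ (u 0) (v 0) + ∫ t in Set.Ioi 0, F' t)) := by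
      have := (intervalIntegral_tendsto_integral_Ioi 0 hF'i.integrableOn tendsto_id).const_add
        (inner ℂ (u 0) (v 0))
      refine this.congr fun t => ?_
      rw [id, hftc 0 t]; ring
    have h2 := (hFi.integrableAtFilter atTop).eq_zero_of_tendsto (fun s hs => by
      obtain ⟨a, ha⟩ := mem_atTop_sets.1 hs
      exact top_le_iff.1 ((Real.volume_Ici (a := a)).ge.trans (measure_mono ha))) h1
    rwa [h2] at h1
  have hbot : Tendsto (fun t => inner ℂ (u t) (v t)) atBot (𝓝 (0 : ℂ)) := by
    have h1 : Tendsto (fun t => inner ℂ (u t) (v t)) atBot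
        (𝓝 (inner ℂ (u 0) (v 0) - ∫ t in Set.Iic 0, F' t)) := by
      have := (intervalIntegral_tendsto_integral_Iic 0 hF'i.integrableOn tendsto_id).const_sub
        (inner ℂ (u 0) (v 0))
      refine this.congr fun t => ?_
      rw [id, hftc t 0]; ring
    have h2 := (hFi.integrableAtFilter atBot).eq_zero_of_tendsto (fun s hs => by
      obtain ⟨a, ha⟩ := mem_atBot_sets.1 hs
      exact top_le_iff.1 ((Real.volume_Iic (a := a)).ge.trans (measure_mono ha))) h1
    rwa [h2] at h1
  rw [L2.inner_def, L2.inner_def, ← integral_add (L2.integrable_inner h g)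
    (L2.integrable_inner f k)]
  have h1 := intervalIntegral_tendsto_integral hF'i tendsto_neg_atTop_atBot tendsto_id
  have h2 : Tendsto (fun t : ℝ => ∫ s in (-t)..(id t), F' s) atTop (𝓝 0) := by
    have := htop.sub (hbot.comp tendsto_neg_atTop_atBot)
    rw [sub_zero] at this
    exact this.congr fun t => (hftc _ _).symm
  exact tendsto_nhds_unique h1 h2

theorem HasL2Deriv.compLpL (T : H →L[ℂ] H) {f h : L2 H} (hf : HasL2Deriv f h) :
    HasL2Deriv (T.compLpL 2 volume f) (T.compLpL 2 volume h) := by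
  obtain ⟨u, hu, hu'⟩ := hf
  refine ⟨fun t => T (u t), ?_, fun t₀ t => ?_⟩
  · filter_upwards [hu, T.coeFn_compLpL f] with t h1 h2
    rw [h1, h2]
  · have : ∫ s in t₀..t, (T.compLpL 2 volume h) s = ∫ s in t₀..t, T (h s) :=
      intervalIntegral.integral_congr_ae ((T.coeFn_compLpL h).mono fun s hs _ => hs)
    rw [this, T.intervalIntegral_comp_comm (L2.intervalIntegrable h _ _), ← map_add]
    exact congrArg T (hu' t₀ t)

theorem ContDiff.absolutelyContinuousOnInterval {E : Type*} [NormedAddCommGroup E]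
    [NormedSpace ℝ E] {φ : ℝ → E} (hφ : ContDiff ℝ 1 φ) (a b : ℝ) :
    AbsolutelyContinuousOnInterval φ a b :=
  hφ.contDiffOn.absolutelyContinuousOnInterval

theorem HasL2Deriv.contDiff_smul {φ : ℝ → ℂ} (hφ : ContDiff ℝ 1 φ) {f h f₂ h₂ : L2 H}
    (hf : HasL2Deriv f h) (hf₂ : f₂ =ᵐ[volume] fun t => φ t • f t)
    (hh₂ : h₂ =ᵐ[volume] fun t => deriv φ t • f t + φ t • h t) : HasL2Deriv f₂ h₂ := by
  obtain ⟨u, hu, huac, hud⟩ := hasL2Deriv_iff.1 hf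
  refine hasL2Deriv_iff.2 ⟨fun t => φ t • u t, ?_, fun a b => ?_, ?_⟩
  · filter_upwards [hu, hf₂] with t h1 h2
    rw [h1, h2]
  · exact (ContDiff.absolutelyContinuousOnInterval hφ a b).fun_smul (huac a b)
  · filter_upwards [hu, hud, hh₂] with t h1 h2 h3
    rw [h3, ← h1, add_comm]
    exact ((hφ.differentiable one_ne_zero).differentiableAt.hasDerivAt (x := t)).smul h2

/-- Elementary tensors `φ ⊗ x` with `φ` compactly supported belong to the domain of `d/dt`. -/
theorem exists_hasL2Deriv_smul {φ : ℝ → ℂ} (hφ : ContDiff ℝ 1 φ) (hc : HasCompactSupport φ)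
    (x : H) : ∃ f h : L2 H, f =ᵐ[volume] (fun t => φ t • x) ∧
      h =ᵐ[volume] (fun t => deriv φ t • x) ∧ HasL2Deriv f h := by
  have h1 : MemLp (fun t => φ t • x) 2 volume :=
    (hφ.continuous.smul continuous_const).memLp_of_hasCompactSupport hc.smul_right
  have h2 : MemLp (fun t => deriv φ t • x) 2 volume :=
    ((hφ.continuous_deriv le_rfl).smul continuous_const).memLp_of_hasCompactSupport
      hc.deriv.smul_right
  refine ⟨h1.toLp, h2.toLp, h1.coeFn_toLp, h2.coeFn_toLp, hasL2Deriv_iff.2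
    ⟨fun t => φ t • x, h1.coeFn_toLp.symm, fun a b => ?_, ?_⟩⟩
  · exact ContDiff.absolutelyContinuousOnInterval (hφ.smul contDiff_const) a b
  · filter_upwards [h2.coeFn_toLp] with t ht
    rw [ht]
    exact ((hφ.differentiable one_ne_zero).differentiableAt.hasDerivAt (x := t)).smul_const x

/-- A locally integrable function is constant if its weak derivative vanishes. -/
theorem exists_ae_eq_const_of_integral_deriv_smul {w : ℝ → H} (hw : LocallyIntegrable w)
    (h : ∀ φ : ℝ → ℝ, ContDiff ℝ (⊤ : ℕ∞) φ → HasCompactSupport φ → ∫ t, deriv φ t • w t = 0) :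
    ∃ c, w =ᵐ[volume] fun _ => c := by
  let ρ : ContDiffBump (0 : ℝ) := ⟨1, 2, one_pos, one_lt_two⟩
  set r : ℝ → ℝ := ρ.normed volume with hr
  have hr1 : ∫ t, r t = 1 := ρ.integral_normed
  have hrs : ContDiff ℝ (⊤ : ℕ∞) r := ρ.contDiff_normed
  have hrc : HasCompactSupport r := ρ.hasCompactSupport_normed
  refine ⟨∫ t, r t • w t, ae_eq_of_integral_contDiff_smul_eq hw
    (continuous_const.locallyIntegrable) fun ψ hψ hψc => ?_⟩
  -- Subtracting a multiple of the normalized bump r makes the test function have mean zero, so that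
  -- it is the derivative of a test function.
  set θ : ℝ → ℝ := fun t => ψ t - (∫ s, ψ s) * r t with hθ
  have hθs : ContDiff ℝ (⊤ : ℕ∞) θ := hψ.sub (contDiff_const.mul hrs)
  have hθc : HasCompactSupport θ := by
    refine HasCompactSupport.intro (hψc.isCompact.union hrc.isCompact) fun t ht => ?_
    rw [Set.mem_union, not_or] at ht
    simp [hθ, image_eq_zero_of_notMem_tsupport ht.1, image_eq_zero_of_notMem_tsupport ht.2]
  have hθi : Integrable θ := hθs.continuous.integrable_of_hasCompactSupport hθc
  have hθ0 : ∫ t, θ t = 0 := by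
    rw [hθ, integral_sub (hψ.continuous.integrable_of_hasCompactSupport hψc)
      ((hrs.continuous.integrable_of_hasCompactSupport hrc).const_mul _), integral_const_mul, hr1,
      mul_one, sub_self]
  obtain ⟨M, hM⟩ := hθc.isCompact.isBounded.subset_closedBall 0
  have hθz : ∀ t, M < |t| → θ t = 0 := fun t ht => image_eq_zero_of_notMem_tsupport fun hmem => by
    have := hM hmem
    rw [mem_closedBall_zero_iff, Real.norm_eq_abs] at this
    linarith
  set φ : ℝ → ℝ := fun t => ∫ s in Set.Iic t, θ s with hφ
  have hφd : ∀ t, HasDerivAt φ (θ t) t := by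
    intro t
    have h1 : φ = fun t => (∫ s in Set.Iic 0, θ s) + ∫ s in (0 : ℝ)..t, θ s := by
      funext t
      rw [← intervalIntegral.integral_Iic_sub_Iic hθi.integrableOn hθi.integrableOn]
      simp [hφ]
    rw [h1]
    exact (intervalIntegral.integral_hasDerivAt_right (hθi.intervalIntegrable)
      (hθs.continuous.stronglyMeasurableAtFilter _ _) hθs.continuous.continuousAt).const_add _
  have hφderiv : deriv φ = θ := funext fun t => (hφd t).deriv
  have hφs : ContDiff ℝ (⊤ : ℕ∞) φ :=
    contDiff_infty_iff_deriv.2 ⟨fun t => (hφd t).differentiableAt, hφderiv ▸ hθs⟩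
  have hφc : HasCompactSupport φ := by
    refine HasCompactSupport.intro (isCompact_closedBall (0 : ℝ) |M|) fun t ht => ?_
    rw [mem_closedBall_zero_iff, Real.norm_eq_abs, not_le] at ht
    rcases le_total 0 t with h0 | h0
    · rw [abs_of_nonneg h0] at ht
      have h2 : φ t = ∫ s, θ s := by
        refine setIntegral_eq_integral_of_forall_compl_eq_zero fun s hs => hθz s ?_
        rw [Set.mem_Iic, not_le] at hs
        exact (le_abs_self M).trans_lt (ht.trans (hs.trans_le (le_abs_self s)))
      rw [h2, hθ0]
    · rw [abs_of_nonpos h0] at ht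
      refine setIntegral_eq_zero_of_forall_eq_zero fun s hs => hθz s ?_
      rw [Set.mem_Iic] at hs
      exact (le_abs_self M).trans_lt (ht.trans_le ((neg_le_neg hs).trans (neg_le_abs s)))
  have h1 := h φ hφs hφc
  have hint : ∀ ξ : ℝ → ℝ, ContDiff ℝ (⊤ : ℕ∞) ξ → HasCompactSupport ξ →
      Integrable fun t => ξ t • w t := fun ξ hξ hξc =>
    hw.integrable_smul_left_of_hasCompactSupport hξ.continuous hξc
  rw [hφderiv] at h1
  simp only [hθ, sub_smul, mul_smul] at h1
  rw [integral_sub (hint ψ hψ hψc) ((hint r hrs hrc).fun_smul _), integral_smul, sub_eq_zero] at h1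
  rw [h1, integral_smul_const]

/-- Weak derivatives in `L²` are derivatives. -/
theorem hasL2Deriv_of_integral {f h : L2 H} (hfh : ∀ φ : ℝ → ℝ, ContDiff ℝ (⊤ : ℕ∞) φ →
    HasCompactSupport φ → ∫ t, (deriv φ t • f t + φ t • h t) = 0) : HasL2Deriv f h := by
  set v : ℝ → H := fun t => ∫ s in (0 : ℝ)..t, h s with hv
  have hvc : Continuous v := intervalIntegral.continuous_primitive (L2.intervalIntegrable h) 0
  have hvd : ∀ᵐ t, HasDerivAt v (h t) t :=
    (LocallyIntegrable.ae_hasDerivAt_integral (L2.locallyIntegrable h)).mono fun t ht => ht 0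
  have hvac : ∀ a b, AbsolutelyContinuousOnInterval v a b := fun a b =>
    absolutelyContinuousOnInterval_integral (L2.intervalIntegrable h) a b 0
  -- f minus the primitive v of h has zero weak derivative, hence is constant.
  obtain ⟨c, hc⟩ := exists_ae_eq_const_of_integral_deriv_smul (w := fun t => f t - v t)
    ((L2.locallyIntegrable f).sub hvc.locallyIntegrable) fun φ hφ hφc => by
      have hφ1 : ContDiff ℝ 1 φ := hφ.of_le (by exact_mod_cast le_top)
      have hdc : Continuous (deriv φ) := hφ1.continuous_deriv le_rfl
      have i1 : Integrable fun t => deriv φ t • f t :=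
        (L2.locallyIntegrable f).integrable_smul_left_of_hasCompactSupport hdc hφc.deriv
      have i2 : Integrable fun t => φ t • h t :=
        (L2.locallyIntegrable h).integrable_smul_left_of_hasCompactSupport hφ.continuous hφc
      have i3 : Integrable fun t => deriv φ t • v t :=
        hvc.locallyIntegrable.integrable_smul_left_of_hasCompactSupport hdc hφc.deriv
      have h1 : ∫ t, (deriv φ t • v t + φ t • h t) = 0 := by
        obtain ⟨M, hM⟩ := hφc.isCompact.isBounded.subset_closedBall 0
        have hz : ∀ t, M < |t| → φ t = 0 := fun t ht => image_eq_zero_of_notMem_tsupport fun hm => by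
          have := hM hm
          rw [mem_closedBall_zero_iff, Real.norm_eq_abs] at this
          linarith
        have h2 := intervalIntegral_tendsto_integral (i3.add i2) tendsto_neg_atTop_atBot tendsto_id
        refine tendsto_nhds_unique h2 (tendsto_const_nhds.congr' ?_)
        filter_upwards [eventually_gt_atTop |M|] with t ht
        have ht0 : M < |t| := (le_abs_self M).trans_lt (ht.trans_le (le_abs_self t))
        have h3 := integral_eq_sub_of_absolutelyContinuous (a := -t) (b := t)
          (f := fun t => φ t • v t) (f' := fun t => deriv φ t • v t + φ t • h t)
          ((ContDiff.absolutelyContinuousOnInterval hφ1 _ _).fun_smul (hvac _ _))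
          (by
            filter_upwards [hvd] with s hs
            rw [add_comm]
            exact ((hφ1.differentiable one_ne_zero).differentiableAt.hasDerivAt (x := s)).smul hs)
          (i3.add i2).locallyIntegrable
        rw [hz t ht0, hz (-t) (by rwa [abs_neg]), zero_smul, zero_smul, sub_zero] at h3
        exact h3.symm
      have h2 := hfh φ hφ hφc
      rw [integral_add i3 i2] at h1
      rw [integral_add i1 i2, ← h1] at h2
      simp only [smul_sub]
      rw [integral_sub i1 i3, sub_eq_zero]
      exact add_right_cancel h2
  refine hasL2Deriv_iff.2 ⟨fun t => c + v t, ?_, fun a b => ?_, ?_⟩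
  · filter_upwards [hc] with t ht
    rw [← ht]; abel
  · refine Tendsto.congr (fun E => Finset.sum_congr rfl fun i _ => ?_) (hvac a b)
    rw [dist_add_left]
  · exact hvd.mono fun t ht => ht.const_add c

end Sobolev

end ModelOperator
end

noncomputable section
namespace ModelOperator

/-! ### Constant fibers: bounded operators acting pointwise. -/

section Lift

variable {H : Type*} [NormedAddCommGroup H] [InnerProductSpace ℂ H]

theorem L2.integrable_norm_sq {E : Type*} [NormedAddCommGroup E] (f : L2 E) :
    Integrable fun t => ‖f t‖ ^ 2 :=
  (Lp.memLp f).integrable_norm_pow two_ne_zero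

theorem L2.norm_sq_eq (f : L2 H) : ‖f‖ ^ 2 = ∫ t, ‖f t‖ ^ 2 := by
  have h1 : inner ℂ f f = ((∫ t, ‖f t‖ ^ 2 : ℝ) : ℂ) := by
    rw [L2.inner_def, ← integral_complex_ofReal]
    refine integral_congr_ae (Eventually.of_forall fun t => ?_)
    simp only [inner_self_eq_norm_sq_to_K, Complex.coe_algebraMap]
    norm_cast
  rw [inner_self_eq_norm_sq_to_K] at h1
  simp only [Complex.coe_algebraMap] at h1
  exact_mod_cast h1

/-- The operator acting on `L²(ℝ; H)` fiberwise by a fixed bounded operator. -/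
abbrev lift (T : H →L[ℂ] H) : L2 H →L[ℂ] L2 H := T.compLpL 2 volume

theorem lift_lift (S T : H →L[ℂ] H) (f : L2 H) : lift S (lift T f) = lift (S ∘L T) f := by
  refine Lp.ext ?_
  filter_upwards [S.coeFn_compLpL (lift T f), T.coeFn_compLpL f, (S ∘L T).coeFn_compLpL f]
    with t h1 h2 h3
  rw [h1, h2, h3]
  rfl

theorem hasL2Deriv_lift [CompleteSpace H] (T : H →L[ℂ] H) {f h : L2 H} (hf : HasL2Deriv f h) :
    HasL2Deriv (lift T f) (lift T h) := HasL2Deriv.compLpL T hf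

theorem inner_lift_left [CompleteSpace H] (T : H →L[ℂ] H) (f g : L2 H) :
    inner ℂ (lift T f) g = inner ℂ f (lift (ContinuousLinearMap.adjoint T) g) := by
  rw [L2.inner_def, L2.inner_def]
  refine integral_congr_ae ?_
  filter_upwards [T.coeFn_compLpL f, (ContinuousLinearMap.adjoint T).coeFn_compLpL g] with t h1 h2
  rw [h1, h2, ContinuousLinearMap.adjoint_inner_right]

/-- Bounded pointwise convergence of operators lifts to `L²(ℝ; H)`. -/
theorem tendsto_lift {T : ℕ → H →L[ℂ] H} {S : H →L[ℂ] H} {C : ℝ} (hT : ∀ n, ‖T n‖ ≤ C)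
    (hlim : ∀ x, Tendsto (fun n => T n x) atTop (𝓝 (S x))) (f : L2 H) :
    Tendsto (fun n => lift (T n) f) atTop (𝓝 (lift S f)) := by
  rw [tendsto_iff_norm_sub_tendsto_zero]
  have hC : 0 ≤ C := (norm_nonneg _).trans (hT 0)
  have hST : ∀ n, (fun t => (lift (T n) f - lift S f : L2 H) t) =ᵐ[volume]
      fun t => T n (f t) - S (f t) := fun n => by
    filter_upwards [Lp.coeFn_sub (lift (T n) f) (lift S f), (T n).coeFn_compLpL f,
      S.coeFn_compLpL f] with t h1 h2 h3
    rw [h1, Pi.sub_apply, h2, h3]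
  have h1 : Tendsto (fun n => ∫ t, ‖(lift (T n) f - lift S f : L2 H) t‖ ^ 2) atTop
      (𝓝 (∫ _ : ℝ, (0 : ℝ))) := by
    refine tendsto_integral_of_dominated_convergence (fun t => ((C + ‖S‖) * ‖f t‖) ^ 2)
      (fun n => (L2.integrable_norm_sq _).aestronglyMeasurable) ?_ (fun n => ?_) ?_
    · simp only [mul_pow]
      exact (L2.integrable_norm_sq f).const_mul _
    · filter_upwards [hST n] with t ht
      rw [ht, norm_pow, norm_norm]
      refine pow_le_pow_left₀ (norm_nonneg _) ((norm_sub_le _ _).trans ?_) 2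
      rw [add_mul]
      exact add_le_add (((T n).le_opNorm _).trans (by gcongr; exact hT n)) (S.le_opNorm _)
    · filter_upwards [ae_all_iff.2 hST] with t ht
      simp only [ht]
      have := ((hlim (f t)).sub_const (S (f t))).norm.pow 2
      simpa using this
  simp only [integral_zero, ← L2.norm_sq_eq] at h1
  have := h1.sqrt
  simpa using this

end Lift

/-! ### Skewness and invertibility of d/dt + A with constant fiber A. -/

section Invert

variable {H : Type*} [NormedAddCommGroup H] [InnerProductSpace ℂ H] [CompleteSpace H]

/-- The operator `d/dt` is the negative of its adjoint. -/
theorem hasL2Deriv_of_inner {f h : L2 H}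
    (hfh : ∀ p q, HasL2Deriv p q → inner ℂ q f + inner ℂ p h = 0) : HasL2Deriv f h := by
  refine hasL2Deriv_of_integral fun φ hφ hφc => ext_inner_left ℂ fun x => ?_
  have hφ1 : ContDiff ℝ 1 φ := hφ.of_le (by exact_mod_cast le_top)
  have i1 : Integrable fun t => deriv φ t • f t :=
    (L2.locallyIntegrable f).integrable_smul_left_of_hasCompactSupport
      (hφ1.continuous_deriv le_rfl) hφc.deriv
  have i2 : Integrable fun t => φ t • h t :=
    (L2.locallyIntegrable h).integrable_smul_left_of_hasCompactSupport hφ.continuous hφc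
  have hd : ∀ t, deriv (fun t => (φ t : ℂ)) t = ((deriv φ t : ℝ) : ℂ) := fun t =>
    ((hφ1.differentiable one_ne_zero).differentiableAt.hasDerivAt (x := t)).ofReal_comp.deriv
  -- Elementary tensors φ ⊗ x already detect the weak derivative, one direction x at a time.
  obtain ⟨p, q, hp, hq, hpq⟩ := exists_hasL2Deriv_smul (φ := fun t => (φ t : ℂ))
    (Complex.ofRealCLM.contDiff.comp hφ1) (hφc.comp_left (g := Complex.ofReal) rfl) x
  rw [inner_zero_right, ← integral_inner (i1.fun_add i2), ← hfh p q hpq, L2.inner_def, L2.inner_def,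
    ← integral_add (L2.integrable_inner q f) (L2.integrable_inner p h)]
  refine integral_congr_ae ?_
  filter_upwards [hp, hq] with t h1 h2
  rw [h1, h2, hd, inner_add_right, inner_smul_left, inner_smul_left, Complex.conj_ofReal,
    Complex.conj_ofReal, inner_smul_right_eq_smul, inner_smul_right_eq_smul]
  rfl

/-- Being minus its own adjoint, d/dt has a graph cut out by closed linear conditions. -/
theorem isClosed_hasL2Deriv : IsClosed {p : L2 H × L2 H | HasL2Deriv p.1 p.2} := by
  have : {p : L2 H × L2 H | HasL2Deriv p.1 p.2} =
      ⋂ (p : L2 H × L2 H) (_ : HasL2Deriv p.1 p.2),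
        {r | inner ℂ p.2 r.1 + inner ℂ p.1 r.2 = 0} := by
    ext r
    simp only [Set.mem_iInter, Set.mem_ofPred_eq]
    exact ⟨fun hr p hp => hp.inner_add_inner hr,
      fun h => hasL2Deriv_of_inner fun p q hpq => h (p, q) hpq⟩
  rw [this]
  refine isClosed_biInter fun p _ => isClosed_eq (by fun_prop) continuous_const

/-- For constant fibers, `d/dt` and `A` are skew to one another. -/
theorem re_inner_eq_zero_of_hasL2Deriv {A : H →ₗ.[ℂ] H} (hA : IsSelfAdjoint A)
    {J C : H →L[ℂ] H} (hJC : ∀ x, (J x, C x) ∈ A.graph) {g h : L2 H}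
    (hh : HasL2Deriv (lift J g) h) : (inner ℂ h (lift C g)).re = 0 := by
  obtain ⟨E, G, hE1, hE, hE', -, hEG⟩ := exists_regularizer hA
  have h1 : ∀ n, inner ℂ h (lift (E n) (lift C g)) +
      inner ℂ (lift (ContinuousLinearMap.adjoint (E n)) (lift C g)) h = 0 := fun n => by
    -- The bounded operator A Eₙ commutes with d/dt, so skew-symmetry applies to J g and A Eₙ J g.
    -- The claim follows as Eₙ and its adjoint tend to the identity.
    have h2 := hh.inner_add_inner (hasL2Deriv_lift (G n) hh)
    have h5 := inner_lift_left (ContinuousLinearMap.adjoint (G n)) (lift J g) h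
    rw [ContinuousLinearMap.adjoint_adjoint] at h5
    rw [← h5, lift_lift, lift_lift] at h2
    rw [lift_lift, lift_lift]
    have h3 : E n ∘L C = G n ∘L J := by ext x; exact (hEG n _ _ (hJC x)).1
    have h4 : ContinuousLinearMap.adjoint (E n) ∘L C = ContinuousLinearMap.adjoint (G n) ∘L J := by
      ext x; exact (hEG n _ _ (hJC x)).2
    rw [h3, h4]
    exact h2
  have hid : lift (ContinuousLinearMap.id ℂ H) (lift C g) = lift C g := by
    rw [lift_lift, ContinuousLinearMap.id_comp]
  have h2 := tendsto_lift (S := ContinuousLinearMap.id ℂ H) hE1 hE (lift C g)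
  have h3 := tendsto_lift (S := ContinuousLinearMap.id ℂ H) (C := 1)
    (T := fun n => ContinuousLinearMap.adjoint (E n))
    (fun n => by rw [LinearIsometryEquiv.norm_map]; exact hE1 n) hE' (lift C g)
  rw [hid] at h2 h3
  have h4 := (Tendsto.inner (𝕜 := ℂ) (tendsto_const_nhds (x := h)) h2).add
    (h3.inner (𝕜 := ℂ) (tendsto_const_nhds (x := h)))
  simp only [h1] at h4
  have h5 := tendsto_nhds_unique h4 tendsto_const_nhds
  rw [← inner_conj_symm (lift C g) h, Complex.add_conj] at h5
  simpa using h5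

/-- A Pythagoras identity: f' + A f controls f' and A f separately, which is the source of
closedness. -/
theorem norm_add_sq_of_hasL2Deriv {A : H →ₗ.[ℂ] H} (hA : IsSelfAdjoint A)
    {J C : H →L[ℂ] H} (hJC : ∀ x, (J x, C x) ∈ A.graph) {g h : L2 H}
    (hh : HasL2Deriv (lift J g) h) : ‖h + lift C g‖ ^ 2 = ‖h‖ ^ 2 + ‖lift C g‖ ^ 2 := by
  rw [@norm_add_sq ℂ]
  have := re_inner_eq_zero_of_hasL2Deriv hA hJC hh
  simp [this]

/-- `d/dt + A - i b` is invertible when `A = Q⁻¹` has a bounded symmetric inverse. -/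
theorem exists_inverse_of_skew {Q : H →L[ℂ] H} (hQ : ContinuousLinearMap.adjoint Q = Q)
    (hskew : ∀ g h, HasL2Deriv (lift Q g) h → (inner ℂ h g).re = 0) (b : ℝ) :
    ∃ Γ : L2 H →L[ℂ] L2 H, ∀ l,
      HasL2Deriv (lift Q (Γ l)) (l - Γ l + (b * Complex.I) • lift Q (Γ l)) := by
  have hre : ∀ g, (inner ℂ ((b * Complex.I) • lift Q g) g).re = 0 := fun g => by
    have h1 : (inner ℂ (lift Q g) g).im = 0 := by
      refine Complex.conj_eq_iff_im.1 ?_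
      rw [inner_conj_symm, inner_lift_left, hQ]
    rw [inner_smul_left]
    simp [h1]
  -- The unknown is g = A f rather than f = Q g: N consists of the pairs (g, l) with (Q g)' + g - ib
  -- Q g = l.
  let N : Submodule ℂ (L2 H × L2 H) := ddtGraph.comap
    ((lift Q ∘L ContinuousLinearMap.fst ℂ (L2 H) (L2 H)).prod
      (ContinuousLinearMap.snd ℂ (L2 H) (L2 H) - ContinuousLinearMap.fst ℂ (L2 H) (L2 H) +
        (b * Complex.I) • (lift Q ∘L ContinuousLinearMap.fst ℂ (L2 H) (L2 H)))).toLinearMap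
  have hN : ∀ p, p ∈ N ↔
      HasL2Deriv (lift Q p.1) (p.2 - p.1 + (b * Complex.I) • lift Q p.1) := fun p => Iff.rfl
  have hNc : IsClosed (N : Set (L2 H × L2 H)) :=
    isClosed_hasL2Deriv.preimage (ContinuousLinearMap.continuous _)
  have : CompleteSpace N := hNc.completeSpace_coe
  -- Pairing the equation with g, both (Q g)' and ib Q g contribute no real part, which leaves ‖g‖²
  -- = Re ⟨l, g⟩.
  have hbd : ∀ p ∈ N, ‖p.1‖ ≤ ‖p.2‖ := fun p hp => by
    have h1 := hskew _ _ ((hN p).1 hp)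
    rw [inner_add_left, Complex.add_re, hre, add_zero, inner_sub_left, Complex.sub_re,
      inner_self_eq_norm_sq_to_K] at h1
    have h2 : ‖p.1‖ ^ 2 = (inner ℂ p.2 p.1).re := by
      rw [sub_eq_zero] at h1
      rw [h1]
      simp only [Complex.coe_algebraMap]
      norm_cast
    have h3 : (inner ℂ p.2 p.1).re ≤ ‖p.2‖ * ‖p.1‖ :=
      (Complex.re_le_norm _).trans (norm_inner_le_norm _ _)
    by_contra! hlt
    have h4 : 0 < ‖p.1‖ := (norm_nonneg _).trans_lt hlt
    nlinarith
  let σ : N →L[ℂ] L2 H := (ContinuousLinearMap.snd ℂ (L2 H) (L2 H)) ∘L N.subtypeL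
  have hσ : ∀ p : N, ‖p‖ ≤ 1 * ‖σ p‖ := fun p => by
    rw [one_mul]
    exact max_le (hbd p p.2) le_rfl
  have hanti : AntilipschitzWith 1 σ := σ.antilipschitz_of_bound (K := 1) (by simpa using hσ)
  have hrc : IsClosed (LinearMap.range σ.toLinearMap : Set (L2 H)) := by
    rw [LinearMap.coe_range]
    exact hanti.isClosed_range σ.uniformContinuous
  have hrange : LinearMap.range σ.toLinearMap = ⊤ := by
    have : CompleteSpace (LinearMap.range σ.toLinearMap) := hrc.completeSpace_coe
    rw [← Submodule.orthogonal_eq_bot_iff, Submodule.eq_bot_iff]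
    intro l hl
    -- A vector orthogonal to the range solves the adjoint equation (Q l)' = l + ib Q l; the same
    -- pairing then forces l = 0.
    have hd : HasL2Deriv (lift Q l) (l + (b * Complex.I) • lift Q l) := by
      refine hasL2Deriv_of_inner fun p q hpq => ?_
      have hmem : (p, lift Q q + p - (b * Complex.I) • lift Q p) ∈ N := by
        rw [hN]
        have : lift Q q + p - (b * Complex.I) • lift Q p - p + (b * Complex.I) • lift Q p =
            lift Q q := by abel
        simp only [this]
        exact hasL2Deriv_lift Q hpq
      have h1 := (Submodule.mem_orthogonal _ _).1 hl _ (LinearMap.mem_range.2 ⟨⟨_, hmem⟩, rfl⟩)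
      change inner ℂ (lift Q q + p - (b * Complex.I) • lift Q p) l = 0 at h1
      rw [inner_sub_left, inner_add_left, inner_smul_left, inner_lift_left, inner_lift_left,
        hQ] at h1
      rw [inner_add_right, inner_smul_right, ← h1]
      simp
      ring
    have h1 := hskew _ _ hd
    rw [inner_add_left, Complex.add_re, hre, add_zero, inner_self_eq_norm_sq_to_K] at h1
    simp only [Complex.coe_algebraMap] at h1
    norm_cast at h1
    simpa using h1
  let e : N ≃L[ℂ] L2 H := ContinuousLinearEquiv.ofBijective σ
    (LinearMap.ker_eq_bot.2 hanti.injective) hrange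
  refine ⟨(ContinuousLinearMap.fst ℂ (L2 H) (L2 H)) ∘L N.subtypeL ∘L (e.symm : L2 H →L[ℂ] N),
    fun l => ?_⟩
  have h1 := (hN _).1 (e.symm l).2
  have h2 : ((e.symm l : N) : L2 H × L2 H).2 = l := e.apply_symm_apply l
  rw [h2] at h1
  exact h1

end Invert

end ModelOperator
end

noncomputable section
namespace ModelOperator

/-! ### Multiplication by operator-valued functions and integration over intervals. -/

section Fiber

variable {H : Type*} [NormedAddCommGroup H] [InnerProductSpace ℂ H]

open scoped Classical in
/-- The operator of multiplication by a bounded measurable operator-valued function. -/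
def fib (W : ℝ → H →L[ℂ] H) : L2 H →L[ℂ] L2 H :=
  if hW : MemLp W ∞ volume then
    (ContinuousLinearMap.id ℂ (H →L[ℂ] H)).holderL volume ∞ 2 2 hW.toLp
  else 0

theorem coeFn_fib {W : ℝ → H →L[ℂ] H} (hW : MemLp W ∞ volume) (f : L2 H) :
    fib W f =ᵐ[volume] fun t => W t (f t) := by
  rw [fib, dif_pos hW]
  have := (ContinuousLinearMap.id ℂ (H →L[ℂ] H)).coeFn_holder (r := 2) (hW.toLp) f
  filter_upwards [this, hW.coeFn_toLp] with t h1 h2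
  rw [ContinuousLinearMap.holderL_apply_apply, h1, h2]
  rfl

theorem norm_fib_apply_le {W : ℝ → H →L[ℂ] H} (hW : MemLp W ∞ volume) {C : ℝ}
    (hC : ∀ t, ‖W t‖ ≤ C) (f : L2 H) : ‖fib W f‖ ≤ C * ‖f‖ := by
  refine Lp.norm_le_mul_norm_of_ae_le_mul ?_
  filter_upwards [coeFn_fib hW f] with t ht
  rw [ht]
  exact ((W t).le_opNorm _).trans (by gcongr; exact hC t)

theorem norm_fib_le {W : ℝ → H →L[ℂ] H} (hW : MemLp W ∞ volume) {C : ℝ}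
    (hC : ∀ t, ‖W t‖ ≤ C) : ‖fib W‖ ≤ C :=
  ContinuousLinearMap.opNorm_le_bound _ ((norm_nonneg _).trans (hC 0)) (norm_fib_apply_le hW hC)

theorem memLp_top_of_continuous {W : ℝ → H →L[ℂ] H} (hW : Continuous W) {C : ℝ}
    (hC : ∀ t, ‖W t‖ ≤ C) : MemLp W ∞ volume :=
  memLp_top_of_bound hW.aestronglyMeasurable C (Eventually.of_forall hC)

theorem memLp_top_indicator_Ico (a b : ℝ) (F : H →L[ℂ] H) :
    MemLp ((Set.Ico a b).indicator fun _ => F) ∞ volume :=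
  (memLp_top_const F).indicator measurableSet_Ico

/-- The embedding `x ↦ 1_{[a, b)} ⊗ x` of `H` into `L²(ℝ; H)`. -/
def iota (a b : ℝ) : H →L[ℂ] L2 H :=
  LinearMap.mkContinuous
    { toFun := fun x => indicatorConstLp 2 (measurableSet_Ico (a := a) (b := b))
        measure_Ico_lt_top.ne x
      map_add' := fun x y => by
        refine Lp.ext ?_
        refine indicatorConstLp_coeFn.trans ?_
        filter_upwards [Lp.coeFn_add (indicatorConstLp 2 (measurableSet_Ico (a := a) (b := b))
          measure_Ico_lt_top.ne x) (indicatorConstLp 2 (measurableSet_Ico (a := a) (b := b))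
          measure_Ico_lt_top.ne y : L2 H), indicatorConstLp_coeFn (p := 2)
          (hs := measurableSet_Ico (a := a) (b := b)) (hμs := measure_Ico_lt_top.ne) (c := x),
          indicatorConstLp_coeFn (p := 2) (hs := measurableSet_Ico (a := a) (b := b))
          (hμs := measure_Ico_lt_top.ne) (c := y)] with t h1 h2 h3
        rw [h1, Pi.add_apply, h2, h3]
        exact congrFun (Set.indicator_add (Set.Ico a b) (fun _ => x) fun _ => y) t
      map_smul' := fun c x => by
        refine Lp.ext ?_
        refine indicatorConstLp_coeFn.trans ?_
        filter_upwards [Lp.coeFn_smul c (indicatorConstLp 2 (measurableSet_Ico (a := a) (b := b))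
          measure_Ico_lt_top.ne x : L2 H), indicatorConstLp_coeFn (p := 2)
          (hs := measurableSet_Ico (a := a) (b := b)) (hμs := measure_Ico_lt_top.ne) (c := x)]
          with t h1 h2
        rw [RingHom.id_apply, h1, Pi.smul_apply, h2]
        exact congrFun (Set.indicator_const_smul (Set.Ico a b) c fun _ => x) t }
    (√(max (b - a) 0)) fun x => by
      change ‖indicatorConstLp 2 (measurableSet_Ico (a := a) (b := b))
        measure_Ico_lt_top.ne x‖ ≤ _
      rw [norm_indicatorConstLp two_ne_zero ENNReal.ofNat_ne_top, Measure.real, Real.volume_Ico,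
        ENNReal.toReal_ofReal', mul_comm, Real.sqrt_eq_rpow]
      simp

theorem coeFn_iota (a b : ℝ) (x : H) :
    iota a b x =ᵐ[volume] (Set.Ico a b).indicator fun _ => x :=
  indicatorConstLp_coeFn (hs := measurableSet_Ico) (hμs := measure_Ico_lt_top.ne)

theorem norm_iota_le (a b : ℝ) : ‖(iota a b : H →L[ℂ] L2 H)‖ ≤ √(max (b - a) 0) :=
  LinearMap.mkContinuous_norm_le _ (Real.sqrt_nonneg _) _

theorem L2.norm_le_of_ae_norm_le_indicator {E : Type*} [NormedAddCommGroup E] {f : L2 E} {a b C : ℝ} (hab : a ≤ b) (hC : 0 ≤ C)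
    (h : ∀ᵐ t, ‖f t‖ ≤ (Set.Ico a b).indicator (fun _ => C) t) : ‖f‖ ≤ C * √(b - a) := by
  have h1 : ‖f‖ ≤ ‖(indicatorConstLp 2 (measurableSet_Ico (a := a) (b := b))
      measure_Ico_lt_top.ne C : L2 ℝ)‖ := by
    refine Lp.norm_le_norm_of_ae_le ?_
    filter_upwards [h, indicatorConstLp_coeFn (p := 2) (E := ℝ)
          (hs := measurableSet_Ico (a := a) (b := b)) (hμs := measure_Ico_lt_top.ne) (c := C)]
      with t h1 h2
    rw [h2]
    exact h1.trans (le_abs_self _)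
  refine h1.trans ?_
  rw [norm_indicatorConstLp two_ne_zero ENNReal.ofNat_ne_top, Measure.real, Real.volume_Ico,
    ENNReal.toReal_ofReal (sub_nonneg.2 hab), Real.norm_of_nonneg hC, Real.sqrt_eq_rpow]
  simp

variable [CompleteSpace H]

theorem adjoint_iota_apply (a b : ℝ) (f : L2 H) :
    ContinuousLinearMap.adjoint (iota a b) f = ∫ t in Set.Ico a b, f t := by
  refine ext_inner_left ℂ fun x => ?_
  rw [ContinuousLinearMap.adjoint_inner_right]
  exact L2.inner_indicatorConstLp_eq_inner_setIntegral ℂ measurableSet_Ico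
    measure_Ico_lt_top.ne x f

theorem norm_setIntegral_Ico_le (a b : ℝ) (f : L2 H) :
    ‖∫ t in Set.Ico a b, f t‖ ≤ √(max (b - a) 0) * ‖f‖ := by
  rw [← adjoint_iota_apply]
  refine (ContinuousLinearMap.le_opNorm _ _).trans ?_
  rw [LinearIsometryEquiv.norm_map]
  gcongr
  exact norm_iota_le a b

/-- Cauchy–Schwarz; it makes functions with square integrable derivative Hölder continuous of order
1/2. -/
theorem norm_intervalIntegral_le_sqrt (f : L2 H) {s t δ : ℝ} (hst : |t - s| ≤ δ) :
    ‖∫ r in s..t, f r‖ ≤ √δ * ‖f‖ := by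
  wlog h : s ≤ t generalizing s t
  · rw [intervalIntegral.integral_symm, norm_neg]
    exact this (by rwa [abs_sub_comm]) (le_of_not_ge h)
  rw [intervalIntegral.integral_of_le h, ← integral_Ico_eq_integral_Ioc]
  refine (norm_setIntegral_Ico_le s t f).trans ?_
  rw [abs_of_nonneg (sub_nonneg.2 h)] at hst
  gcongr
  exact max_le hst ((sub_nonneg.2 h).trans hst)

end Fiber

/-! ### Partitions of an interval into cells of equal length. -/

section Partition

/-- The `k`-th of the intervals of length `δ` starting at `a`. -/
abbrev cell (a δ : ℝ) (k : ℕ) : Set ℝ := Set.Ico (a + k * δ) (a + k * δ + δ)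

/-- Half-open cells are disjoint, and the cell of t has index ⌊(t - a) / δ⌋. -/
theorem sum_indicator_cell {E : Type*} [AddCommMonoid E] {a b δ t : ℝ} {n : ℕ} (hδ : 0 < δ)
    (hn : n * δ = b - a) (ht : t ∈ Set.Ico a b) : ∃ k ∈ Finset.range n, t ∈ cell a δ k ∧
      ∀ c : ℕ → E, ∑ j ∈ Finset.range n, (cell a δ j).indicator (fun _ => c j) t = c k := by
  have h0 : 0 ≤ (t - a) / δ := div_nonneg (sub_nonneg.2 ht.1) hδ.le
  have hiff : ∀ j : ℕ, t ∈ cell a δ j ↔ ⌊(t - a) / δ⌋₊ = j := fun j => by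
    rw [Nat.floor_eq_iff h0, le_div_iff₀ hδ, div_lt_iff₀ hδ, Set.mem_Ico]
    constructor <;> rintro ⟨h1, h2⟩ <;> constructor <;> linarith
  have hk : ⌊(t - a) / δ⌋₊ ∈ Finset.range n := by
    rw [Finset.mem_range, Nat.floor_lt h0, div_lt_iff₀ hδ, hn]
    linarith [ht.2]
  refine ⟨_, hk, (hiff _).2 rfl, fun c => ?_⟩
  rw [Finset.sum_eq_single_of_mem _ hk, Set.indicator_of_mem ((hiff _).2 rfl)]
  intro j _ hj
  exact Set.indicator_of_notMem (fun h => hj ((hiff j).1 h).symm) _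

theorem sum_indicator_cell_eq_zero {E : Type*} [AddCommMonoid E] {a b δ t : ℝ} {n : ℕ} (hδ : 0 < δ)
    (hn : n * δ = b - a) (ht : t ∉ Set.Ico a b) (c : ℕ → E) :
    ∑ j ∈ Finset.range n, (cell a δ j).indicator (fun _ => c j) t = 0 := by
  refine Finset.sum_eq_zero fun j hj => Set.indicator_of_notMem (fun h => ht ⟨?_, ?_⟩) _
  · exact le_trans (by nlinarith [(Nat.cast_nonneg j : (0 : ℝ) ≤ j)]) h.1
  · have h1 : ((j : ℝ) + 1) ≤ n := by exact_mod_cast Finset.mem_range.1 hj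
    have := h.2
    nlinarith

end Partition

/-! ### Rellich-type compactness in L²(ℝ; H). -/

section Compactness

variable {H : Type*} [NormedAddCommGroup H] [InnerProductSpace ℂ H] [CompleteSpace H]

theorem isCompactOperator_finsetSum {E F : Type*} [NormedAddCommGroup E] [NormedSpace ℂ E]
    [NormedAddCommGroup F] [NormedSpace ℂ F] {ι : Type*} (s : Finset ι) {T : ι → E →L[ℂ] F}
    (hT : ∀ i ∈ s, IsCompactOperator (T i)) : IsCompactOperator (∑ i ∈ s, T i : E →L[ℂ] F) := by
  classical
  induction s using Finset.induction_on with
  | empty => simpa using isCompactOperator_zero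
  | insert i s hi ih =>
    rw [Finset.sum_insert hi]
    exact (hT i (Finset.mem_insert_self i s)).add
      (ih fun j hj => hT j (Finset.mem_insert_of_mem hj))

/-- Cell averages approximate a function with square integrable derivative. -/
theorem norm_sub_average_le {u : ℝ → H} {h : L2 H} (hu : ∀ t₀ t, u t = u t₀ + ∫ s in t₀..t, h s)
    {a δ t : ℝ} (hδ : 0 < δ) (ht : t ∈ Set.Ico a (a + δ)) :
    ‖u t - δ⁻¹ • ∫ s in Set.Ico a (a + δ), u s‖ ≤ √δ * ‖h‖ := by
  have hc : Continuous u := by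
    have : u = fun t => u 0 + ∫ s in (0 : ℝ)..t, h s := funext fun t => hu 0 t
    rw [this]
    exact continuous_const.add
      (intervalIntegral.continuous_primitive (fun a b => L2.intervalIntegrable h a b) 0)
  have hi : IntegrableOn u (Set.Ico a (a + δ)) :=
    (hc.integrableOn_Icc).mono_set Set.Ico_subset_Icc_self
  have hvol : volume.real (Set.Ico a (a + δ)) = δ := by
    rw [Measure.real, Real.volume_Ico, ENNReal.toReal_ofReal (by linarith)]; ring
  have h1 : u t - δ⁻¹ • ∫ s in Set.Ico a (a + δ), u s =
      δ⁻¹ • ∫ s in Set.Ico a (a + δ), (u t - u s) := by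
    rw [integral_sub (integrable_const (u t)) hi, setIntegral_const, hvol,
      smul_sub, smul_smul, inv_mul_cancel₀ hδ.ne', one_smul]
  rw [h1, norm_smul, norm_inv, Real.norm_of_nonneg hδ.le]
  have h2 : ‖∫ s in Set.Ico a (a + δ), (u t - u s)‖ ≤ (√δ * ‖h‖) * δ := by
    have := norm_setIntegral_le_of_norm_le_const (μ := volume) (s := Set.Ico a (a + δ))
      (f := fun s => u t - u s) (C := √δ * ‖h‖) measure_Ico_lt_top fun s hs => by
        rw [hu s t, add_sub_cancel_left]
        refine norm_intervalIntegral_le_sqrt h ?_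
        rw [abs_le]
        constructor <;> linarith [ht.1, ht.2, hs.1, hs.2]
    rwa [hvol] at this
  rw [inv_mul_le_iff₀ hδ]
  linarith

/-- A local Rellich theorem: if the values of `Λ` are locally absolutely continuous, then cutting
off and composing with a compact operator on the fibers gives a compact operator. -/
theorem isCompactOperator_fib_indicator_comp {Λ Δ : L2 H →L[ℂ] L2 H}
    (hΛ : ∀ l, HasL2Deriv (Λ l) (Δ l)) {G : H →L[ℂ] H} (hG : IsCompactOperator G) (a b : ℝ) :
    IsCompactOperator (fib ((Set.Ico a b).indicator fun _ => G) ∘L Λ) := by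
  have hmem := memLp_top_indicator_Ico a b G
  rcases le_or_gt b a with hab | hab
  · have : fib ((Set.Ico a b).indicator fun _ => G) ∘L Λ = 0 := by
      ext1 l
      refine Lp.ext ?_
      filter_upwards [coeFn_fib hmem (Λ l), Lp.coeFn_zero H 2 (volume : Measure ℝ)] with t h1 h2
      rw [ContinuousLinearMap.comp_apply, h1, Set.Ico_eq_empty (not_lt.2 hab)]
      simp
    rw [this]
    exact isCompactOperator_zero
  refine isCompactOperator_of_forall_norm_sub_le fun ε hε => ?_
  have hlim : Tendsto (fun n : ℕ => ‖G‖ * (√((b - a) / n) * ‖Δ‖) * √(b - a)) atTop (𝓝 0) := by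
    have h1 : Tendsto (fun n : ℕ => √((b - a) / n)) atTop (𝓝 0) := by
      simpa using (tendsto_const_div_atTop_nhds_zero_nat (b - a)).sqrt
    simpa using ((h1.mul_const ‖Δ‖).const_mul ‖G‖).mul_const √(b - a)
  obtain ⟨n, hn, hn0⟩ := ((hlim.eventually (eventually_le_nhds hε)).and
    (eventually_gt_atTop 0)).exists
  set δ := (b - a) / n with hδdef
  have hn0' : (0 : ℝ) < n := by exact_mod_cast hn0
  have hδ : 0 < δ := div_pos (sub_pos.2 hab) hn0'
  have hnδ : n * δ = b - a := by rw [hδdef]; field_simp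
  -- Averaging over a cell, applying G and spreading the value over the cell again: this factors
  -- through the compact G on H. By the Hölder bound the total error is at most ‖G‖ √δ ‖Δ‖ √(b - a).
  let L : ℕ → L2 H →L[ℂ] L2 H := fun k => ((δ⁻¹ : ℝ) : ℂ) • (iota (a + k * δ) (a + k * δ + δ) ∘L G ∘L
    ContinuousLinearMap.adjoint (iota (a + k * δ) (a + k * δ + δ)) ∘L Λ)
  refine ⟨∑ k ∈ Finset.range n, L k, isCompactOperator_finsetSum _ fun k _ => ?_, ?_⟩
  · have h1 : IsCompactOperator (iota (a + k * δ) (a + k * δ + δ) ∘L G ∘L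
        ContinuousLinearMap.adjoint (iota (a + k * δ) (a + k * δ + δ)) ∘L Λ) :=
      (hG.comp_clm (ContinuousLinearMap.adjoint (iota (a + k * δ) (a + k * δ + δ)) ∘L Λ)).clm_comp
        (iota (a + k * δ) (a + k * δ + δ))
    exact h1.smul ((δ⁻¹ : ℝ) : ℂ)
  refine (ContinuousLinearMap.opNorm_le_bound _ (by positivity) fun l => ?_).trans hn
  obtain ⟨u, hu, hu'⟩ := hΛ l
  set c : ℕ → H := fun k => G (δ⁻¹ • ∫ s in cell a δ k, u s) with hc
  have hL : ∀ k, L k l =ᵐ[volume] (cell a δ k).indicator fun _ => c k := fun k => by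
    have h1 : L k l = iota (a + k * δ) (a + k * δ + δ) (c k) := by
      have h2 : ContinuousLinearMap.adjoint (iota (a + k * δ) (a + k * δ + δ)) (Λ l) =
          ∫ s in cell a δ k, u s := by
        rw [adjoint_iota_apply]
        exact integral_congr_ae (ae_restrict_of_ae (hu.mono fun t ht => ht.symm))
      simp only [L, hc, smul_apply, ContinuousLinearMap.comp_apply, h2]
      rw [← Complex.coe_smul δ⁻¹ (∫ s in cell a δ k, u s), map_smul, map_smul]
    rw [h1]
    exact coeFn_iota _ _ _
  have key : ∀ᵐ t, ‖((fib ((Set.Ico a b).indicator fun _ => G) ∘L Λ - ∑ k ∈ Finset.range n, L k :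
      L2 H →L[ℂ] L2 H) l) t‖ ≤
        (Set.Ico a b).indicator (fun _ => ‖G‖ * (√δ * (‖Δ‖ * ‖l‖))) t := by
    have h0 : (fib ((Set.Ico a b).indicator fun _ => G) ∘L Λ - ∑ k ∈ Finset.range n, L k :
      L2 H →L[ℂ] L2 H) l = fib ((Set.Ico a b).indicator fun _ => G) (Λ l) -
        ∑ k ∈ Finset.range n, L k l := by
      rw [sub_apply, ContinuousLinearMap.comp_apply, sum_apply]
    rw [h0]
    filter_upwards [Lp.coeFn_sub (fib ((Set.Ico a b).indicator fun _ => G) (Λ l))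
      (∑ k ∈ Finset.range n, L k l), coeFn_fib hmem (Λ l),
      Lp.coeFn_finsetSum (Finset.range n) (fun k => L k l), ae_all_iff.2 hL, hu]
      with t h1 h2 h3 h4 h5
    rw [h1, Pi.sub_apply, h2, h3, Finset.sum_apply, Finset.sum_congr rfl fun k _ => h4 k, ← h5]
    by_cases ht : t ∈ Set.Ico a b
    · obtain ⟨k, -, hk, hk'⟩ := sum_indicator_cell (E := H) hδ hnδ ht
      rw [hk' c, Set.indicator_of_mem ht, Set.indicator_of_mem ht, hc, ← map_sub]
      refine (G.le_opNorm _).trans ?_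
      gcongr
      refine (norm_sub_average_le hu' hδ hk).trans ?_
      gcongr
      exact Δ.le_opNorm l
    · rw [sum_indicator_cell_eq_zero hδ hnδ ht, Set.indicator_of_notMem ht,
        Set.indicator_of_notMem ht]
      simp
  refine (L2.norm_le_of_ae_norm_le_indicator hab.le (by positivity) key).trans (le_of_eq ?_)
  ring

/-- A bounded inverse of a self-adjoint operator can be split off compact operators. -/
theorem exists_norm_sub_comp_le {A : H →ₗ.[ℂ] H} (hA : IsSelfAdjoint A) {Q : H →L[ℂ] H}
    (hQ : ∀ x, (Q x, x) ∈ A.graph) {F : H →L[ℂ] H} (hF : IsCompactOperator F) {ε : ℝ}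
    (hε : 0 < ε) : ∃ G : H →L[ℂ] H, IsCompactOperator G ∧ ‖F - G ∘L Q‖ ≤ ε := by
  obtain ⟨E, G, hE1, hE, hE', -, hEG⟩ := exists_regularizer hA
  -- Take G = F A Eₙ. Then G Q = F Eₙ, and F (1 - Eₙ) → 0 in norm because F is compact.
  have h1 := tendsto_isCompactOperator_comp (C := 2)
    (T := fun n => ContinuousLinearMap.id ℂ H - E n) (fun n => ?_) (fun x => ?_) hF (l := atTop)
  · obtain ⟨n, hn⟩ := (h1.eventually (eventually_le_nhds hε)).exists
    refine ⟨F ∘L G n, hF.comp_clm _, ?_⟩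
    have : F - (F ∘L G n) ∘L Q = F ∘L (ContinuousLinearMap.id ℂ H - E n) := by
      ext x
      have := (hEG n _ _ (hQ x)).1
      simp [this]
    rw [this]
    exact hn
  · refine (norm_sub_le _ _).trans ?_
    linarith [hE1 n, ContinuousLinearMap.norm_id_le (𝕜 := ℂ) (E := H)]
  · have h2 : ContinuousLinearMap.adjoint (ContinuousLinearMap.id ℂ H) =
        ContinuousLinearMap.id ℂ H := by
      ext y
      exact ext_inner_left ℂ fun z => by rw [ContinuousLinearMap.adjoint_inner_right]; rfl
    simp only [map_sub, h2, sub_apply, ContinuousLinearMap.id_apply]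
    simpa using (hE' x).const_sub x

/-- Only Q Γ, not Γ itself, takes differentiable values, so a compact F on a finite interval is
first replaced by G Q with G compact. A continuous W vanishing at infinity is then a uniform limit
of step functions with compact values. -/
theorem isCompactOperator_fib_comp {A : H →ₗ.[ℂ] H} (hA : IsSelfAdjoint A) {Q : H →L[ℂ] H}
    (hQ : ∀ x, (Q x, x) ∈ A.graph) {Γ Δ : L2 H →L[ℂ] L2 H}
    (hΓ : ∀ l, HasL2Deriv (lift Q (Γ l)) (Δ l)) {W : ℝ → H →L[ℂ] H} (hW : Continuous W)
    (hWc : ∀ t, IsCompactOperator (W t)) (hW0 : Tendsto W (cocompact ℝ) (𝓝 0)) :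
    IsCompactOperator (fib W ∘L Γ) := by
  have hind : ∀ (F : H →L[ℂ] H) (a b : ℝ), IsCompactOperator F →
      IsCompactOperator (fib ((Set.Ico a b).indicator fun _ => F) ∘L Γ) := by
    intro F a b hF
    refine isCompactOperator_of_forall_norm_sub_le fun ε hε => ?_
    have hpos : 0 < ‖Γ‖ + 1 := by positivity
    obtain ⟨G, hG, hFG⟩ := exists_norm_sub_comp_le hA hQ hF (div_pos hε hpos)
    refine ⟨_, isCompactOperator_fib_indicator_comp (Λ := lift Q ∘L Γ) hΓ hG a b, ?_⟩
    refine ContinuousLinearMap.opNorm_le_bound _ hε.le fun l => ?_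
    have h1 : ‖(fib ((Set.Ico a b).indicator fun _ => F) ∘L Γ -
        fib ((Set.Ico a b).indicator fun _ => G) ∘L lift Q ∘L Γ : L2 H →L[ℂ] L2 H) l‖ ≤
          ε / (‖Γ‖ + 1) * ‖Γ l‖ := by
      refine Lp.norm_le_mul_norm_of_ae_le_mul ?_
      rw [sub_apply, ContinuousLinearMap.comp_apply, ContinuousLinearMap.comp_apply,
        ContinuousLinearMap.comp_apply]
      filter_upwards [Lp.coeFn_sub (fib ((Set.Ico a b).indicator fun _ => F) (Γ l))
        (fib ((Set.Ico a b).indicator fun _ => G) (lift Q (Γ l))),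
        coeFn_fib (memLp_top_indicator_Ico a b F) (Γ l),
        coeFn_fib (memLp_top_indicator_Ico a b G) (lift Q (Γ l)), Q.coeFn_compLpL (Γ l)]
        with t h1 h2 h3 h4
      rw [h1, Pi.sub_apply, h2, h3, h4]
      by_cases ht : t ∈ Set.Ico a b
      · rw [Set.indicator_of_mem ht, Set.indicator_of_mem ht]
        exact (ContinuousLinearMap.le_opNorm (F - G ∘L Q) _).trans (by gcongr)
      · rw [Set.indicator_of_notMem ht, Set.indicator_of_notMem ht]
        simp only [zero_apply, sub_zero, norm_zero]
        positivity
    refine h1.trans ?_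
    calc ε / (‖Γ‖ + 1) * ‖Γ l‖ ≤ ε / (‖Γ‖ + 1) * ((‖Γ‖ + 1) * ‖l‖) := by
          gcongr
          exact (Γ.le_opNorm l).trans (by gcongr; linarith)
      _ = ε * ‖l‖ := by field_simp
  have hunif : UniformContinuous W := hW.uniformContinuous_of_tendsto_cocompact hW0
  obtain ⟨C, hC⟩ : ∃ C, ∀ t, ‖W t‖ ≤ C := by
    let W₀ : ZeroAtInftyContinuousMap ℝ (H →L[ℂ] H) := ⟨⟨W, hW⟩, hW0⟩
    exact ⟨‖W₀.toBCF‖, fun t => W₀.toBCF.norm_coe_le_norm t⟩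
  have hmem := memLp_top_of_continuous hW hC
  refine isCompactOperator_of_forall_norm_sub_le fun ε hε => ?_
  set η := ε / (‖Γ‖ + 1) with hη
  have hpos : 0 < ‖Γ‖ + 1 := by positivity
  have hη0 : 0 < η := div_pos hε hpos
  obtain ⟨δ₀, hδ₀, hδ₀'⟩ := Metric.uniformContinuous_iff.1 hunif η hη0
  -- Outside [-M, M) the norm of W is already at most η; inside, cells shorter than the modulus of
  -- continuity δ₀ give the step function.
  obtain ⟨M, hM, hM'⟩ : ∃ M > 0, ∀ t, t ∉ Set.Ico (-M) M → ‖W t‖ ≤ η := by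
    have h1 := hW0.eventually (Metric.ball_mem_nhds 0 hη0)
    rw [cocompact_eq_atBot_atTop, eventually_sup, eventually_atBot, eventually_atTop] at h1
    obtain ⟨⟨x, hx⟩, y, hy⟩ := h1
    refine ⟨max (max (-x) y) 1, by positivity, fun t ht => ?_⟩
    rw [Set.mem_Ico, not_and_or, not_le, not_lt] at ht
    have : W t ∈ Metric.ball 0 η := by
      rcases ht with ht | ht
      · exact hx t (by linarith [le_max_left (max (-x) y) 1, le_max_left (-x) y])
      · exact hy t (by linarith [le_max_left (max (-x) y) 1, le_max_right (-x) y])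
    rw [mem_ball_zero_iff] at this
    exact this.le
  obtain ⟨n, hn⟩ := exists_nat_gt ((M - -M) / δ₀)
  have hn0 : (0 : ℝ) < n := (div_pos (by linarith) hδ₀).trans hn
  set δ := (M - -M) / n with hδdef
  have hδ : 0 < δ := div_pos (by linarith) hn0
  have hδδ₀ : δ < δ₀ := by
    rw [div_lt_iff₀ hδ₀] at hn
    rw [hδdef, div_lt_iff₀ hn0]
    linarith
  have hnδ : n * δ = M - -M := by rw [hδdef]; field_simp
  let L : ℕ → L2 H →L[ℂ] L2 H := fun k =>
    fib ((cell (-M) δ k).indicator fun _ => W (-M + k * δ)) ∘L Γ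
  refine ⟨∑ k ∈ Finset.range n, L k,
    isCompactOperator_finsetSum _ fun k _ => hind _ _ _ (hWc _), ?_⟩
  refine ContinuousLinearMap.opNorm_le_bound _ hε.le fun l => ?_
  have h1 : ‖(fib W ∘L Γ - ∑ k ∈ Finset.range n, L k : L2 H →L[ℂ] L2 H) l‖ ≤ η * ‖Γ l‖ := by
    refine Lp.norm_le_mul_norm_of_ae_le_mul ?_
    rw [sub_apply, ContinuousLinearMap.comp_apply, sum_apply]
    filter_upwards [Lp.coeFn_sub (fib W (Γ l)) (∑ k ∈ Finset.range n, L k l),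
      coeFn_fib hmem (Γ l), Lp.coeFn_finsetSum (Finset.range n) (fun k => L k l),
      ae_all_iff.2 fun k : ℕ => coeFn_fib
        (memLp_top_indicator_Ico (-M + k * δ) (-M + k * δ + δ) (W (-M + k * δ))) (Γ l)]
      with t h1 h2 h3 h4
    have h5 : ∀ k ∈ Finset.range n, (L k l) t =
        (cell (-M) δ k).indicator (fun _ => W (-M + k * δ) ((Γ l) t)) t := fun k _ => by
      refine (h4 k).trans ?_
      by_cases ht : t ∈ cell (-M) δ k
      · rw [Set.indicator_of_mem ht, Set.indicator_of_mem ht]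
      · rw [Set.indicator_of_notMem ht, Set.indicator_of_notMem ht]; rfl
    rw [h1, Pi.sub_apply, h2, h3, Finset.sum_apply, Finset.sum_congr rfl h5]
    by_cases ht : t ∈ Set.Ico (-M) M
    · obtain ⟨k, -, hk, hk'⟩ := sum_indicator_cell (E := H) hδ hnδ ht
      rw [hk' fun j => W (-M + j * δ) ((Γ l) t)]
      refine (ContinuousLinearMap.le_opNorm (W t - W (-M + k * δ)) _).trans ?_
      gcongr
      rw [← dist_eq_norm]
      refine (hδ₀' ?_).le
      rw [Real.dist_eq, abs_of_nonneg (sub_nonneg.2 hk.1)]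
      linarith [hk.2]
    · rw [sum_indicator_cell_eq_zero hδ hnδ ht, sub_zero]
      exact ((W t).le_opNorm _).trans (by gcongr; exact hM' t ht)
  refine h1.trans ?_
  calc η * ‖Γ l‖ ≤ η * ((‖Γ‖ + 1) * ‖l‖) := by
        gcongr
        exact (Γ.le_opNorm l).trans (by gcongr; linarith)
    _ = ε * ‖l‖ := by rw [hη]; field_simp

end Compactness

end ModelOperator
end

noncomputable section
namespace ModelOperator

/-! ### The model operator: graph, density of the domain and closedness. -/

section ModelGraph

variable {H : Type*} [NormedAddCommGroup H] [InnerProductSpace ℂ H]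

theorem mem_graph_domRestrict {T : H →ₗ.[ℂ] H} {S : Submodule ℂ H} {x y : H} :
    (x, y) ∈ (T.domRestrict S).graph ↔ x ∈ S ∧ (x, y) ∈ T.graph := by
  constructor
  · intro h
    obtain ⟨⟨a, ha⟩, rfl, hb⟩ := (LinearPMap.mem_graph_iff _).1 h
    refine ⟨ha.1, (LinearPMap.mem_graph_iff _).2 ⟨⟨a, ha.2⟩, rfl, ?_⟩⟩
    rw [← hb]
    exact (LinearPMap.domRestrict_apply rfl).symm
  · rintro ⟨hx, h⟩
    obtain ⟨⟨a, ha⟩, rfl, hb⟩ := (LinearPMap.mem_graph_iff _).1 h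
    refine (LinearPMap.mem_graph_iff _).2 ⟨⟨a, hx, ha⟩, rfl, ?_⟩
    rw [← hb]
    exact LinearPMap.domRestrict_apply rfl

theorem mem_graph_fiberOp {A : ℝ → H →ₗ.[ℂ] H} {f l : L2 H} :
    (f, l) ∈ (fiberOp A).graph ↔ ∀ᵐ t, (f t, l t) ∈ (A t).graph := by
  constructor
  · intro h
    obtain ⟨⟨a, ha⟩, rfl, rfl⟩ := (LinearPMap.mem_graph_iff _).1 h
    filter_upwards [ha.1, ha.2.coeFn_toLp] with t h1 h2
    rw [mem_graph_val_iff]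
    exact ⟨h1, h2.symm⟩
  · intro h
    have h1 : (fun t => val (A t) (f t)) =ᵐ[volume] l := h.mono fun t ht => val_eq_of_mem_graph ht
    have hf : f ∈ (fiberOp A).domain :=
      ⟨h.mono fun t ht => LinearPMap.mem_domain_of_mem_graph ht, (Lp.memLp l).ae_eq h1.symm⟩
    refine (LinearPMap.mem_graph_iff _).2 ⟨⟨f, hf⟩, rfl, ?_⟩
    exact Lp.ext (hf.2.coeFn_toLp.trans h1)

/-- The bounded operator `1 + i R + F`, where `R = (A - i)⁻¹`; it is `(A + F (A - i)) R`. -/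
def symbol (A : H →ₗ.[ℂ] H) (F : H →L[ℂ] H) : H →L[ℂ] H :=
  ContinuousLinearMap.id ℂ H + Complex.I • resolv A Complex.I + F

theorem symbol_apply (A : H →ₗ.[ℂ] H) (F : H →L[ℂ] H) (x : H) :
    symbol A F x = x + Complex.I • resolv A Complex.I x + F x := rfl

theorem mem_perturb_graph_iff {A : H →ₗ.[ℂ] H} {F : H →L[ℂ] H} (hI : Complex.I ∈ resolventSet A)
    {x y : H} : (x, y) ∈ (perturb A F).graph ↔ ∃ v, resolv A Complex.I v = x ∧ symbol A F v = y :=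
  mem_perturb_iff hI

theorem lift_eq_zero {T : H →L[ℂ] H} (hT : Function.Injective T) {l : L2 H} (hl : lift T l = 0) :
    l = 0 := by
  refine (Lp.eq_zero_iff_ae_eq_zero).2 ?_
  filter_upwards [T.coeFn_compLpL l, (Lp.eq_zero_iff_ae_eq_zero).1 hl] with t h1 h2
  refine hT ?_
  rw [← h1, Pi.zero_apply, map_zero]
  exact h2

variable [CompleteSpace H]

/-- The substitution f = (A - i)⁻¹ g replaces the unbounded fibers by the bounded `symbol`; the rest
of the argument works in the variable g. -/
theorem mem_graph_modelOp {A : H →ₗ.[ℂ] H} {B : ℝ → H →ₗ.[ℂ] H} {K : ℝ → H →L[ℂ] H}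
    (hI : Complex.I ∈ resolventSet A) (hB : ∀ t, A + B t = perturb A (K t))
    (hm : MemLp (fun t => symbol A (K t)) ∞ volume) {f l : L2 H} :
    (f, l) ∈ (modelOp A B).graph ↔ ∃ g h, lift (resolv A Complex.I) g = f ∧ HasL2Deriv f h ∧
      h + fib (fun t => symbol A (K t)) g = l := by
  rw [modelOp, mem_graph_domRestrict, mem_graph_add]
  simp only [hB, ddt_graph, mem_graph_fiberOp]
  constructor
  · rintro ⟨⟨-, hf⟩, h, m, hh, hfm, rfl⟩
    obtain ⟨k, hk⟩ := LinearPMap.mem_domain_iff.1 hf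
    rw [mem_graph_fiberOp] at hk
    have hR : ∀ᵐ t, resolv A Complex.I ((k - Complex.I • f : L2 H) t) = f t := by
      filter_upwards [hk, Lp.coeFn_sub k (Complex.I • f), Lp.coeFn_smul Complex.I f] with t h1 h2 h3
      rw [h2, Pi.sub_apply, h3]
      exact resolv_sub hI h1
    refine ⟨k - Complex.I • f, h, Lp.ext ?_, hh, ?_⟩
    · filter_upwards [hR, (resolv A Complex.I).coeFn_compLpL (k - Complex.I • f)] with t h1 h2
      rw [h2, h1]
    · congr 1
      refine Lp.ext ?_
      filter_upwards [hR, coeFn_fib hm (k - Complex.I • f), hfm] with t h1 h2 h3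
      obtain ⟨v, hv, hv'⟩ := (mem_perturb_graph_iff hI).1 h3
      rw [h2, resolv_injective hI (h1.trans hv.symm), hv']
  · rintro ⟨g, h, rfl, hh, rfl⟩
    refine ⟨⟨LinearPMap.mem_domain_of_mem_graph (y := h) (by rw [ddt_graph]; exact hh),
      LinearPMap.mem_domain_of_mem_graph
        (y := g + Complex.I • lift (resolv A Complex.I) g) (mem_graph_fiberOp.2 ?_)⟩,
      h, _, hh, ?_, rfl⟩
    · filter_upwards [(resolv A Complex.I).coeFn_compLpL g,
        Lp.coeFn_add g (Complex.I • lift (resolv A Complex.I) g),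
        Lp.coeFn_smul Complex.I (lift (resolv A Complex.I) g)] with t h1 h2 h3
      rw [h2, Pi.add_apply, h3, Pi.smul_apply, h1]
      exact resolv_mem_graph hI _
    · filter_upwards [(resolv A Complex.I).coeFn_compLpL g, coeFn_fib hm g] with t h1 h2
      rw [h1, h2]
      exact (mem_perturb_graph_iff hI).2 ⟨_, rfl, rfl⟩

theorem HasL2Deriv.eq_zero {h : L2 H} (hh : HasL2Deriv (0 : L2 H) h) : h = 0 := by
  have h1 : ((0 : L2 H), h) ∈ (ddt (H := H)).graph := by rw [ddt_graph]; exact hh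
  exact LinearPMap.graph_fst_eq_zero_snd _ h1 rfl

/-- If l is orthogonal to R p for every p in dom d/dt, then (0, R* l) satisfies the adjoint relation
defining d/dt. So R* l is the derivative of 0, and R* is injective. -/
theorem dense_domain_modelOp {A : H →ₗ.[ℂ] H} (hA : IsSelfAdjoint A) {B : ℝ → H →ₗ.[ℂ] H}
    {K : ℝ → H →L[ℂ] H} (hB : ∀ t, A + B t = perturb A (K t))
    (hm : MemLp (fun t => symbol A (K t)) ∞ volume) :
    Dense ((modelOp A B).domain : Set (L2 H)) := by
  have hI : Complex.I ∈ resolventSet A := mem_resolventSet_of_im_ne_zero hA (by simp)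
  rw [Submodule.dense_iff_topologicalClosure_eq_top, Submodule.topologicalClosure_eq_top_iff,
    Submodule.eq_bot_iff]
  intro l hl
  have h1 : HasL2Deriv (0 : L2 H)
      (lift (ContinuousLinearMap.adjoint (resolv A Complex.I)) l) := by
    refine hasL2Deriv_of_inner fun p q hpq => ?_
    have h2 : lift (resolv A Complex.I) p ∈ (modelOp A B).domain :=
      LinearPMap.mem_domain_of_mem_graph
        ((mem_graph_modelOp hI hB hm).2 ⟨p, _, rfl, hasL2Deriv_lift _ hpq, rfl⟩)
    rw [inner_zero_right, zero_add, ← inner_lift_left]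
    exact (Submodule.mem_orthogonal _ _).1 hl _ h2
  refine lift_eq_zero ?_ h1.eq_zero
  rw [adjoint_resolv hA (by simp)]
  exact resolv_injective (mem_resolventSet_of_im_ne_zero hA (by simp))

/-- The a priori estimate behind the closedness of the model operator. -/
theorem exists_norm_le_of_hasL2Deriv {A : H →ₗ.[ℂ] H} (hA : IsSelfAdjoint A)
    {K : ℝ → H →L[ℂ] H} (hK : MemLp K ∞ volume)
    (hsmall : ∀ T : ℕ → H →L[ℂ] H, (∀ n, ‖T n‖ ≤ 3) →
      (∀ x, Tendsto (fun n => ContinuousLinearMap.adjoint (T n) x) atTop (𝓝 0)) →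
      ∃ n, ∀ t, ‖K t ∘L T n‖ ≤ 1 / 2) :
    ∃ C : ℝ, 0 ≤ C ∧ ∀ g h, HasL2Deriv (lift (resolv A Complex.I) g) h →
      ‖h‖ ≤ C * (‖lift (resolv A Complex.I) g‖ + ‖h + (g + Complex.I •
        lift (resolv A Complex.I) g + fib K g)‖) ∧
      ‖g‖ ≤ C * (‖lift (resolv A Complex.I) g‖ + ‖h + (g + Complex.I •
        lift (resolv A Complex.I) g + fib K g)‖) := by
  have hI : Complex.I ∈ resolventSet A := mem_resolventSet_of_im_ne_zero hA (by simp)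
  set R := resolv A Complex.I with hR
  let z : ℕ → ℂ := fun n => ((n + 1 : ℝ) : ℂ) * Complex.I
  obtain ⟨T, hT, hlim, hTA⟩ := exists_relative_regularizer hA z
    (fun n => by simp [z, abs_of_pos (show (0 : ℝ) < n + 1 by positivity)]) (fun n => by simp [z])
  obtain ⟨n, hn⟩ := hsmall T hT hlim
  refine ⟨4 + 2 * ‖z n‖, by positivity, fun g h hh => ?_⟩
  set f := lift R g with hf
  set m := g + Complex.I • f with hmdef
  set k := fib K g with hk
  have hCg : lift (ContinuousLinearMap.id ℂ H + Complex.I • R) g = m := by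
    refine Lp.ext ?_
    filter_upwards [ContinuousLinearMap.coeFn_compLpL (p := 2) (μ := (volume : Measure ℝ))
      (ContinuousLinearMap.id ℂ H + Complex.I • R) g, Lp.coeFn_add g (Complex.I • f),
      Lp.coeFn_smul Complex.I f, R.coeFn_compLpL g] with t h1 h2 h3 h4
    rw [h1, h2, Pi.add_apply, h3, Pi.smul_apply, h4]
    rfl
  have hsq : ‖h + m‖ ^ 2 = ‖h‖ ^ 2 + ‖m‖ ^ 2 := by
    rw [← hCg]
    exact norm_add_sq_of_hasL2Deriv hA (fun x => resolv_mem_graph hI x) hh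
  have h1 : ‖h‖ ≤ ‖h + m‖ := abs_le_of_sq_le_sq' (by nlinarith [sq_nonneg ‖m‖]) (norm_nonneg _) |>.2
  have h2 : ‖m‖ ≤ ‖h + m‖ := abs_le_of_sq_le_sq' (by nlinarith [sq_nonneg ‖h‖]) (norm_nonneg _) |>.2
  -- Here m stands for A f, and g = Tₙ (m - zₙ f), so K g = (K Tₙ)(m - zₙ f). The factor 1/2 lets
  -- the ‖m‖ part be absorbed into ‖h + m‖.
  have h3 : ‖k‖ ≤ 1 / 2 * ‖m - z n • f‖ := by
    refine Lp.norm_le_mul_norm_of_ae_le_mul ?_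
    filter_upwards [coeFn_fib hK g, Lp.coeFn_sub m (z n • f), Lp.coeFn_add g (Complex.I • f),
      Lp.coeFn_smul Complex.I f, Lp.coeFn_smul (z n) f, R.coeFn_compLpL g]
      with t e1 e2 e3 e4 e5 e6
    rw [hk, e1, e2, Pi.sub_apply, e5, Pi.smul_apply, hmdef, e3, Pi.add_apply, e4, Pi.smul_apply, e6]
    have h4 := hTA n _ _ (resolv_mem_graph hI (g t))
    rw [add_sub_cancel_right] at h4
    conv_lhs => rw [← h4]
    exact ((K t ∘L T n).le_opNorm _).trans (by gcongr; exact hn t)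
  have h4 : ‖m - z n • f‖ ≤ ‖m‖ + ‖z n‖ * ‖f‖ := (norm_sub_le _ _).trans_eq (by rw [norm_smul])
  have h5 : ‖h + m‖ ≤ ‖h + (m + k)‖ + ‖k‖ := by
    calc ‖h + m‖ = ‖h + (m + k) - k‖ := by congr 1; abel
      _ ≤ _ := norm_sub_le _ _
  have h6 : ‖g‖ ≤ ‖m‖ + ‖f‖ := by
    calc ‖g‖ = ‖m - Complex.I • f‖ := by rw [hmdef, add_sub_cancel_right]
      _ ≤ _ := (norm_sub_le _ _).trans_eq (by rw [norm_smul, Complex.norm_I, one_mul])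
  have h7 : 0 ≤ ‖z n‖ * ‖f‖ := by positivity
  have h8 : 0 ≤ ‖z n‖ * ‖h + (m + k)‖ := by positivity
  have h9 := norm_nonneg f
  have h10 := norm_nonneg (h + (m + k))
  constructor <;> nlinarith

/-- The graph is the image of the closed space of pairs (g, (R g)') under a bounded map, which the a
priori estimate makes bounded below. -/
theorem isClosed_modelOp {A : H →ₗ.[ℂ] H} (hA : IsSelfAdjoint A) {B : ℝ → H →ₗ.[ℂ] H}
    {K : ℝ → H →L[ℂ] H} (hB : ∀ t, A + B t = perturb A (K t)) (hK : MemLp K ∞ volume)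
    (hm : MemLp (fun t => symbol A (K t)) ∞ volume)
    (hsmall : ∀ T : ℕ → H →L[ℂ] H, (∀ n, ‖T n‖ ≤ 3) →
      (∀ x, Tendsto (fun n => ContinuousLinearMap.adjoint (T n) x) atTop (𝓝 0)) →
      ∃ n, ∀ t, ‖K t ∘L T n‖ ≤ 1 / 2) : (modelOp A B).IsClosed := by
  have hI : Complex.I ∈ resolventSet A := mem_resolventSet_of_im_ne_zero hA (by simp)
  obtain ⟨C, hC0, hC⟩ := exists_norm_le_of_hasL2Deriv hA hK hsmall
  have hfib : ∀ g, fib (fun t => symbol A (K t)) g =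
      g + Complex.I • lift (resolv A Complex.I) g + fib K g := fun g => by
    refine Lp.ext ?_
    filter_upwards [coeFn_fib hm g, coeFn_fib hK g,
      Lp.coeFn_add (g + Complex.I • lift (resolv A Complex.I) g) (fib K g),
      Lp.coeFn_add g (Complex.I • lift (resolv A Complex.I) g),
      Lp.coeFn_smul Complex.I (lift (resolv A Complex.I) g),
      (resolv A Complex.I).coeFn_compLpL g] with t e1 e2 e3 e4 e5 e6
    rw [e1, e3, Pi.add_apply, e4, Pi.add_apply, e5, Pi.smul_apply, e6, e2]
    rfl
  let Rl := lift (resolv A Complex.I)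
  let N : Submodule ℂ (L2 H × L2 H) := ddtGraph.comap
    ((Rl ∘L ContinuousLinearMap.fst ℂ (L2 H) (L2 H)).prod
      (ContinuousLinearMap.snd ℂ (L2 H) (L2 H))).toLinearMap
  have hN : ∀ p, p ∈ N ↔ HasL2Deriv (Rl p.1) p.2 := fun p => Iff.rfl
  have hNc : IsClosed (N : Set (L2 H × L2 H)) :=
    isClosed_hasL2Deriv.preimage (ContinuousLinearMap.continuous _)
  have : CompleteSpace N := hNc.completeSpace_coe
  let σ : N →L[ℂ] L2 H × L2 H :=
    ((Rl ∘L ContinuousLinearMap.fst ℂ (L2 H) (L2 H)).prod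
      (ContinuousLinearMap.snd ℂ (L2 H) (L2 H) + fib (fun t => symbol A (K t)) ∘L
        ContinuousLinearMap.fst ℂ (L2 H) (L2 H))) ∘L N.subtypeL
  have hσ : ∀ p : N, σ p = (Rl (p : L2 H × L2 H).1,
    (p : L2 H × L2 H).2 + fib (fun t => symbol A (K t)) (p : L2 H × L2 H).1) := fun p => rfl
  have hbd : ∀ p : N, ‖p‖ ≤ (2 * C) * ‖σ p‖ := fun p => by
    obtain ⟨h1, h2⟩ := hC _ _ ((hN p).1 p.2)
    rw [← hfib] at h1 h2
    have h3 : ‖Rl (p : L2 H × L2 H).1‖ ≤ ‖σ p‖ := norm_fst_le (σ p)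
    have h4 : ‖(p : L2 H × L2 H).2 + fib (fun t => symbol A (K t)) (p : L2 H × L2 H).1‖ ≤ ‖σ p‖ :=
      norm_snd_le (σ p)
    have h5 := mul_le_mul_of_nonneg_left (add_le_add h3 h4) hC0
    exact max_le ((h2.trans h5).trans_eq (by ring)) ((h1.trans h5).trans_eq (by ring))
  have hanti : AntilipschitzWith (2 * C).toNNReal σ := σ.antilipschitz_of_bound (by
    rw [Real.coe_toNNReal _ (by positivity)]; exact hbd)
  have hgraph : ((modelOp A B).graph : Set (L2 H × L2 H)) = Set.range σ := by
    ext ⟨f, l⟩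
    rw [SetLike.mem_coe, mem_graph_modelOp hI hB hm]
    constructor
    · rintro ⟨g, h, rfl, hh, rfl⟩
      exact ⟨⟨(g, h), hh⟩, rfl⟩
    · rintro ⟨p, hp⟩
      rw [hσ, Prod.mk.injEq] at hp
      obtain ⟨rfl, rfl⟩ := hp
      exact ⟨_, _, rfl, (hN _).1 p.2, rfl⟩
  rw [LinearPMap.IsClosed, hgraph]
  exact hanti.isClosed_range σ.uniformContinuous

end ModelGraph

end ModelOperator
end

noncomputable section
namespace ModelOperator

/-! ### Closed range and finite codimension from an approximate right inverse. -/

section FredholmCriterion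

variable {E : Type*} [NormedAddCommGroup E] [InnerProductSpace ℂ E] [CompleteSpace E]

/-- A subspace containing the range of a compact perturbation of an invertible operator is closed
and has finite codimension. -/
theorem isClosed_and_finiteDimensional_of_range_le {S C : E →L[ℂ] E} (hS : ‖S‖ < 1)
    (hC : IsCompactOperator C) {X : Submodule ℂ E} (hX : ∀ x, x + S x + C x ∈ X) :
    IsClosed (X : Set E) ∧ FiniteDimensional ℂ Xᗮ := by
  obtain ⟨u, hu⟩ : IsUnit (1 + S) := by
    have := isUnit_one_sub_of_norm_lt_one (x := -S) (by rwa [norm_neg])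
    rwa [sub_neg_eq_add] at this
  set L : E →L[ℂ] E := (↑u⁻¹ : E →L[ℂ] E) ∘L C with hL
  have hLc : IsCompactOperator L := hC.clm_comp _
  obtain ⟨V₀, hV₀, hn⟩ :=
    IsCompactOperator.exists_finiteDimensional_approx hLc (ε := 1 / 2) (by norm_num)
  obtain ⟨w, hw⟩ : IsUnit (1 + (L - V₀.starProjection ∘L L)) := by
    have := isUnit_one_sub_of_norm_lt_one (x := -(L - V₀.starProjection ∘L L))
      (by rw [norm_neg]; linarith)
    rwa [sub_neg_eq_add] at this
  -- With P the projection onto `V₀`, 1 + S + C = u (w + P L), where u = 1 + S and w = 1 + (L - P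
  -- L). If P L x = 0, then u w x = (1 + S + C) x lies in X; so X contains the kernel of the finite
  -- rank operator Φ.
  set Φ : E →L[ℂ] E := V₀.starProjection ∘L L ∘L (↑(u * w)⁻¹ : E →L[ℂ] E) with hΦ
  have hker : LinearMap.ker Φ.toLinearMap ≤ X := by
    intro y hy
    set x : E := (↑(u * w)⁻¹ : E →L[ℂ] E) y with hx
    have hxy : (↑(u * w) : E →L[ℂ] E) x = y := by
      rw [hx, ← mul_apply_eq_comp, Units.mul_inv]; rfl
    have h0 : V₀.starProjection (L x) = 0 := hy
    have h1 : (↑w : E →L[ℂ] E) x = x + L x := by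
      rw [hw]
      simp [h0]
    have h2 : (↑u : E →L[ℂ] E) (L x) = C x := by
      rw [hL, ContinuousLinearMap.comp_apply, ← mul_apply_eq_comp, Units.mul_inv]; rfl
    have h3 : y = x + S x + C x := by
      rw [← hxy, Units.val_mul, mul_apply_eq_comp, h1, map_add, h2, hu]
      rfl
    rw [h3]
    exact hX x
  have hclosed : IsClosed (LinearMap.ker Φ.toLinearMap : Set E) :=
    isClosed_singleton.preimage Φ.continuous
  have hrange : ∀ y, Φ y ∈ V₀ := fun y => V₀.starProjection_apply_mem _
  have hfd : FiniteDimensional ℂ (LinearMap.range Φ.toLinearMap) :=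
    Submodule.finiteDimensional_of_le (S₂ := V₀) (by rintro _ ⟨y, rfl⟩; exact hrange y)
  have hq : FiniteDimensional ℂ (E ⧸ LinearMap.ker Φ.toLinearMap) :=
    LinearEquiv.finiteDimensional Φ.toLinearMap.quotKerEquivRange.symm
  refine ⟨Submodule.isClosed_mono_of_finiteDimensional_quotient hclosed hker, ?_⟩
  refine FiniteDimensional.of_injective
    ((LinearMap.ker Φ.toLinearMap).mkQ ∘ₗ Xᗮ.subtype) ?_
  rw [← LinearMap.ker_eq_bot, LinearMap.ker_eq_bot']
  intro y hy
  have h1 : (y : E) ∈ LinearMap.ker Φ.toLinearMap :=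
    (Submodule.Quotient.mk_eq_zero _).1 hy
  have h2 : inner ℂ (y : E) (y : E) = 0 := (Submodule.mem_orthogonal _ _).1 y.2 _ (hker h1)
  exact Subtype.ext (inner_self_eq_zero.1 h2)

end FredholmCriterion

/-! ### Slowly varying cutoff functions. -/

section Cutoff

/-- There are smooth cutoff functions from `0` at `-∞` to `1` at `+∞` with small derivative. -/
theorem exists_cutoff {ε : ℝ} (hε : 0 < ε) : ∃ χ : ℝ → ℝ, ContDiff ℝ 1 χ ∧
    (∀ t, |χ t| ≤ 1) ∧ (∀ t, |1 - χ t| ≤ 1) ∧ (∀ t, |deriv χ t| ≤ ε) ∧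
    Tendsto χ atBot (𝓝 0) ∧ Tendsto χ atTop (𝓝 1) := by
  have hπ := Real.pi_pos
  -- An arctangent profile suffices: only the limits of the cutoff at ±∞ enter, not local constancy.
  have hd : ∀ t, HasDerivAt (fun t => 1 / 2 + Real.arctan (ε * t) / Real.pi)
      (ε / (1 + (ε * t) ^ 2) / Real.pi) t := fun t => by
    have h1 : HasDerivAt (fun t => ε * t) ε t := by simpa using (hasDerivAt_id t).const_mul ε
    have h2 := (((Real.hasDerivAt_arctan (ε * t)).comp t h1).div_const Real.pi).const_add (1 / 2)
    refine h2.congr_deriv ?_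
    ring
  have hb : ∀ t, -(1 / 2) < Real.arctan (ε * t) / Real.pi ∧
      Real.arctan (ε * t) / Real.pi < 1 / 2 := fun t => by
    rw [lt_div_iff₀ hπ, div_lt_iff₀ hπ]
    constructor
    · linarith [Real.neg_pi_div_two_lt_arctan (ε * t)]
    · linarith [Real.arctan_lt_pi_div_two (ε * t)]
  refine ⟨fun t => 1 / 2 + Real.arctan (ε * t) / Real.pi, ?_, fun t => ?_, fun t => ?_,
    fun t => ?_, ?_, ?_⟩
  · exact contDiff_const.add ((Real.contDiff_arctan.comp (contDiff_const.mul contDiff_id)).div_const _)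
  · rw [abs_le]; constructor <;> linarith [hb t]
  · rw [abs_le]; constructor <;> linarith [hb t]
  · rw [(hd t).deriv, abs_of_nonneg (by positivity), div_div, div_le_iff₀ (by positivity)]
    have h1 : 1 ≤ (1 + (ε * t) ^ 2) * Real.pi := by
      nlinarith [sq_nonneg (ε * t), Real.pi_gt_three]
    nlinarith
  · have h1 := (tendsto_nhds_of_tendsto_nhdsWithin Real.tendsto_arctan_atBot).comp
      (tendsto_id.const_mul_atBot hε)
    have h2 := (h1.div_const Real.pi).const_add (1 / 2)
    have h3 : 1 / 2 + -(Real.pi / 2) / Real.pi = 0 := by field_simp; norm_num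
    rw [h3] at h2
    exact h2
  · have h1 := (tendsto_nhds_of_tendsto_nhdsWithin Real.tendsto_arctan_atTop).comp
      (tendsto_id.const_mul_atTop hε)
    have h2 := (h1.div_const Real.pi).const_add (1 / 2)
    have h3 : 1 / 2 + (Real.pi / 2) / Real.pi = 1 := by field_simp; norm_num
    rw [h3] at h2
    exact h2

end Cutoff

/-! ### Gluing the inverses at -∞ and +∞. -/

section Parametrix

variable {H : Type*} [NormedAddCommGroup H] [InnerProductSpace ℂ H]

/-- Multiplication by a bounded continuous function on `L²(ℝ; H)`. -/
abbrev scal (φ : ℝ → ℂ) : L2 H →L[ℂ] L2 H := fib fun t => φ t • ContinuousLinearMap.id ℂ H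

theorem memLp_scal {φ : ℝ → ℂ} (hφ : Continuous φ) {C : ℝ} (hC : ∀ t, ‖φ t‖ ≤ C) :
    MemLp (fun t => φ t • ContinuousLinearMap.id ℂ H) ∞ volume :=
  memLp_top_of_continuous (hφ.smul continuous_const) (C := C) fun t => by
    rw [norm_smul]
    calc ‖φ t‖ * ‖ContinuousLinearMap.id ℂ H‖ ≤ C * 1 := by
          gcongr
          · exact (norm_nonneg _).trans (hC t)
          · exact hC t
          · exact ContinuousLinearMap.norm_id_le
      _ = C := mul_one C

theorem coeFn_scal {φ : ℝ → ℂ} (hφ : Continuous φ) {C : ℝ} (hC : ∀ t, ‖φ t‖ ≤ C) (f : L2 H) :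
    scal φ f =ᵐ[volume] fun t => φ t • f t :=
  coeFn_fib (memLp_scal hφ hC) f

theorem norm_scal_le {φ : ℝ → ℂ} (hφ : Continuous φ) {C : ℝ} (hC : ∀ t, ‖φ t‖ ≤ C) :
    ‖(scal φ : L2 H →L[ℂ] L2 H)‖ ≤ C := by
  refine norm_fib_le (memLp_scal hφ hC) fun t => ?_
  rw [norm_smul]
  calc ‖φ t‖ * ‖ContinuousLinearMap.id ℂ H‖ ≤ C * 1 := by
        gcongr
        · exact (norm_nonneg _).trans (hC t)
        · exact hC t
        · exact ContinuousLinearMap.norm_id_le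
    _ = C := mul_one C

theorem lift_smul_apply (c : ℂ) (T : H →L[ℂ] H) (f : L2 H) : lift (c • T) f = c • lift T f := by
  rw [lift, ContinuousLinearMap.smul_compLpL, smul_apply]

theorem lift_id_apply (f : L2 H) : lift (ContinuousLinearMap.id ℂ H) f = f :=
  Lp.ext ((ContinuousLinearMap.id ℂ H).coeFn_compLpL f)

variable [CompleteSpace H]

theorem HasL2Deriv.scal {φ : ℝ → ℂ} (hφ : ContDiff ℝ 1 φ) {C C' : ℝ} (hC : ∀ t, ‖φ t‖ ≤ C)
    (hC' : ∀ t, ‖deriv φ t‖ ≤ C') {f h : L2 H} (hf : HasL2Deriv f h) :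
    HasL2Deriv (scal φ f) (scal (deriv φ) f + scal φ h) := by
  refine hf.contDiff_smul hφ (coeFn_scal hφ.continuous hC f) ?_
  filter_upwards [coeFn_scal hφ.continuous hC h, coeFn_scal (hφ.continuous_deriv le_rfl) hC' f,
    Lp.coeFn_add (ModelOperator.scal (deriv φ) f) (ModelOperator.scal φ h)] with t h1 h2 h3
  rw [h3, Pi.add_apply, h1, h2]

/-- σ = ±1 treats the operator and its formal adjoint at once: σ Q is the inverse of σ A. The
function f = σ Q Γ l solves f' + σ A f - ib f = l. -/
theorem exists_signed_inverse {A : H →ₗ.[ℂ] H} (hA : IsSelfAdjoint A) {Q : H →L[ℂ] H}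
    (hQ : ∀ x, (Q x, x) ∈ A.graph) {σ : ℝ} (hσ : σ * σ = 1) (b : ℝ) :
    ∃ Γ : L2 H →L[ℂ] L2 H, ∀ l,
      HasL2Deriv ((σ : ℂ) • lift Q (Γ l))
        (l - Γ l + (b * Complex.I) • ((σ : ℂ) • lift Q (Γ l))) := by
  have hadj : ContinuousLinearMap.adjoint Q = Q := by
    symm
    rw [ContinuousLinearMap.eq_adjoint_iff]
    intro x y
    exact ((IsSelfAdjoint.isSymm hA) _ _ _ _ (hQ x) (hQ y)).symm
  have hσ' : (σ : ℂ) * σ = 1 := by exact_mod_cast hσ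
  obtain ⟨Γ, hΓ⟩ := exists_inverse_of_skew (Q := (σ : ℂ) • Q) (by
    rw [map_smulₛₗ, hadj, Complex.conj_ofReal]) (fun g h hh => by
      rw [lift_smul_apply] at hh
      have h1 := hh.smul σ
      rw [smul_smul, hσ', one_smul] at h1
      have h2 := re_inner_eq_zero_of_hasL2Deriv hA (J := Q) (C := ContinuousLinearMap.id ℂ H) hQ h1
      rw [lift_id_apply, inner_smul_left, Complex.conj_ofReal, Complex.re_ofReal_mul] at h2
      rcases mul_eq_zero.1 h2 with h3 | h3
      · rw [h3] at hσ; norm_num at hσ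
      · exact h3) b
  refine ⟨Γ, fun l => ?_⟩
  have := hΓ l
  rwa [lift_smul_apply] at this

/-- The range of `d/dt + σ P(t) - i b`, written in terms of the regularized variable `g`, is closed
and has finite codimension when the fibers have invertible limits at `±∞`. -/
theorem isClosed_and_finiteDimensional_of_parametrix {Am Ap : H →ₗ.[ℂ] H} (hAm : IsSelfAdjoint Am)
    (hAp : IsSelfAdjoint Ap) {R Sm Sp : H →L[ℂ] H} (hSm : ∀ x, (R (Sm x), x) ∈ Am.graph)
    (hSp : ∀ x, (R (Sp x), x) ∈ Ap.graph) {P : ℝ → H →L[ℂ] H} (hPc : Continuous P) {C : ℝ}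
    (hPC : ∀ t, ‖P t‖ ≤ C)
    (hPm : Tendsto (fun t => P t ∘L Sm - ContinuousLinearMap.id ℂ H) atBot (𝓝 0))
    (hPp : Tendsto (fun t => P t ∘L Sp - ContinuousLinearMap.id ℂ H) atTop (𝓝 0))
    (hcm : ∀ t, IsCompactOperator (P t ∘L Sm - ContinuousLinearMap.id ℂ H))
    (hcp : ∀ t, IsCompactOperator (P t ∘L Sp - ContinuousLinearMap.id ℂ H))
    {σ : ℝ} (hσ : σ * σ = 1) (b : ℝ) {X : Submodule ℂ (L2 H)}
    (hX : ∀ g h, HasL2Deriv (lift R g) h →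
      h + (σ : ℂ) • fib P g - (b * Complex.I) • lift R g ∈ X) :
    IsClosed (X : Set (L2 H)) ∧ FiniteDimensional ℂ Xᗮ := by
  have hσ' : (σ : ℂ) * σ = 1 := by exact_mod_cast hσ
  obtain ⟨Γm, hΓm⟩ := exists_signed_inverse hAm (Q := R ∘L Sm) hSm hσ b
  obtain ⟨Γp, hΓp⟩ := exists_signed_inverse hAp (Q := R ∘L Sp) hSp hσ b
  -- D is the difference of the two solution operators. The commutator with the cutoff contributes
  -- χ' D, so the slope of χ is chosen below 1 / ‖D‖.
  let D : L2 H →L[ℂ] L2 H := (σ : ℂ) • (lift (R ∘L Sp) ∘L Γp - lift (R ∘L Sm) ∘L Γm)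
  have hε : 0 < 1 / (‖D‖ + 1) := by positivity
  obtain ⟨χ, hχ, hχ1, hχ1', hχd, hχbot, hχtop⟩ := exists_cutoff hε
  let φ : ℝ → ℂ := fun t => (χ t : ℂ)
  let ψ : ℝ → ℂ := fun t => ((1 - χ t : ℝ) : ℂ)
  have hφ : ContDiff ℝ 1 φ := Complex.ofRealCLM.contDiff.comp hχ
  have hψ : ContDiff ℝ 1 ψ := Complex.ofRealCLM.contDiff.comp (contDiff_const.sub hχ)
  have hχh : ∀ t, HasDerivAt χ (deriv χ t) t := fun t =>
    (hχ.differentiable one_ne_zero).differentiableAt.hasDerivAt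
  have hφd : deriv φ = fun t => ((deriv χ t : ℝ) : ℂ) := funext fun t => (hχh t).ofReal_comp.deriv
  have hψd : deriv ψ = fun t => -((deriv χ t : ℝ) : ℂ) := funext fun t => by
    have := ((hχh t).const_sub 1).ofReal_comp.deriv
    rw [Complex.ofReal_neg] at this
    exact this
  have hφ1 : ∀ t, ‖φ t‖ ≤ 1 := fun t => by simpa [φ, Complex.norm_real] using hχ1 t
  have hψ1 : ∀ t, ‖ψ t‖ ≤ 1 := fun t => by
    simp only [ψ, Complex.norm_real]
    exact hχ1' t
  have hφd1 : ∀ t, ‖deriv φ t‖ ≤ 1 / (‖D‖ + 1) := fun t => by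
    rw [hφd, Complex.norm_real]; exact hχd t
  have hψd1 : ∀ t, ‖deriv ψ t‖ ≤ 1 / (‖D‖ + 1) := fun t => by
    rw [hψd, norm_neg, Complex.norm_real]; exact hχd t
  have hφdc := hφ.continuous_deriv le_rfl
  have hψdc := hψ.continuous_deriv le_rfl
  have hPmem := memLp_top_of_continuous hPc hPC
  let Wm : ℝ → H →L[ℂ] H := fun t => ψ t • (P t ∘L Sm - ContinuousLinearMap.id ℂ H)
  let Wp : ℝ → H →L[ℂ] H := fun t => φ t • (P t ∘L Sp - ContinuousLinearMap.id ℂ H)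
  have hWb : ∀ (S : H →L[ℂ] H) t, ‖P t ∘L S - ContinuousLinearMap.id ℂ H‖ ≤ C * ‖S‖ + 1 :=
    fun S t => (norm_sub_le _ _).trans (add_le_add
      ((ContinuousLinearMap.opNorm_comp_le _ _).trans (by gcongr; exact hPC t))
      ContinuousLinearMap.norm_id_le)
  have hWc : ∀ (S : H →L[ℂ] H), Continuous fun t => P t ∘L S - ContinuousLinearMap.id ℂ H :=
    fun S => (hPc.clm_comp continuous_const).sub continuous_const
  have hcomp : ∀ {A : H →ₗ.[ℂ] H} (_ : IsSelfAdjoint A) {S : H →L[ℂ] H}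
      (_ : ∀ x, (R (S x), x) ∈ A.graph) {Γ : L2 H →L[ℂ] L2 H} (_ : ∀ l, HasL2Deriv
        ((σ : ℂ) • lift (R ∘L S) (Γ l))
          (l - Γ l + (b * Complex.I) • ((σ : ℂ) • lift (R ∘L S) (Γ l))))
      {ξ : ℝ → ℂ} (_ : Continuous ξ)
      (_ : ∀ t, IsCompactOperator (P t ∘L S - ContinuousLinearMap.id ℂ H))
      (_ : Tendsto (fun t => ξ t • (P t ∘L S - ContinuousLinearMap.id ℂ H)) (cocompact ℝ) (𝓝 0)),
      IsCompactOperator (fib (fun t => ξ t • (P t ∘L S - ContinuousLinearMap.id ℂ H)) ∘L Γ) := by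
    intro A hA S hS Γ hΓ ξ hξ hc hlim
    refine isCompactOperator_fib_comp hA (Q := R ∘L S) hS (Γ := Γ)
      (Δ := (σ : ℂ) • (ContinuousLinearMap.id ℂ (L2 H) - Γ +
        (b * Complex.I) • ((σ : ℂ) • (lift (R ∘L S) ∘L Γ)))) (fun l => ?_) (hξ.smul (hWc S))
      (fun t => (hc t).smul (ξ t)) hlim
    have := (hΓ l).smul σ
    rw [smul_smul, hσ', one_smul] at this
    exact this
  -- At -∞ the factor P(t) Sm - 1 tends to zero; at +∞ the cutoff ψ does.
  have hWm0 : Tendsto Wm (cocompact ℝ) (𝓝 0) := by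
    rw [cocompact_eq_atBot_atTop, tendsto_sup]
    constructor
    · refine squeeze_zero_norm (fun t => ?_) (tendsto_zero_iff_norm_tendsto_zero.1 hPm)
      rw [norm_smul]
      exact mul_le_of_le_one_left (norm_nonneg _) (hψ1 t)
    · have h1 : Tendsto (fun t => ‖ψ t‖ * (C * ‖Sm‖ + 1)) atTop (𝓝 0) := by
        have h2 : Tendsto ψ atTop (𝓝 0) := by
          have := (Complex.continuous_ofReal.tendsto _).comp (hχtop.const_sub 1)
          simpa [ψ, Function.comp_def] using this
        simpa using h2.norm.mul_const (C * ‖Sm‖ + 1)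
      refine squeeze_zero_norm (fun t => ?_) h1
      rw [norm_smul]
      gcongr
      exact hWb Sm t
  have hWp0 : Tendsto Wp (cocompact ℝ) (𝓝 0) := by
    rw [cocompact_eq_atBot_atTop, tendsto_sup]
    constructor
    · have h1 : Tendsto (fun t => ‖φ t‖ * (C * ‖Sp‖ + 1)) atBot (𝓝 0) := by
        have h2 : Tendsto φ atBot (𝓝 0) := by
          have := (Complex.continuous_ofReal.tendsto _).comp hχbot
          simpa [φ, Function.comp_def] using this
        simpa using h2.norm.mul_const (C * ‖Sp‖ + 1)
      refine squeeze_zero_norm (fun t => ?_) h1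
      rw [norm_smul]
      gcongr
      exact hWb Sp t
    · refine squeeze_zero_norm (fun t => ?_) (tendsto_zero_iff_norm_tendsto_zero.1 hPp)
      rw [norm_smul]
      exact mul_le_of_le_one_left (norm_nonneg _) (hφ1 t)
  have hKm := hcomp hAm hSm hΓm hψ.continuous hcm hWm0
  have hKp := hcomp hAp hSp hΓp hφ.continuous hcp hWp0
  have hWmem : ∀ {ξ : ℝ → ℂ} (_ : Continuous ξ) (_ : ∀ t, ‖ξ t‖ ≤ 1) (S : H →L[ℂ] H),
      MemLp (fun t => ξ t • (P t ∘L S - ContinuousLinearMap.id ℂ H)) ∞ volume := fun hξ hξ1 S =>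
    memLp_top_of_continuous (hξ.smul (hWc S)) (C := C * ‖S‖ + 1) fun t => by
      rw [norm_smul]
      exact (mul_le_of_le_one_left (norm_nonneg _) (hξ1 t)).trans (hWb S t)
  refine isClosed_and_finiteDimensional_of_range_le (S := scal (deriv φ) ∘L D)
    (C := fib Wm ∘L Γm + fib Wp ∘L Γp) ?_ (hKm.add hKp) fun l => ?_
  · calc ‖scal (deriv φ) ∘L D‖ ≤ 1 / (‖D‖ + 1) * ‖D‖ :=
          (ContinuousLinearMap.opNorm_comp_le _ _).trans
            (by gcongr; exact norm_scal_le hφdc hφd1)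
      _ < 1 := by
          rw [one_div_mul_eq_div, div_lt_one (by positivity)]
          linarith
  · set fm := (σ : ℂ) • lift (R ∘L Sm) (Γm l) with hfm
    set fp := (σ : ℂ) • lift (R ∘L Sp) (Γp l) with hfp
    set hm := l - Γm l + (b * Complex.I) • fm with hhm
    set hp := l - Γp l + (b * Complex.I) • fp with hhp
    -- The glued approximate solution in the variable g; applying R gives ψ f_- + φ f_+.
    set g := scal ψ ((σ : ℂ) • lift Sm (Γm l)) + scal φ ((σ : ℂ) • lift Sp (Γp l)) with hg
    have h1 : lift R g = scal ψ fm + scal φ fp := by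
      refine Lp.ext ?_
      filter_upwards [R.coeFn_compLpL g,
        Lp.coeFn_add (scal ψ ((σ : ℂ) • lift Sm (Γm l))) (scal φ ((σ : ℂ) • lift Sp (Γp l))),
        Lp.coeFn_add (scal ψ fm) (scal φ fp),
        coeFn_scal hψ.continuous hψ1 ((σ : ℂ) • lift Sm (Γm l)),
        coeFn_scal hφ.continuous hφ1 ((σ : ℂ) • lift Sp (Γp l)),
        coeFn_scal hψ.continuous hψ1 fm, coeFn_scal hφ.continuous hφ1 fp,
        Lp.coeFn_smul (σ : ℂ) (lift Sm (Γm l)), Lp.coeFn_smul (σ : ℂ) (lift Sp (Γp l)),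
        Lp.coeFn_smul (σ : ℂ) (lift (R ∘L Sm) (Γm l)),
        Lp.coeFn_smul (σ : ℂ) (lift (R ∘L Sp) (Γp l)), Sm.coeFn_compLpL (Γm l),
        Sp.coeFn_compLpL (Γp l), (R ∘L Sm).coeFn_compLpL (Γm l), (R ∘L Sp).coeFn_compLpL (Γp l)]
        with t e1 e2 e3 e4 e5 e6 e7 e8 e9 e10 e11 e12 e13 e14 e15
      rw [e1, hg, e2, e3, Pi.add_apply, Pi.add_apply, e4, e5, e6, e7, e8, e9, hfm, hfp, e10, e11,
        Pi.smul_apply, Pi.smul_apply, Pi.smul_apply, Pi.smul_apply, e12, e13, e14, e15, map_add,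
        map_smul, map_smul, map_smul, map_smul]
      rfl
    have h2 : HasL2Deriv (lift R g)
        ((scal (deriv ψ) fm + scal ψ hm) + (scal (deriv φ) fp + scal φ hp)) := by
      rw [h1]
      exact (HasL2Deriv.scal hψ hψ1 hψd1 (hΓm l)).add (HasL2Deriv.scal hφ hφ1 hφd1 (hΓp l))
    -- Since ψ' = -φ', the operator maps the glued solution to l + φ' (f_+ - f_-) plus the two
    -- compact remainders.
    convert hX g _ h2 using 1
    rw [h1]
    have hD : D l = fp - fm := by
      simp only [D, smul_apply, sub_apply, ContinuousLinearMap.comp_apply, smul_sub, hfm, hfp]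
    simp only [add_apply, ContinuousLinearMap.comp_apply, hD]
    refine Lp.ext ?_
    filter_upwards [
      Lp.coeFn_add (l + scal (deriv φ) (fp - fm)) (fib Wm (Γm l) + fib Wp (Γp l)),
      Lp.coeFn_add l (scal (deriv φ) (fp - fm)), coeFn_scal hφdc hφd1 (fp - fm),
      Lp.coeFn_sub fp fm, Lp.coeFn_add (fib Wm (Γm l)) (fib Wp (Γp l)),
      coeFn_fib (hWmem hψ.continuous hψ1 Sm) (Γm l), coeFn_fib (hWmem hφ.continuous hφ1 Sp) (Γp l),
      Lp.coeFn_sub ((scal (deriv ψ) fm + scal ψ hm) + (scal (deriv φ) fp + scal φ hp) +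
        (σ : ℂ) • fib P g) ((b * Complex.I) • (scal ψ fm + scal φ fp)),
      Lp.coeFn_add ((scal (deriv ψ) fm + scal ψ hm) + (scal (deriv φ) fp + scal φ hp))
        ((σ : ℂ) • fib P g),
      Lp.coeFn_add (scal (deriv ψ) fm + scal ψ hm) (scal (deriv φ) fp + scal φ hp),
      Lp.coeFn_add (scal (deriv ψ) fm) (scal ψ hm), Lp.coeFn_add (scal (deriv φ) fp) (scal φ hp),
      coeFn_scal hψdc hψd1 fm, coeFn_scal hφdc hφd1 fp, coeFn_scal hψ.continuous hψ1 hm,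
      coeFn_scal hφ.continuous hφ1 hp, Lp.coeFn_smul (σ : ℂ) (fib P g), coeFn_fib hPmem g,
      Lp.coeFn_smul (b * Complex.I) (scal ψ fm + scal φ fp),
      Lp.coeFn_add (scal ψ fm) (scal φ fp), coeFn_scal hψ.continuous hψ1 fm,
      coeFn_scal hφ.continuous hφ1 fp,
      Lp.coeFn_add (scal ψ ((σ : ℂ) • lift Sm (Γm l))) (scal φ ((σ : ℂ) • lift Sp (Γp l))),
      coeFn_scal hψ.continuous hψ1 ((σ : ℂ) • lift Sm (Γm l)),
      coeFn_scal hφ.continuous hφ1 ((σ : ℂ) • lift Sp (Γp l)),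
      Lp.coeFn_smul (σ : ℂ) (lift Sm (Γm l)), Lp.coeFn_smul (σ : ℂ) (lift Sp (Γp l)),
      Sm.coeFn_compLpL (Γm l), Sp.coeFn_compLpL (Γp l),
      Lp.coeFn_add (l - Γm l) ((b * Complex.I) • fm), Lp.coeFn_sub l (Γm l),
      Lp.coeFn_smul (b * Complex.I) fm, Lp.coeFn_add (l - Γp l) ((b * Complex.I) • fp),
      Lp.coeFn_sub l (Γp l), Lp.coeFn_smul (b * Complex.I) fp]
      with t a1 a2 a3 a4 a5 a6 a7 a8 a9 a10 a11 a12 a13 a14 a15 a16 a17 a18 a19 a20 a21 a22 a23 a24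
        a25 a26 a27 a28 a29 a30 a31 a32 a33 a34 a35
    rw [a1, Pi.add_apply, a2, Pi.add_apply, a3, a4, Pi.sub_apply, a5, Pi.add_apply, a6, a7, a8, Pi.sub_apply, a9,
      Pi.add_apply, a10, Pi.add_apply, a11, a12, Pi.add_apply, Pi.add_apply, a13, a14, a15, a16,
      a17, Pi.smul_apply, a18, a19, Pi.smul_apply, a20, Pi.add_apply, a21, a22, hg, a23,
      Pi.add_apply, a24, a25, a26, a27, Pi.smul_apply, Pi.smul_apply, a28, a29, hhm, a30,
      Pi.add_apply, a31, Pi.sub_apply, a32, Pi.smul_apply, hhp, a33, Pi.add_apply, a34,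
      Pi.sub_apply, a35, Pi.smul_apply, hφd, hψd]
    have hψφ : ψ t = 1 - φ t := by simp [ψ, φ]
    simp only [smul_apply, sub_apply, ContinuousLinearMap.comp_apply, ContinuousLinearMap.id_apply,
      map_add, map_smul, hψφ]
    have hs : ∀ (c : ℂ) (x : H), (σ : ℂ) • (c • ((σ : ℂ) • x)) = c • x := fun c x => by
      rw [smul_smul, smul_smul, mul_right_comm, hσ', one_mul]
    rw [smul_add (σ : ℂ), hs, hs]
    module

end Parametrix

end ModelOperator
end

noncomputable section
namespace ModelOperator

/-! ### Fredholmness when Re z avoids both spectra. -/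

section FredholmModel

variable {H : Type*} [NormedAddCommGroup H] [InnerProductSpace ℂ H]

theorem perturb_zero (A : H →ₗ.[ℂ] H) : perturb A 0 = A := by
  apply LinearPMap.eq_of_eq_graph
  ext ⟨x, y⟩
  rw [mem_perturb_graph]
  simp

theorem fib_symbol_sub {A : H →ₗ.[ℂ] H} {K : ℝ → H →L[ℂ] H}
    (hm : MemLp (fun t => symbol A (K t)) ∞ volume) (a : ℂ)
    (hm' : MemLp (fun t => symbol A (K t) - a • resolv A Complex.I) ∞ volume) (g : L2 H) :
    fib (fun t => symbol A (K t) - a • resolv A Complex.I) g =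
      fib (fun t => symbol A (K t)) g - a • lift (resolv A Complex.I) g := by
  refine Lp.ext ?_
  filter_upwards [coeFn_fib hm g, coeFn_fib hm' g, (resolv A Complex.I).coeFn_compLpL g,
    Lp.coeFn_sub (fib (fun t => symbol A (K t)) g) (a • lift (resolv A Complex.I) g),
    Lp.coeFn_smul a (lift (resolv A Complex.I) g)] with t h1 h2 h3 h4 h5
  rw [h2, h4, Pi.sub_apply, h1, h5, Pi.smul_apply, h3]
  rfl

theorem inner_lift_resolv_fib_symbol {A : H →ₗ.[ℂ] H} (hI : Complex.I ∈ resolventSet A)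
    {K : ℝ → H →L[ℂ] H} (hm : MemLp (fun t => symbol A (K t)) ∞ volume)
    (hs : ∀ t, IsSymm (perturb A (K t))) (f g : L2 H) :
    inner ℂ (lift (resolv A Complex.I) f) (fib (fun t => symbol A (K t)) g) =
      inner ℂ (fib (fun t => symbol A (K t)) f) (lift (resolv A Complex.I) g) := by
  rw [L2.inner_def, L2.inner_def]
  refine integral_congr_ae ?_
  filter_upwards [coeFn_fib hm f, coeFn_fib hm g, (resolv A Complex.I).coeFn_compLpL f,
    (resolv A Complex.I).coeFn_compLpL g] with t h1 h2 h3 h4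
  rw [h1, h2, h3, h4]
  exact (hs t _ _ _ _ ((mem_perturb_graph_iff hI).2 ⟨_, rfl, rfl⟩)
    ((mem_perturb_graph_iff hI).2 ⟨_, rfl, rfl⟩)).symm

theorem shift_isClosed {T : H →ₗ.[ℂ] H} (hT : T.IsClosed) (z : ℂ) : (shift T z).IsClosed := by
  have : ((shift T z).graph : Set (H × H)) =
      (fun p : H × H => (p.1, p.2 + z • p.1)) ⁻¹' T.graph := by
    ext ⟨x, y⟩
    exact mem_shift_graph
  rw [LinearPMap.IsClosed, this]
  exact hT.preimage (by fun_prop)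

variable [CompleteSpace H]

theorem isSelfAdjoint_shift {A : H →ₗ.[ℂ] H} (hA : IsSelfAdjoint A) (a : ℝ) :
    IsSelfAdjoint (shift A a) := by
  have hsurj : ∀ z : ℂ, z.im ≠ 0 → ∀ w, ∃ x y, (x, y) ∈ (shift A a).graph ∧ y - z • x = w := by
    intro z hz w
    have hr : (a + z : ℂ) ∈ resolventSet A := mem_resolventSet_of_im_ne_zero hA (by simpa using hz)
    refine ⟨resolv A (a + z) w, w + z • resolv A (a + z) w, ?_, add_sub_cancel_right _ _⟩
    rw [mem_shift_graph]
    convert resolv_mem_graph hr w using 2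
    module
  refine IsSymm.isSelfAdjoint (fun x y x' y' h h' => ?_) hA.dense_domain Complex.I
    (hsurj _ (by simp)) (hsurj _ (by simp))
  rw [mem_shift_graph] at h h'
  have h1 := (IsSelfAdjoint.isSymm hA) _ _ _ _ h h'
  rw [inner_add_left, inner_add_right, inner_smul_left, inner_smul_right, Complex.conj_ofReal] at h1
  exact add_right_cancel h1

/-- The kernel of the adjoint embeds into the orthogonal complement of the range; for the kernel any
finite dimensional space containing it will do. -/
theorem isFredholm_of_orthogonal {T : H →ₗ.[ℂ] H} (hd : Dense (T.domain : Set H))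
    (hcl : T.IsClosed)
    (hr : IsClosed (LinearMap.range T.toFun : Set H))
    (hc : FiniteDimensional ℂ (LinearMap.range T.toFun)ᗮ) {Y : Submodule ℂ H}
    (hY : ∀ x, (x, 0) ∈ T.graph → x ∈ Y) (hYf : FiniteDimensional ℂ Y) : IsFredholm T := by
  refine ⟨hd, hcl, hr, ?_, ?_⟩
  · refine FiniteDimensional.of_injective (((T.domain.subtype).comp
      (LinearMap.ker T.toFun).subtype).codRestrict Y fun x => hY _ ?_) ?_
    · have := T.mem_graph x.1
      rwa [show T x.1 = 0 from x.2] at this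
    · intro x y hxy
      have h1 : ((x : T.domain) : H) = y := congrArg (Y.subtype) hxy
      exact Subtype.ext (Subtype.ext h1)
  · refine FiniteDimensional.of_injective (((T†).domain.subtype.comp
      (LinearMap.ker (T†).toFun).subtype).codRestrict (LinearMap.range T.toFun)ᗮ fun x => ?_) ?_
    · rw [Submodule.mem_orthogonal']
      rintro _ ⟨y, rfl⟩
      have h1 := LinearPMap.adjoint_isFormalAdjoint hd x.1 y
      rw [show (T†) x.1 = 0 from x.2, inner_zero_left] at h1
      exact h1.symm
    · intro x y hxy
      have h1 : ((x : (T†).domain) : H) = y :=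
        congrArg (LinearMap.range T.toFun)ᗮ.subtype hxy
      exact Subtype.ext (Subtype.ext h1)

/-- `d/dt + A(t) - z` is Fredholm if `Re z` is in the resolvent sets of the limits of `A(t)`. -/
theorem isFredholm_shift_modelOp {A : H →ₗ.[ℂ] H} (hA : IsSelfAdjoint A) {B : ℝ → H →ₗ.[ℂ] H}
    {K : ℝ → H →L[ℂ] H} (hB : ∀ t, A + B t = perturb A (K t)) (hKc : Continuous K) {C : ℝ}
    (hKC : ∀ t, ‖K t‖ ≤ C) (hKcpt : ∀ t, IsCompactOperator (K t))
    (hs : ∀ t, IsSymm (perturb A (K t))) {Kp : H →L[ℂ] H} (hbot : Tendsto K atBot (𝓝 0))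
    (htop : Tendsto K atTop (𝓝 Kp)) (hKp : IsCompactOperator Kp)
    (hAp : IsSelfAdjoint (perturb A Kp)) (hcl : (modelOp A B).IsClosed) {a : ℝ} (b : ℝ)
    (ham : (a : ℂ) ∈ resolventSet A) (hap : (a : ℂ) ∈ resolventSet (perturb A Kp)) :
    IsFredholm (shift (modelOp A B) (a + b * Complex.I)) := by
  have hI : Complex.I ∈ resolventSet A := mem_resolventSet_of_im_ne_zero hA (by simp)
  set R := resolv A Complex.I with hR
  set z : ℂ := a + b * Complex.I with hz
  have hsb : ∀ t, ‖symbol A (K t)‖ ≤ ‖ContinuousLinearMap.id ℂ H + Complex.I • R‖ + C := fun t =>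
    (norm_add_le _ _).trans (by gcongr; exact hKC t)
  have hsc : Continuous fun t => symbol A (K t) := continuous_const.add hKc
  have hm := memLp_top_of_continuous hsc hsb
  have hd := dense_domain_modelOp hA hB hm
  let P : ℝ → H →L[ℂ] H := fun t => symbol A (K t) - (a : ℂ) • R
  have hPc : Continuous P := hsc.sub continuous_const
  have hPC : ∀ t, ‖P t‖ ≤ ‖ContinuousLinearMap.id ℂ H + Complex.I • R‖ + C + ‖(a : ℂ) • R‖ :=
    fun t => (norm_sub_le _ _).trans (by gcongr; exact hsb t)
  have hPm := memLp_top_of_continuous hPc hPC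
  -- S = (A - i)(A_F - a)⁻¹, so that R S inverts A_F - a. Then P(t) S - 1 = (K(t) - F) S is compact
  -- and vanishes at the end where K → F.
  have hS : ∀ {F : H →L[ℂ] H}, (a : ℂ) ∈ resolventSet (perturb A F) → IsCompactOperator F →
      ∃ S : H →L[ℂ] H, (∀ x, (R (S x), x) ∈ (shift (perturb A F) a).graph) ∧
        (∀ t, P t ∘L S - ContinuousLinearMap.id ℂ H = (K t - F) ∘L S) ∧
        ∀ t, IsCompactOperator (P t ∘L S - ContinuousLinearMap.id ℂ H) := by
    intro F hF hFc
    obtain ⟨S, hS1, hS2⟩ := exists_resolv_perturb_eq hI hF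
    have h1 : ∀ t, P t ∘L S - ContinuousLinearMap.id ℂ H = (K t - F) ∘L S := fun t => by
      ext x
      have h2 := hS2 x
      simp only [P, sub_apply, ContinuousLinearMap.comp_apply, symbol_apply, smul_apply,
        ContinuousLinearMap.id_apply]
      nth_rw 5 [← h2]
      abel
    refine ⟨S, fun x => ?_, h1, fun t => ?_⟩
    · rw [mem_shift_graph, hS1]
      exact resolv_mem_graph hF x
    · rw [h1]
      exact ((hKcpt t).sub hFc).comp_clm S
  obtain ⟨Sm, hSm, hSm1, hSm2⟩ := hS (F := 0) (by rwa [perturb_zero]) isCompactOperator_zero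
  obtain ⟨Sp, hSp, hSp1, hSp2⟩ := hS hap hKp
  have hlim : ∀ {l : Filter ℝ} {F S : H →L[ℂ] H}, Tendsto K l (𝓝 F) →
      Tendsto (fun t => (K t - F) ∘L S) l (𝓝 0) := by
    intro l F S hF
    have h1 := hF.sub_const F
    rw [sub_self] at h1
    have h2 : Continuous fun L : H →L[ℂ] H => L ∘L S := by fun_prop
    have h3 := (h2.tendsto 0).comp h1
    rw [ContinuousLinearMap.zero_comp] at h3
    exact h3
  have main : ∀ {σ : ℝ} (_ : σ * σ = 1) {X : Submodule ℂ (L2 H)}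
      (_ : ∀ g h, HasL2Deriv (lift R g) h →
        h + (σ : ℂ) • fib P g - (b * Complex.I) • lift R g ∈ X),
      IsClosed (X : Set (L2 H)) ∧ FiniteDimensional ℂ Xᗮ := fun {σ} hσ {X} hX =>
    isClosed_and_finiteDimensional_of_parametrix
      (isSelfAdjoint_shift (by rwa [perturb_zero]) a) (isSelfAdjoint_shift hAp a) hSm hSp hPc hPC
      (by simp only [hSm1]; exact hlim hbot) (by simp only [hSp1]; exact hlim htop) hSm2 hSp2
      hσ b hX
  obtain ⟨hr, hrf⟩ := main (σ := 1) (by norm_num)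
    (X := LinearMap.range (shift (modelOp A B) z).toFun) fun g h hgh => by
      have h1 := (mem_graph_modelOp hI hB hm).2 ⟨g, h, rfl, hgh, rfl⟩
      have h2 : (lift R g, h + fib (fun t => symbol A (K t)) g - z • lift R g) ∈
          (shift (modelOp A B) z).graph := by
        rw [mem_shift_graph, sub_add_cancel]; exact h1
      obtain ⟨p, -, hp⟩ := (LinearPMap.mem_graph_iff _).1 h2
      refine ⟨p, hp.trans ?_⟩
      rw [fib_symbol_sub hm a hPm g, hz, Complex.ofReal_one, one_smul, add_smul, ← hR]
      abel_nf
  let Y : Submodule ℂ (L2 H) := LinearMap.ker ((shift (modelOp A B) z).toFun) |>.map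
    (shift (modelOp A B) z).domain.subtype
  have hY : ∀ x, (x, 0) ∈ (shift (modelOp A B) z).graph → x ∈ Y := fun x hx => by
    obtain ⟨p, hp1, hp2⟩ := (LinearPMap.mem_graph_iff _).1 hx
    exact ⟨p, hp2, hp1⟩
  have hY' : ∀ x ∈ Y, (x, z • x) ∈ (modelOp A B).graph := fun x hx => by
    obtain ⟨p, hp1, rfl⟩ := hx
    have h1 := (shift (modelOp A B) z).mem_graph p
    rw [show (shift (modelOp A B) z) p = 0 from hp1, mem_shift_graph, zero_add] at h1
    exact h1
  -- For σ = -1 the operator is, up to sign, the formal adjoint -d/dt + A(t) - conj z. Its range is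
  -- orthogonal to the kernel Y, so the double complement of Y, and with it Y, is finite
  -- dimensional.
  obtain ⟨-, hkf⟩ := main (σ := -1) (by norm_num) (X := Yᗮ) fun g h hgh => by
    rw [Submodule.mem_orthogonal]
    intro f hf
    obtain ⟨g', h', rfl, hh', hl⟩ := (mem_graph_modelOp hI hB hm).1 (hY' f hf)
    have h1 := hh'.inner_add_inner hgh
    have h2 := inner_lift_resolv_fib_symbol hI hm hs g' g
    have h3 : inner ℂ h' (lift R g) + inner ℂ (fib (fun t => symbol A (K t)) g') (lift R g) =
        starRingEnd ℂ z * inner ℂ (lift R g') (lift R g) := by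
      rw [← inner_add_left, hl, inner_smul_left]
    have h4 : starRingEnd ℂ z = a - b * Complex.I := by
      simp [hz]; ring
    rw [fib_symbol_sub hm a hPm g, inner_sub_right, inner_add_right, inner_smul_right,
      inner_smul_right, inner_sub_right, inner_smul_right, h2]
    rw [h4] at h3
    push_cast
    linear_combination h1 - h3
  exact isFredholm_of_orthogonal hd (shift_isClosed hcl z) hr hrf
    (fun x hx => Submodule.le_orthogonal_orthogonal Y (hY x hx)) hkf

end FredholmModel

/-! ### Singular Weyl sequences exclude Fredholmness. -/

section Weyl

variable {E : Type*} [NormedAddCommGroup E] [InnerProductSpace ℂ E] [CompleteSpace E]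

/-- A Fredholm operator has no singular Weyl sequences. -/
theorem not_isFredholm_of_weyl {T : E →ₗ.[ℂ] E}
    (h : ∀ ε > 0, ∃ (f l : ℕ → E) (M : ℝ), 0 < M ∧ (∀ n, (f n, l n) ∈ T.graph) ∧
      (∀ n, ‖f n‖ = M) ∧ (∀ᶠ n in atTop, ‖l n‖ ≤ ε * M) ∧
      ∀ u, Tendsto (fun n => inner ℂ (f n) u) atTop (𝓝 0)) : ¬ IsFredholm T := by
  rintro ⟨-, hcl, hr, hk, -⟩
  have hTc : IsClosed (T.graph : Set (E × E)) := hcl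
  have : CompleteSpace T.graph := hTc.completeSpace_coe
  have : CompleteSpace (LinearMap.range T.toFun) := hr.completeSpace_coe
  let π : T.graph →L[ℂ] LinearMap.range T.toFun :=
    ((ContinuousLinearMap.snd ℂ E E) ∘L T.graph.subtypeL).codRestrict _ fun p => by
      obtain ⟨q, -, hq⟩ := (LinearPMap.mem_graph_iff _).1 p.2
      exact ⟨q, hq⟩
  have hπ : Function.Surjective π := by
    rintro ⟨_, q, rfl⟩
    exact ⟨⟨(q, T q), T.mem_graph q⟩, rfl⟩
  -- The open mapping constant C fixes ε = 1 / (4C): each l n then has a preimage of norm at most M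
  -- / 4.
  obtain ⟨C, hC, hCπ⟩ := π.exists_preimage_norm_le hπ
  let N : Submodule ℂ E := (LinearMap.ker T.toFun).map T.domain.subtype
  have hN : FiniteDimensional ℂ N := Module.Finite.map _ _
  have hNmem : ∀ x, (x, 0) ∈ T.graph → x ∈ N := fun x hx => by
    obtain ⟨p, hp1, hp2⟩ := (LinearPMap.mem_graph_iff _).1 hx
    exact ⟨p, hp2, hp1⟩
  obtain ⟨f, l, M, hM, hfl, hfM, hlM, hw⟩ := h (1 / (4 * C)) (by positivity)
  have hcpt : IsCompactOperator N.starProjection := by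
    have := isCompactOperator_starProjection_comp N (ContinuousLinearMap.id ℂ E)
    rwa [ContinuousLinearMap.comp_id] at this
  -- Weak convergence to zero makes the projections of f n onto the finite dimensional kernel tend
  -- to zero, so f n, a kernel element plus a small preimage, has norm at most 3M / 4.
  have h1 := tendsto_comp_of_isCompactOperator (T := fun n => innerSL ℂ (f n)) (C := M)
    (fun n => by rw [innerSL_apply_norm, hfM]) (fun u => hw u) hcpt (l := atTop)
  have h2 : ∀ n, ‖N.starProjection (f n)‖ ^ 2 ≤ ‖innerSL ℂ (f n) ∘L N.starProjection‖ * M := by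
    intro n
    have h3 := (innerSL ℂ (f n) ∘L N.starProjection).le_opNorm (f n)
    rw [hfM] at h3
    refine le_trans (le_of_eq ?_) h3
    have h4 : inner ℂ (f n) (N.starProjection (f n)) =
        inner ℂ (N.starProjection (f n)) (N.starProjection (f n)) := by
      have h5 := Submodule.starProjection_inner_eq_zero (K := N) (f n) (N.starProjection (f n))
        (N.starProjection_apply_mem (f n))
      rw [inner_sub_left, sub_eq_zero] at h5
      exact h5
    rw [ContinuousLinearMap.comp_apply, innerSL_apply_apply, h4, inner_self_eq_norm_sq_to_K,
      norm_pow]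
    simp
  obtain ⟨n, hn1, hn2⟩ := ((h1.eventually_lt_const (show (0 : ℝ) < M / 16 by positivity)).and
    hlM).exists
  have h3 : ‖N.starProjection (f n)‖ ≤ M / 4 := by
    refine abs_le_of_sq_le_sq' ?_ (by positivity) |>.2
    nlinarith [h2 n]
  obtain ⟨p, hp1, hp2⟩ := hCπ (π ⟨(f n, l n), hfl n⟩)
  have hpl : (p : E × E).2 = l n := congrArg Subtype.val hp1
  have h4 : ‖(p : E × E).1‖ ≤ M / 4 := by
    have h5 : ‖(p : E × E).1‖ ≤ ‖p‖ := norm_fst_le (p : E × E)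
    have h6 : ‖π ⟨(f n, l n), hfl n⟩‖ = ‖l n‖ := rfl
    rw [h6] at hp2
    calc _ ≤ C * ‖l n‖ := h5.trans hp2
      _ ≤ C * (1 / (4 * C) * M) := by gcongr
      _ = M / 4 := by field_simp
  have h5 : f n - (p : E × E).1 ∈ N := by
    refine hNmem _ ?_
    convert T.graph.sub_mem (hfl n) p.2 using 1
    ext
    · rfl
    · simp [hpl]
  have h6 : N.starProjection (f n - (p : E × E).1) = f n - (p : E × E).1 :=
    Submodule.starProjection_eq_self_iff.2 h5
  have h7 : ‖f n - (p : E × E).1‖ ≤ M / 4 + M / 4 := by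
    rw [← h6, map_sub]
    refine (norm_sub_le _ _).trans (add_le_add h3 (le_trans ?_ h4))
    exact N.norm_starProjection_apply_le _
  have h8 : ‖f n‖ ≤ ‖f n - (p : E × E).1‖ + ‖(p : E × E).1‖ := by
    calc ‖f n‖ = ‖f n - (p : E × E).1 + (p : E × E).1‖ := by rw [sub_add_cancel]
      _ ≤ _ := norm_add_le _ _
  rw [hfM] at h8
  linarith

end Weyl

end ModelOperator
end

noncomputable section
namespace ModelOperator

/-! ### Weyl sequences for the model operator. -/

theorem integrable_sq_of_hasCompactSupport {φ : ℝ → ℝ} (hφ : Continuous φ)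
    (hc : HasCompactSupport φ) : Integrable fun t => φ t ^ 2 := by
  have h1 : Continuous fun t => φ t ^ 2 := hφ.pow 2
  exact h1.integrable_of_hasCompactSupport (hc.comp_left (g := fun s => s ^ 2) (by simp))

/-- Stretching a bump by ρ multiplies ∫ φ² by ρ and ∫ φ'² by 1 / ρ. -/
theorem exists_bump {ε : ℝ} (hε : 0 < ε) : ∃ φ : ℝ → ℝ, ContDiff ℝ 1 φ ∧ HasCompactSupport φ ∧
    0 < ∫ t, φ t ^ 2 ∧ ∫ t, deriv φ t ^ 2 ≤ ε ^ 2 * ∫ t, φ t ^ 2 := by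
  let χ : ContDiffBump (0 : ℝ) := ⟨1, 2, by norm_num, by norm_num⟩
  have hχ : ContDiff ℝ 1 χ := χ.contDiff
  have hχc : HasCompactSupport χ := χ.hasCompactSupport
  set m := ∫ t, χ t ^ 2 with hmdef
  set k := ∫ t, deriv χ t ^ 2
  have hm : 0 < m := by
    refine Continuous.integral_pos_of_hasCompactSupport_nonneg_nonzero (x := 0) (by fun_prop)
      ?_ (fun t => sq_nonneg _) ?_
    · exact hχc.comp_left (g := fun s => s ^ 2) (by simp)
    · rw [χ.one_of_mem_closedBall (Metric.mem_closedBall_self χ.rIn_pos.le)]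
      norm_num
  have hk : 0 ≤ k := integral_nonneg fun t => sq_nonneg _
  obtain ⟨ρ, hρ, hρk⟩ : ∃ ρ : ℝ, 0 < ρ ∧ k ≤ ε ^ 2 * m * ρ ^ 2 := by
    have hp : 0 < ε ^ 2 * m := by positivity
    refine ⟨1 + k / (ε ^ 2 * m), by positivity, ?_⟩
    calc k = ε ^ 2 * m * (k / (ε ^ 2 * m)) := by field_simp
      _ ≤ ε ^ 2 * m * (1 + k / (ε ^ 2 * m)) ^ 2 := by
        gcongr
        nlinarith [show 0 ≤ k / (ε ^ 2 * m) by positivity]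
  have hd : ∀ t, deriv (fun t => χ (t / ρ)) t = deriv χ (t / ρ) / ρ := fun t => by
    have h1 : HasDerivAt (fun t : ℝ => t / ρ) (1 / ρ) t := (hasDerivAt_id t).div_const ρ
    have h2 := (hχ.differentiable one_ne_zero (t / ρ)).hasDerivAt.comp t h1
    exact h2.deriv.trans (by ring)
  have h1 : ∫ t, χ (t / ρ) ^ 2 = ρ * m := by
    rw [Measure.integral_comp_div (fun t => χ t ^ 2), abs_of_pos hρ, smul_eq_mul]
  have h2 : ∫ t, (deriv χ (t / ρ) / ρ) ^ 2 = k / ρ := by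
    rw [Measure.integral_comp_div (fun t => (deriv χ t / ρ) ^ 2), abs_of_pos hρ, smul_eq_mul]
    simp only [div_pow, integral_div]
    change ρ * (k / ρ ^ 2) = k / ρ
    field_simp
  refine ⟨fun t => χ (t / ρ), hχ.comp (contDiff_id.div_const ρ), ?_, ?_, ?_⟩
  · have := hχc.comp_homeomorph (Homeomorph.mulRight₀ ρ⁻¹ (inv_ne_zero hρ.ne'))
    simpa [Function.comp_def, div_eq_mul_inv] using this
  · rw [h1]; positivity
  · simp only [hd, h1, h2]
    rw [div_le_iff₀ hρ]
    linarith

section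

variable {H : Type*} [NormedAddCommGroup H] [InnerProductSpace ℂ H]

/-- A bounded sequence in `L²(ℝ; H)` whose supports leave every point tends weakly to zero. -/
theorem tendsto_inner_of_eventually_notMem {f : ℕ → L2 H} {M : ℝ} (hM : ∀ n, ‖f n‖ ≤ M)
    {J : ℕ → Set ℝ} (hJ : ∀ n, MeasurableSet (J n))
    (hf : ∀ n, ∀ᵐ t : ℝ, t ∉ J n → f n t = 0) (hJt : ∀ t, ∀ᶠ n in atTop, t ∉ J n) (u : L2 H) :
    Tendsto (fun n => inner ℂ (f n) u) atTop (𝓝 0) := by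
  have hM0 : 0 ≤ M := (norm_nonneg _).trans (hM 0)
  let w : ℕ → L2 H := fun n => ((Lp.memLp u).indicator (hJ n)).toLp
  have hw : ∀ n, w n =ᵐ[volume] (J n).indicator u := fun n => MemLp.coeFn_toLp _
  have h1 : ∀ n, inner ℂ (f n) u = inner ℂ (f n) (w n) := fun n => by
    rw [L2.inner_def, L2.inner_def]
    refine integral_congr_ae ?_
    filter_upwards [hw n, hf n] with t h2 h3
    rw [h2]
    by_cases ht : t ∈ J n
    · rw [Set.indicator_of_mem ht]
    · rw [h3 ht, inner_zero_left, inner_zero_left]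
  have h2 : Tendsto (fun n => ‖w n‖ ^ 2) atTop (𝓝 0) := by
    have h3 : Tendsto (fun n => ∫ t, ‖w n t‖ ^ 2) atTop (𝓝 (∫ _ : ℝ, (0 : ℝ))) := by
      refine tendsto_integral_of_dominated_convergence (fun t => ‖u t‖ ^ 2)
        (fun n => (L2.integrable_norm_sq (w n)).aestronglyMeasurable) (L2.integrable_norm_sq u)
        (fun n => ?_) ?_
      · filter_upwards [hw n] with t ht
        rw [ht, Real.norm_of_nonneg (sq_nonneg _)]
        gcongr
        exact norm_indicator_le_norm_self _ _
      · filter_upwards [ae_all_iff.2 hw] with t ht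
        refine tendsto_const_nhds.congr' ?_
        filter_upwards [hJt t] with n hn
        rw [ht n, Set.indicator_of_notMem hn, norm_zero, zero_pow two_ne_zero]
    rw [integral_zero] at h3
    simpa only [L2.norm_sq_eq] using h3
  have h4 : Tendsto (fun n => ‖w n‖) atTop (𝓝 0) := by
    have := h2.sqrt
    simpa only [Real.sqrt_sq (norm_nonneg _), Real.sqrt_zero] using this
  refine squeeze_zero_norm (fun n => ?_) (by simpa using h4.const_mul M)
  rw [h1]
  refine (norm_inner_le_norm _ _).trans ?_
  gcongr
  exact hM n

variable [CompleteSpace H]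

/-- Otherwise A - a is bounded below, and as a is real this is also the bound at its conjugate, so a
would be in the resolvent set. -/
theorem exists_approx_eigenvector {A : H →ₗ.[ℂ] H} (hA : IsSelfAdjoint A) {a : ℝ}
    (ha : (a : ℂ) ∉ resolventSet A) {η : ℝ} (hη : 0 < η) :
    ∃ x y, (x, y) ∈ A.graph ∧ x ≠ 0 ∧ ‖y - (a : ℂ) • x‖ ≤ η * ‖x‖ := by
  by_contra! h
  have h1 : ∀ x y, (x, y) ∈ A.graph → η * ‖x‖ ≤ ‖y - (a : ℂ) • x‖ := fun x y hxy => by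
    rcases eq_or_ne x 0 with rfl | hx
    · simp
    · exact (h x y hxy hx).le
  exact ha (mem_resolventSet_of_bound hA hη h1 (by simpa only [Complex.conj_ofReal] using h1))

/-- If the perturbations `K` are close to `F` on windows of any width around `τ n`, which escape to
infinity, then `d/dt + A(t) - z` is not Fredholm whenever `Re z` is in the spectrum of the
perturbation of `A` by `F`. -/
theorem not_isFredholm_shift_modelOp {A : H →ₗ.[ℂ] H} (hI : Complex.I ∈ resolventSet A)
    {B : ℝ → H →ₗ.[ℂ] H} {K : ℝ → H →L[ℂ] H} (hB : ∀ t, A + B t = perturb A (K t))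
    (hm : MemLp (fun t => symbol A (K t)) ∞ volume) {F : H →L[ℂ] H}
    (hF : IsSelfAdjoint (perturb A F)) {τ : ℕ → ℝ}
    (hτF : ∀ r δ, 0 < δ → ∀ᶠ n in atTop, ∀ t, |t - τ n| ≤ r → ‖K t - F‖ ≤ δ)
    (hτ : ∀ t r, ∀ᶠ n in atTop, r < |t - τ n|) {a : ℝ} (b : ℝ)
    (ha : (a : ℂ) ∉ resolventSet (perturb A F)) :
    ¬ IsFredholm (shift (modelOp A B) (a + b * Complex.I)) := by
  refine not_isFredholm_of_weyl fun ε hε => ?_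
  obtain ⟨x, y, hxy, hx, hxa⟩ := exists_approx_eigenvector hF ha (η := ε / 4) (by positivity)
  obtain ⟨v, rfl, rfl⟩ := (mem_perturb_graph_iff hI).1 hxy
  obtain ⟨φ, hφ, hφc, hφ0, hφd⟩ := exists_bump (ε := ε / 4) (by positivity)
  set R := resolv A Complex.I with hR
  set z : ℂ := a + b * Complex.I with hz
  set m := ∫ t, φ t ^ 2
  have hx0 : 0 < ‖R v‖ := norm_pos_iff.2 hx
  obtain ⟨r, hr⟩ : ∃ r, ∀ t, r < |t| → φ t = 0 ∧ deriv φ t = 0 := by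
    obtain ⟨r, hr⟩ := hφc.isCompact.isBounded.subset_closedBall (0 : ℝ)
    refine ⟨r, fun t ht => ?_⟩
    have h1 : t ∉ tsupport φ := fun h => by
      have := hr h
      rw [mem_closedBall_zero_iff, Real.norm_eq_abs] at this
      linarith
    exact ⟨image_eq_zero_of_notMem_tsupport h1, by_contra fun h => h1 (support_deriv_subset h)⟩
  let e : ℝ → ℂ := fun t => Complex.exp (b * Complex.I * t)
  have he : ∀ t, ‖e t‖ = 1 := fun t => by
    simp only [e, Complex.norm_exp]
    simp
  have hed : ∀ t, HasDerivAt e (b * Complex.I * e t) t := fun t => by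
    have h1 : HasDerivAt (fun t : ℝ => b * Complex.I * (t : ℂ)) (b * Complex.I) t := by
      simpa using (Complex.ofRealCLM.hasDerivAt (x := t)).const_mul (b * Complex.I)
    simpa [e, mul_comm] using h1.cexp
  -- The factor exp(ibt) cancels the imaginary part of z, leaving only φ' and the error of the
  -- approximate eigenvector.
  let ψ : ℕ → ℝ → ℂ := fun n t => e t * (φ (t - τ n) : ℂ)
  have hψd : ∀ n t, HasDerivAt (ψ n)
      (e t * (deriv φ (t - τ n) + b * Complex.I * φ (t - τ n))) t := fun n t => by
    have h1 : HasDerivAt (fun t => φ (t - τ n)) (deriv φ (t - τ n)) t := by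
      simpa using (hφ.differentiable one_ne_zero (t - τ n)).hasDerivAt.comp_sub_const t (τ n)
    refine ((hed t).mul h1.ofReal_comp).congr_deriv ?_
    ring
  have hψ : ∀ n, ContDiff ℝ 1 (ψ n) := fun n => by
    refine ContDiff.mul ?_ ?_
    · exact (contDiff_const.mul Complex.ofRealCLM.contDiff).cexp
    · exact Complex.ofRealCLM.contDiff.comp (hφ.comp (contDiff_id.sub contDiff_const))
  have hψc : ∀ n, HasCompactSupport (ψ n) := fun n => by
    have h1 : HasCompactSupport fun t => φ (t - τ n) := by
      have := hφc.comp_homeomorph (Homeomorph.subRight (τ n))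
      exact this
    exact (h1.comp_left (g := Complex.ofReal) (by simp)).mul_left
  choose p q hp hq hpq using fun n => exists_hasL2Deriv_smul (hψ n) (hψc n) v
  let f : ℕ → L2 H := fun n => lift R (p n)
  let l : ℕ → L2 H := fun n => lift R (q n) + fib (fun t => symbol A (K t)) (p n) - z • f n
  have hf : ∀ n, f n =ᵐ[volume] fun t => ψ n t • R v := fun n => by
    filter_upwards [R.coeFn_compLpL (p n), hp n] with t h1 h2
    rw [h1, h2, map_smul]
  have hl : ∀ n, l n =ᵐ[volume] fun t => e t • (((deriv φ (t - τ n) : ℝ) : ℂ) • R v +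
      (φ (t - τ n) : ℂ) • (symbol A F v - (a : ℂ) • R v + (K t - F) v)) := fun n => by
    filter_upwards [R.coeFn_compLpL (q n), hq n, coeFn_fib hm (p n), hp n, hf n,
      Lp.coeFn_sub (lift R (q n) + fib (fun t => symbol A (K t)) (p n)) (z • f n),
      Lp.coeFn_add (lift R (q n)) (fib (fun t => symbol A (K t)) (p n)),
      Lp.coeFn_smul z (f n)] with t h1 h2 h3 h4 h5 h6 h7 h8
    have h9 : symbol A (K t) v = symbol A F v + (K t - F) v := by
      rw [symbol_apply, symbol_apply, sub_apply]
      abel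
    rw [h6, Pi.sub_apply, h7, Pi.add_apply, h8, Pi.smul_apply, h1, h2, h3, h4, h5, map_smul,
      map_smul, h9, (hψd n t).deriv]
    simp only [ψ, hz]
    module
  have hfn : ∀ n, ‖f n‖ = √(m * ‖R v‖ ^ 2) := fun n => by
    rw [← Real.sqrt_sq (norm_nonneg (f n)), L2.norm_sq_eq]
    congr 1
    have h1 : ∫ t, ‖f n t‖ ^ 2 = ∫ t, φ (t - τ n) ^ 2 * ‖R v‖ ^ 2 := by
      refine integral_congr_ae ((hf n).mono fun t ht => ?_)
      simp only [ht, ψ, norm_smul, norm_mul, he, one_mul, mul_pow, Complex.norm_real,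
        Real.norm_eq_abs, sq_abs]
    rw [h1, integral_sub_right_eq_self (fun t => φ t ^ 2 * ‖R v‖ ^ 2) (τ n), integral_mul_const]
  have hi1 : Integrable fun t => φ t ^ 2 := integrable_sq_of_hasCompactSupport hφ.continuous hφc
  have hi2 : Integrable fun t => deriv φ t ^ 2 :=
    integrable_sq_of_hasCompactSupport (hφ.continuous_deriv le_rfl) hφc.deriv
  refine ⟨f, l, √(m * ‖R v‖ ^ 2), by positivity, fun n => ?_, hfn, ?_, ?_⟩
  · rw [mem_shift_graph, sub_add_cancel]
    exact (mem_graph_modelOp hI hB hm).2 ⟨p n, _, rfl, hasL2Deriv_lift R (hpq n), rfl⟩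
  · have hδ : 0 < ε / 4 * ‖R v‖ / (‖v‖ + 1) := by positivity
    filter_upwards [hτF r _ hδ] with n hn
    -- The eigenvector error and K(t) - F each contribute ε/4 times |φ|; squaring uses (x + y)² ≤
    -- 2x² + 2y².
    have h1 : ∀ t, ‖e t • (((deriv φ (t - τ n) : ℝ) : ℂ) • R v +
        (φ (t - τ n) : ℂ) • (symbol A F v - (a : ℂ) • R v + (K t - F) v))‖ ^ 2 ≤
        (2 * deriv φ (t - τ n) ^ 2 + ε ^ 2 / 2 * φ (t - τ n) ^ 2) * ‖R v‖ ^ 2 := fun t => by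
      rcases lt_or_ge r |t - τ n| with ht | ht
      · rw [(hr _ ht).1, (hr _ ht).2]
        simp
      · have h2 : ‖(K t - F) v‖ ≤ ε / 4 * ‖R v‖ := by
          calc ‖(K t - F) v‖ ≤ ε / 4 * ‖R v‖ / (‖v‖ + 1) * ‖v‖ :=
                (K t - F).le_of_opNorm_le (hn t ht) v
            _ ≤ ε / 4 * ‖R v‖ / (‖v‖ + 1) * (‖v‖ + 1) := by gcongr; linarith
            _ = ε / 4 * ‖R v‖ := by field_simp
        have h3 : ‖e t • (((deriv φ (t - τ n) : ℝ) : ℂ) • R v +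
            (φ (t - τ n) : ℂ) • (symbol A F v - (a : ℂ) • R v + (K t - F) v))‖ ≤
            (|deriv φ (t - τ n)| + ε / 2 * |φ (t - τ n)|) * ‖R v‖ := by
          rw [norm_smul, he, one_mul]
          refine (norm_add_le _ _).trans ?_
          rw [norm_smul, norm_smul, Complex.norm_real, Complex.norm_real, Real.norm_eq_abs,
            Real.norm_eq_abs]
          have h4 := (norm_add_le (symbol A F v - (a : ℂ) • R v) ((K t - F) v)).trans
            (add_le_add hxa h2)
          have h5 := mul_le_mul_of_nonneg_left h4 (abs_nonneg (φ (t - τ n)))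
          linarith
        calc _ ≤ ((|deriv φ (t - τ n)| + ε / 2 * |φ (t - τ n)|) * ‖R v‖) ^ 2 := by gcongr
          _ ≤ _ := by
            rw [mul_pow]
            gcongr
            have h6 := add_sq_le (a := |deriv φ (t - τ n)|) (b := ε / 2 * |φ (t - τ n)|)
            rw [mul_pow, sq_abs, sq_abs] at h6
            linarith
    have h7 : ‖l n‖ ^ 2 ≤ (ε * √(m * ‖R v‖ ^ 2)) ^ 2 := by
      rw [L2.norm_sq_eq, mul_pow, Real.sq_sqrt (by positivity)]
      have hi3 : Integrable fun t => (2 * deriv φ t ^ 2 + ε ^ 2 / 2 * φ t ^ 2) * ‖R v‖ ^ 2 :=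
        ((hi2.const_mul 2).add (hi1.const_mul _)).mul_const _
      calc ∫ t, ‖l n t‖ ^ 2
          ≤ ∫ t, (2 * deriv φ (t - τ n) ^ 2 + ε ^ 2 / 2 * φ (t - τ n) ^ 2) * ‖R v‖ ^ 2 := by
            refine integral_mono_ae (L2.integrable_norm_sq _) (hi3.comp_sub_right (τ n)) ?_
            filter_upwards [hl n] with t ht
            rw [ht]
            exact h1 t
        _ = ∫ t, (2 * deriv φ t ^ 2 + ε ^ 2 / 2 * φ t ^ 2) * ‖R v‖ ^ 2 :=
            integral_sub_right_eq_self
              (fun t => (2 * deriv φ t ^ 2 + ε ^ 2 / 2 * φ t ^ 2) * ‖R v‖ ^ 2) (τ n)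
        _ = (2 * (∫ t, deriv φ t ^ 2) + ε ^ 2 / 2 * m) * ‖R v‖ ^ 2 := by
            rw [integral_mul_const, integral_add (hi2.const_mul 2) (hi1.const_mul _),
              integral_const_mul, integral_const_mul]
        _ ≤ (2 * ((ε / 4) ^ 2 * m) + ε ^ 2 / 2 * m) * ‖R v‖ ^ 2 := by gcongr
        -- 2 (ε/4)² + ε²/2 = 5ε²/8.
        _ ≤ ε ^ 2 * (m * ‖R v‖ ^ 2) := by
            have : 0 ≤ ε ^ 2 * (m * ‖R v‖ ^ 2) := by positivity
            linarith
    exact abs_le_of_sq_le_sq' h7 (by positivity) |>.2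
  · refine tendsto_inner_of_eventually_notMem (J := fun n => {t | |t - τ n| ≤ r})
      (fun n => (hfn n).le) (fun n => ?_) (fun n => ?_) fun t => ?_
    · exact (isClosed_le (by fun_prop) continuous_const).measurableSet
    · filter_upwards [hf n] with t ht hn
      rw [ht]
      simp only [ψ]
      rw [(hr _ (not_le.1 hn)).1]
      simp
    · filter_upwards [hτ t r] with n hn
      exact not_le.2 hn

end

end ModelOperator
end

noncomputable section
namespace ModelOperator

/-! ### The essential spectrum and the main theorem. -/

section

variable {H : Type*} [NormedAddCommGroup H] [InnerProductSpace ℂ H]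

theorem IsWeakPrimitive.norm_le [CompleteSpace H]
    [TopologicalSpace.SeparableSpace H] {K K' : ℝ → H →L[ℂ] H}
    (hK : IsWeakPrimitive K K') (t : ℝ) : ‖K t‖ ≤ (∫⁻ s, ‖K' s‖ₑ).toReal := by
  have h1 := hK.enorm_comp_le (ContinuousLinearMap.id ℂ H) t
  simp only [ContinuousLinearMap.comp_id] at h1
  rw [← toReal_enorm]
  exact ENNReal.toReal_mono hK.lintegral_lt_top.ne h1

theorem NormResolventTendsto.unique {A : ℝ → H →ₗ.[ℂ] H} {l : Filter ℝ} [l.NeBot]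
    {S T : H →ₗ.[ℂ] H} (hS : NormResolventTendsto A l S) (hT : NormResolventTendsto A l T) :
    S = T := by
  have h1 := hS Complex.I (by simp)
  have h2 := hT Complex.I (by simp)
  exact eq_of_resolv_eq h1.2.1 h2.2.1 (tendsto_nhds_unique h1.2.2 h2.2.2)

/-- The spectrum is real, so membership depends only on Re z. -/
theorem mem_spec_add_imAxis [CompleteSpace H] {A : H →ₗ.[ℂ] H} (hA : IsSelfAdjoint A) (z : ℂ) :
    z ∈ spec A + imAxis ↔ ((z.re : ℝ) : ℂ) ∉ resolventSet A := by
  constructor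
  · rintro ⟨w, hw, _, ⟨μ, rfl⟩, rfl⟩
    have h1 : w.im = 0 := by_contra fun h => hw (mem_resolventSet_of_im_ne_zero hA h)
    convert hw using 2
    apply Complex.ext <;> simp [h1]
  · intro h
    refine ⟨_, h, _, ⟨z.im, rfl⟩, ?_⟩
    change (z.re : ℂ) + Complex.I * z.im = z
    rw [mul_comm]
    exact Complex.re_add_im z

variable [CompleteSpace H]

/-- The Weyl windows are centred at n for the limit at +∞ and at -n for the limit at -∞, where the
perturbation is F = 0. -/
theorem essSpec_modelOp {A : H →ₗ.[ℂ] H} (hA : IsSelfAdjoint A) {B : ℝ → H →ₗ.[ℂ] H}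
    {K : ℝ → H →L[ℂ] H} (hB : ∀ t, A + B t = perturb A (K t)) (hKc : Continuous K) {C : ℝ}
    (hKC : ∀ t, ‖K t‖ ≤ C) (hKcpt : ∀ t, IsCompactOperator (K t))
    (hs : ∀ t, IsSymm (perturb A (K t))) {Kp : H →L[ℂ] H} (hbot : Tendsto K atBot (𝓝 0))
    (htop : Tendsto K atTop (𝓝 Kp)) (hKp : IsCompactOperator Kp)
    (hAp : IsSelfAdjoint (perturb A Kp)) (hcl : (modelOp A B).IsClosed)
    (hm : MemLp (fun t => symbol A (K t)) ∞ volume) :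
    essSpec (modelOp A B) = (spec (perturb A Kp) + imAxis) ∪ (spec A + imAxis) := by
  have hI : Complex.I ∈ resolventSet A := mem_resolventSet_of_im_ne_zero hA (by simp)
  ext z
  rw [Set.mem_union, mem_spec_add_imAxis hAp, mem_spec_add_imAxis hA]
  change ¬ IsFredholm (shift (modelOp A B) z) ↔ _
  constructor
  · intro h
    by_contra! h1
    have h2 := isFredholm_shift_modelOp hA hB hKc hKC hKcpt hs hbot htop hKp hAp hcl z.im
      h1.2 h1.1
    rw [Complex.re_add_im] at h2
    exact h h2
  · intro h
    rw [← Complex.re_add_im z]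
    rcases h with h | h
    · refine not_isFredholm_shift_modelOp hI hB hm hAp (τ := fun n => (n : ℝ))
        (fun r δ hδ => ?_) (fun t r => ?_) z.im h
      · have h1 : ∀ᶠ t in atTop, ‖K t - Kp‖ ≤ δ := by
          filter_upwards [Metric.tendsto_nhds.1 htop δ hδ] with t ht
          rw [← dist_eq_norm]
          exact ht.le
        obtain ⟨s, h2⟩ := eventually_atTop.1 h1
        filter_upwards [tendsto_natCast_atTop_atTop.eventually_ge_atTop (s + r)] with n hn t ht
        refine h2 t ?_
        linarith [(abs_le.1 ht).1]
      · filter_upwards [tendsto_natCast_atTop_atTop.eventually_gt_atTop (t + r)] with n hn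
        rw [abs_sub_comm]
        exact lt_of_lt_of_le (by linarith) (le_abs_self _)
    · refine not_isFredholm_shift_modelOp hI hB hm (F := 0) (by rwa [perturb_zero])
        (τ := fun n => -(n : ℝ)) (fun r δ hδ => ?_) (fun t r => ?_) z.im (by rwa [perturb_zero])
      · have h1 : ∀ᶠ t in atBot, ‖K t - 0‖ ≤ δ := by
          filter_upwards [Metric.tendsto_nhds.1 hbot δ hδ] with t ht
          rw [← dist_eq_norm]
          exact ht.le
        obtain ⟨s, h2⟩ := eventually_atBot.1 h1
        filter_upwards [tendsto_natCast_atTop_atTop.eventually_ge_atTop (r - s)] with n hn t ht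
        refine h2 t ?_
        linarith [(abs_le.1 ht).2]
      · filter_upwards [tendsto_natCast_atTop_atTop.eventually_gt_atTop (r - t)] with n hn
        exact lt_of_lt_of_le (by linarith) (le_abs_self _)

end

end ModelOperator
end

theorem corollaryc2p8 {H : Type*} [NormedAddCommGroup H] [InnerProductSpace ℂ H] [CompleteSpace H]
    [TopologicalSpace.SeparableSpace H] (Aminus : H →ₗ.[ℂ] H) (B B' : ℝ → H →ₗ.[ℂ] H)
    (hyp : ModelOperator.RelTraceClassFamily Aminus B B') :
    (∃! Aplus : H →ₗ.[ℂ] H, IsSelfAdjoint Aplus ∧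
      ModelOperator.NormResolventTendsto (fun t => Aminus + B t) atTop Aplus) ∧
    Dense ((ModelOperator.modelOp Aminus B).domain : Set (ModelOperator.L2 H)) ∧
    (ModelOperator.modelOp Aminus B).IsClosed ∧
    ∀ Aplus : H →ₗ.[ℂ] H, IsSelfAdjoint Aplus →
      ModelOperator.NormResolventTendsto (fun t => Aminus + B t) atTop Aplus →
      ModelOperator.essSpec (ModelOperator.modelOp Aminus B) =
        (ModelOperator.spec Aplus + ModelOperator.imAxis) ∪
          (ModelOperator.spec Aminus + ModelOperator.imAxis) := by
  open ModelOperator in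
  have hA := hyp.selfAdjoint
  have hI : Complex.I ∈ resolventSet Aminus := mem_resolventSet_of_im_ne_zero hA (by simp)
  obtain ⟨K, K', hKB, hK⟩ := isWeakPrimitive_of_relTraceClassFamily hyp
  have hB : ∀ t, Aminus + B t = perturb Aminus (K t) := fun t => add_eq_perturb hI (hKB t)
  have hs : ∀ t, IsSymm (perturb Aminus (K t)) := fun t => by
    rw [← hB]
    exact (IsSelfAdjoint.isSymm hA).add (isSymm_iff.2 (hyp.symm t))
  have hKc := hK.continuous
  have hKcpt := hK.isCompactOperator
  obtain ⟨Kp, htop⟩ := hK.exists_tendsto hK.tendsto_integral_Iic_atTop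
  have hKp : IsCompactOperator Kp := isCompactOperator_of_tendsto htop
    (Eventually.of_forall fun t => hKcpt t)
  have hsa : ∀ t, IsSelfAdjoint (perturb Aminus (K t)) := fun t =>
    isSelfAdjoint_perturb hA (hKcpt t) (hs t)
  have hAp : IsSelfAdjoint (perturb Aminus Kp) :=
    isSelfAdjoint_perturb hA hKp (isSymm_perturb_of_tendsto htop hs)
  have hlim : NormResolventTendsto (fun t => Aminus + B t) atTop (perturb Aminus Kp) := by
    simp only [hB]
    exact normResolventTendsto_perturb hI htop hsa hAp
  have hKm := memLp_top_of_continuous hKc hK.norm_le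
  have hm : MemLp (fun t => symbol Aminus (K t)) ∞ volume :=
    memLp_top_of_continuous (continuous_const.add hKc) fun t =>
      (norm_add_le _ _).trans (add_le_add_right (hK.norm_le t) _)
  have hcl := isClosed_modelOp hA hB hKm hm fun T hT hlimT =>
    (hK.eventually_norm_comp_le hT hlimT (by norm_num)).exists
  refine ⟨⟨_, ⟨hAp, hlim⟩, fun S hS => hS.2.unique hlim⟩, dense_domain_modelOp hA hB hm, hcl,
    fun S _ hS => ?_⟩
  rw [hS.unique hlim]
  exact essSpec_modelOp hA hB hKc hK.norm_le hKcpt hs hK.tendsto_zero_atBot htop hKp hAp hcl hm
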